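/- Let $k\ge 0$ be an integer and let $G$ be a finite simple graph with two distinct vertices $x,y$. Write $G+xy$ for the graph obtained from $G$ by adding the edge $xy$ (so $G+xy=G$ if $xy$ is already an edge) and $G-xy$ for the graph obtained from $G$ by removing the edge $xy$ (so $G-xy=G$ if $xy$ is not an edge). Suppose that $G+xy$ is 2-connected, i.e. it has at least three vertices, is connected, and remains connected after the deletion of any one vertex. Suppose moreover that every vertex of $G$ other than $x$ and $y$ has degree at least $k+1$ in $G$, and that every edge $uv\in E(G)$ with $\{u,v\}\cap\{x,y\}=\emptyset$ satisfies $d_G(u)+d_G(v)\ge 2k+3$. Then $G-xy$ contains either $k+1$ paths from $x$ to $y$ whose lengths are consecutive integers $a,a+1,\dots,a+k$ for some $a$, or $k$ paths from $x$ to $y$ whose lengths form an arithmetic progression $a,a+2,\dots,a+2(k-1)$ with common difference two for some $a$. (Here the length of a path is its number of edges; for $k=0$ the second alternative is an empty requirement.) -/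

import Mathlib

/-- A graph is 2-connected if it has at least three vertices, is connected, and stays connected
after the deletion of any single vertex. -/
def SimpleGraph.IsTwoConnected {V : Type*} (G : SimpleGraph V) : Prop :=
  3 ≤ Nat.card V ∧ G.Connected ∧ ∀ v : V, (G.induce {w | w ≠ v}).Connected

/-- `G + xy`: the graph `G` with the edge `xy` added (and `G` itself if `xy` is already an edge). -/
def SimpleGraph.addEdge {V : Type*} (G : SimpleGraph V) (x y : V) : SimpleGraph V :=
  G ⊔ SimpleGraph.edge x y

/-- `G - xy`: the graph `G` with the edge `xy` removed (and `G` itself if `xy` is not an edge). -/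
def SimpleGraph.removeEdge {V : Type*} (G : SimpleGraph V) (x y : V) : SimpleGraph V :=
  G.deleteEdges {s(x, y)}

/-- `G` contains `m` paths from `x` to `y` whose lengths (numbers of edges) are
`a, a + d, …, a + (m - 1) d` for some `a`. -/
def SimpleGraph.HasPathsInProgression {V : Type*} (G : SimpleGraph V) (x y : V) (m d : ℕ) : Prop :=
  ∃ (a : ℕ) (P : Fin m → G.Path x y), ∀ i : Fin m, (P i : G.Walk x y).length = a + d * (i : ℕ)

/-! Delete `x` and `y` and remember only their neighbourhoods `α` and `β` in the remaining set `W`.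
The lengths sought become lengths of paths inside `W` from `α` to `β`, and the weighted degree still
counts the edges to the two roots. The proof is an induction on the size of `W`, for all `α`, `β`
and `k` at once.

In a minimal counterexample, take near the first root a core `H` inside which many path lengths lead
to `α`. Contract `H`, or a part `E` of it, to a new first root for the part `C` of `W \ H` joined to
`β`. If every vertex of `C` loses at most `l` in weighted degree, induction applies to `C` with `k -
l`; the bound `2 * k + 3` on edges drops by at most `2 * l`, which is what the smaller parameter
needs. Lengths in the core are then added to lengths in `C`: `p + 1` consecutive ones raise the
parameter by `p` (`GoodSet.add_consecutive`), and `p` of equal parity raise it by `p - 1`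
(`GoodSet.add_even`). A core succeeds when it returns what its contraction costs. If the contraction
is not 2-connected, a pendant set hangs on the rest of `C` by at most one vertex and avoids `E`;
this set is rooted at another part of the core instead (`Piece.rooted_or_pendant`,
`Piece.pendant_rooted`).

Three kinds of core occur. Maximal cliques in `α` show that `α` is independent
(`MinBad.indep_left`). Cliques with two or three common neighbours in `α` show that no edge has two
such neighbours (`MinBad.no_diamond`). Complete bipartite graphs with more than half of their
vertices in `α` then lose little under contraction and finish the proof (`Piece.good_bipartite`,
`MinBad.false`). Each kind of core fails only if `β` lies inside it. Exchanging the roots then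
nearly identifies the two neighbourhoods, and a neighbour of the second root can replace it
(`MinBad.reroot`), or a leftover part attached to few vertices is a smaller instance. -/

section RootedPaths

open scoped Classical

/-! ### Rooted sets: the problem with both roots deleted -/

namespace SimpleGraph

variable {V : Type*} (G : SimpleGraph V)

/-- There is a path of length `n` from `a` to `b` all of whose vertices lie in `S`. -/
def PathIn : Finset V → V → V → ℕ → Prop
  | S, a, b, 0 => a = b ∧ a ∈ S
  | S, a, b, n + 1 => a ∈ S ∧ ∃ c, G.Adj a c ∧ PathIn (S.erase a) c b n

/-- The vertices with a neighbour in `E`. -/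
def nbr (E : Finset V) : Set V := {v | ∃ e ∈ E, G.Adj e v}

/-- The lengths of the paths from `α` to `β` inside `W`. -/
def Lens (W : Finset V) (α β : Set V) : Set ℕ := {n | ∃ a ∈ α, ∃ b ∈ β, G.PathIn W a b n}

/-- The number of neighbours of `v` in `S`. -/
noncomputable def degIn (S : Finset V) (v : V) : ℕ := (S.filter (G.Adj v)).card

/-- The degree of `v` in `W` with two additional vertices joined to `α` and `β`. -/
noncomputable def wdeg (W : Finset V) (α β : Set V) (v : V) : ℕ :=
  G.degIn W v + (if v ∈ α then 1 else 0) + (if v ∈ β then 1 else 0)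

/-- `W` together with two additional adjacent vertices joined to `α` and `β` is 2-connected, and
satisfies the degree conditions with parameter `k`. -/
structure Rooted (W : Finset V) (α β : Set V) (k : ℕ) : Prop where
  nonempty : W.Nonempty
  closed : ∀ D ⊆ W, D.Nonempty → (∀ v ∈ D, ∀ w ∈ W, G.Adj v w → w ∈ D) →
    (∃ v ∈ D, v ∈ α) ∧ ∃ v ∈ D, v ∈ β
  cut : ∀ D ⊆ W, D.Nonempty → (∀ v ∈ D, v ∉ α) → (∀ v ∈ D, v ∉ β) →
    ∀ c, ∃ v ∈ D, ∃ w ∈ W, G.Adj v w ∧ w ∉ D ∧ w ≠ c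
  deg : ∀ v ∈ W, k + 1 ≤ G.wdeg W α β v
  sum : ∀ u ∈ W, ∀ v ∈ W, G.Adj u v → 2 * k + 3 ≤ G.wdeg W α β u + G.wdeg W α β v

end SimpleGraph

/-! ### Sums of progressions -/

/-- `L` contains `k + 1` consecutive integers, or `k` terms of a progression of difference two. -/
def GoodSet (k : ℕ) (L : Set ℕ) : Prop :=
  (∃ a, ∀ i ≤ k, a + i ∈ L) ∨ ∃ a, ∀ i < k, a + 2 * i ∈ L

namespace GoodSet

theorem mono {k l : ℕ} {L M : Set ℕ} (h : GoodSet k L) (hl : l ≤ k) (c : ℕ)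
    (hLM : ∀ n ∈ L, n + c ∈ M) : GoodSet l M := by
  rcases h with ⟨a, ha⟩ | ⟨a, ha⟩
  · refine Or.inl ⟨a + c, fun i hi => ?_⟩
    have := hLM _ (ha i (by omega))
    rwa [show a + c + i = a + i + c by omega]
  · refine Or.inr ⟨a + c, fun i hi => ?_⟩
    have := hLM _ (ha i (by omega))
    rwa [show a + c + 2 * i = a + 2 * i + c by omega]

/-- If `B` has step two and `1 ≤ p`, the sums fill an interval of `p + 2 * q - 1` integers. This is
at least `p + q + 1` exactly when `2 ≤ q`, which is why every later contraction must leave a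
parameter of at least two. -/
theorem add_consecutive {p q k : ℕ} {B L : Set ℕ} {a₀ : ℕ} (hB : GoodSet q B) (hq : 2 ≤ q)
    (hk : k ≤ p + q) (c : ℕ) (h : ∀ i ≤ p, ∀ n ∈ B, a₀ + i + n + c ∈ L) : GoodSet k L := by
  rcases hB with ⟨b, hb⟩ | ⟨b, hb⟩
  · refine Or.inl ⟨a₀ + b + c, fun i hi => ?_⟩
    by_cases hip : i ≤ p
    · have := h i hip _ (hb 0 (by omega))
      rwa [show a₀ + b + c + i = a₀ + i + (b + 0) + c by omega]
    · have := h p le_rfl _ (hb (i - p) (by omega))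
      rwa [show a₀ + b + c + i = a₀ + p + (b + (i - p)) + c by omega]
  · rcases Nat.eq_zero_or_pos p with rfl | hp
    · refine Or.inr ⟨a₀ + b + c, fun i hi => ?_⟩
      have := h 0 le_rfl _ (hb i (by omega))
      rwa [show a₀ + b + c + 2 * i = a₀ + 0 + (b + 2 * i) + c by omega]
    · refine Or.inl ⟨a₀ + b + c, fun i hi => ?_⟩
      by_cases hip : i / 2 < q
      · have := h (i % 2) (by omega) _ (hb (i / 2) hip)
        rwa [show a₀ + b + c + i = a₀ + i % 2 + (b + 2 * (i / 2)) + c by omega]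
      · have := h (i - 2 * (q - 1)) (by omega) _ (hb (q - 1) (by omega))
        rwa [show a₀ + b + c + i = a₀ + (i - 2 * (q - 1)) + (b + 2 * (q - 1)) + c by omega]

/-- Two progressions of step two with `p` and `q` terms have only `p + q - 1` distinct sums
guaranteed, so one unit is lost against `add_consecutive`. In exchange `1 ≤ q` is enough: a
consecutive `B` then contains both parities. -/
theorem add_even {p q k : ℕ} {B L : Set ℕ} {a₀ : ℕ} (hB : GoodSet q B) (hp : 1 ≤ p) (hq : 1 ≤ q)
    (hk : k + 1 ≤ p + q) (c : ℕ) (h : ∀ i < p, ∀ n ∈ B, a₀ + 2 * i + n + c ∈ L) :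
    GoodSet k L := by
  rcases hB with ⟨b, hb⟩ | ⟨b, hb⟩
  · refine Or.inl ⟨a₀ + b + c, fun i hi => ?_⟩
    by_cases hip : i / 2 < p
    · have := h (i / 2) hip _ (hb (i % 2) (by omega))
      rwa [show a₀ + b + c + i = a₀ + 2 * (i / 2) + (b + i % 2) + c by omega]
    · have := h (p - 1) (by omega) _ (hb (i - 2 * (p - 1)) (by omega))
      rwa [show a₀ + b + c + i = a₀ + 2 * (p - 1) + (b + (i - 2 * (p - 1))) + c by omega]
  · refine Or.inr ⟨a₀ + b + c, fun i hi => ?_⟩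
    by_cases hip : i < p
    · have := h i hip _ (hb 0 (by omega))
      rwa [show a₀ + b + c + 2 * i = a₀ + 2 * i + (b + 2 * 0) + c by omega]
    · have := h (p - 1) (by omega) _ (hb (i - (p - 1)) (by omega))
      rwa [show a₀ + b + c + 2 * i = a₀ + 2 * (p - 1) + (b + 2 * (i - (p - 1))) + c by omega]

theorem add {p q k : ℕ} {A B L : Set ℕ} (hA : GoodSet p A) (hB : GoodSet q B) (hp : 2 ≤ p)
    (hq : 2 ≤ q) (hk : k + 1 ≤ p + q) (c : ℕ) (h : ∀ m ∈ A, ∀ n ∈ B, m + n + c ∈ L) :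
    GoodSet k L := by
  rcases hA with ⟨a, ha⟩ | ⟨a, ha⟩
  · exact hB.add_consecutive (p := p) (a₀ := a) hq (by omega) c
      (fun i hi n hn => h _ (ha i hi) n hn)
  · exact hB.add_even (p := p) (a₀ := a) (by omega) (by omega) hk c
      (fun i hi n hn => h _ (ha i hi) n hn)

end GoodSet

namespace SimpleGraph

variable {V : Type*} {G : SimpleGraph V}

/-! ### Paths inside a vertex set -/

namespace PathIn

variable {S T : Finset V} {a b c : V} {n m : ℕ}

theorem mem_left (h : G.PathIn S a b n) : a ∈ S := by
  cases n with
  | zero => exact h.2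
  | succ n => exact h.1

theorem mem_right (h : G.PathIn S a b n) : b ∈ S := by
  induction n generalizing S a with
  | zero => exact h.1 ▸ h.2
  | succ n ih =>
    obtain ⟨_, c, _, hc⟩ := h
    exact Finset.mem_of_mem_erase (ih hc)

theorem refl (h : a ∈ S) : G.PathIn S a a 0 := ⟨rfl, h⟩

theorem mono (h : G.PathIn S a b n) (hST : S ⊆ T) : G.PathIn T a b n := by
  induction n generalizing S T a with
  | zero => exact ⟨h.1, hST h.2⟩
  | succ n ih =>
    obtain ⟨ha, c, hac, hc⟩ := h
    exact ⟨hST ha, c, hac, ih hc (Finset.erase_subset_erase _ hST)⟩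

theorem cons (h : G.PathIn S b c n) (hab : G.Adj a b) (ha : a ∈ T) (haS : a ∉ S) (hST : S ⊆ T) :
    G.PathIn T a c (n + 1) :=
  ⟨ha, b, hab, h.mono fun _ hv => Finset.mem_erase.2 ⟨fun h' => haS (h' ▸ hv), hST hv⟩⟩

theorem append (h : G.PathIn S a b n) (h' : G.PathIn T b c m) (hST : ∀ v ∈ S, v ∈ T → v = b) :
    G.PathIn (S ∪ T) a c (n + m) := by
  induction n generalizing S a with
  | zero =>
    obtain ⟨rfl, ha⟩ := h
    rw [Nat.zero_add]
    exact h'.mono Finset.subset_union_right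
  | succ n ih =>
    obtain ⟨ha, d, had, hd⟩ := h
    have key := ih hd fun v hv => hST v (Finset.mem_of_mem_erase hv)
    rw [show n + 1 + m = n + m + 1 by omega]
    refine ⟨Finset.mem_union_left _ ha, d, had, key.mono fun v hv => ?_⟩
    have hb := hd.mem_right
    rw [Finset.mem_erase] at hb ⊢
    rw [Finset.mem_union, Finset.mem_erase] at hv
    rw [Finset.mem_union]
    rcases hv with ⟨h1, h2⟩ | h2
    · exact ⟨h1, Or.inl h2⟩
    · refine ⟨?_, Or.inr h2⟩
      rintro rfl
      exact hb.1 (hST v ha h2).symm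

theorem join (h : G.PathIn S a b n) {d : V} (hbd : G.Adj b d) (h' : G.PathIn T d c m)
    (hST : Disjoint S T) : G.PathIn (S ∪ T) a c (n + m + 1) := by
  have h1 : G.PathIn (insert b T) b c (m + 1) :=
    h'.cons hbd (Finset.mem_insert_self _ _)
      (fun hb => (Finset.disjoint_left.1 hST h.mem_right hb)) (Finset.subset_insert _ _)
  have h2 := h.append h1 (fun _ hv hv' => (Finset.mem_insert.1 hv').resolve_right
    (Finset.disjoint_left.1 hST hv))
  rw [show n + m + 1 = n + (m + 1) by omega]
  refine h2.mono (Finset.union_subset Finset.subset_union_left (Finset.insert_subset ?_ ?_))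
  · exact Finset.mem_union_left _ h.mem_right
  · exact Finset.subset_union_right

theorem symm (h : G.PathIn S a b n) : G.PathIn S b a n := by
  induction n generalizing S a with
  | zero => obtain ⟨rfl, ha⟩ := h; exact ⟨rfl, ha⟩
  | succ n ih =>
    obtain ⟨ha, c, hac, hc⟩ := h
    have h1 := (ih hc).join hac.symm (refl (G := G) (Finset.mem_singleton_self a))
      (Finset.disjoint_singleton_right.2 (Finset.notMem_erase a S))
    refine h1.mono (Finset.union_subset (Finset.erase_subset _ _) ?_)
    simpa using ha

theorem extend (h : G.PathIn S a b n) (hbc : G.Adj b c) (hc : c ∈ S) :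
    ∃ m, G.PathIn S a c m := by
  induction n generalizing S a with
  | zero =>
    obtain ⟨rfl, ha⟩ := h
    exact ⟨1, ha, c, hbc, rfl, Finset.mem_erase.2 ⟨hbc.ne', hc⟩⟩
  | succ n ih =>
    obtain ⟨ha, d, had, hd⟩ := h
    by_cases hca : c = a
    · exact ⟨0, hca.symm, ha⟩
    · obtain ⟨m, hm⟩ := ih hd (Finset.mem_erase.2 ⟨hca, hc⟩)
      exact ⟨m + 1, ha, d, had, hm⟩

/-- The part of a path after its last vertex in `E`. -/
theorem last (h : G.PathIn S a b n) (E : Finset V) :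
    G.PathIn (S \ E) a b n ∨ ∃ e ∈ E, ∃ m, G.PathIn (insert e (S \ E)) e b m := by
  induction n generalizing S a with
  | zero =>
    obtain ⟨rfl, ha⟩ := h
    by_cases haE : a ∈ E
    · exact Or.inr ⟨a, haE, 0, refl (Finset.mem_insert_self _ _)⟩
    · exact Or.inl (refl (Finset.mem_sdiff.2 ⟨ha, haE⟩))
  | succ n ih =>
    obtain ⟨ha, d, had, hd⟩ := h
    have hsub : S.erase a \ E ⊆ S \ E := Finset.sdiff_subset_sdiff (Finset.erase_subset _ _) le_rfl
    have hnot : a ∉ S.erase a \ E := fun h => Finset.notMem_erase a S (Finset.mem_sdiff.1 h).1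
    rcases ih hd with h1 | ⟨e, he, m, h1⟩
    · by_cases haE : a ∈ E
      · exact Or.inr ⟨a, haE, n + 1, h1.cons had (Finset.mem_insert_self _ _) hnot
          (hsub.trans (Finset.subset_insert _ _))⟩
      · exact Or.inl (h1.cons had (Finset.mem_sdiff.2 ⟨ha, haE⟩) hnot hsub)
    · exact Or.inr ⟨e, he, m, h1.mono (Finset.insert_subset_insert _ hsub)⟩

theorem last_of_mem (h : G.PathIn S a b n) {E : Finset V} (ha : a ∈ E) :
    ∃ e ∈ E, ∃ m, G.PathIn (insert e (S \ E)) e b m := by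
  rcases h.last E with h1 | h1
  · exact absurd ha (Finset.mem_sdiff.1 h1.mem_left).2
  · exact h1

/-- A path that starts in `D` and ends outside `D` leaves `D`. -/
theorem exists_edge (h : G.PathIn S a b n) {D : Finset V} (ha : a ∈ D) (hb : b ∉ D) :
    ∃ v ∈ D, ∃ w ∈ S, G.Adj v w ∧ w ∉ D := by
  induction n generalizing S a with
  | zero => exact absurd (h.1 ▸ ha) hb
  | succ n ih =>
    obtain ⟨_, d, had, hd⟩ := h
    by_cases hdD : d ∈ D
    · obtain ⟨v, hv, w, hw, h1⟩ := ih hd hdD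
      exact ⟨v, hv, w, Finset.mem_of_mem_erase hw, h1⟩
    · exact ⟨a, ha, d, Finset.mem_of_mem_erase hd.mem_left, had, hdD⟩

end PathIn

/-! ### Components and degrees -/

/-- A vertex is joined to `β` inside `S` if every closed subset of `S` containing it meets `β`. -/
theorem exists_pathIn {S : Finset V} {a : V} (ha : a ∈ S) {β : Set V}
    (h : ∀ D ⊆ S, a ∈ D → (∀ v ∈ D, ∀ w ∈ S, G.Adj v w → w ∈ D) → ∃ b ∈ D, b ∈ β) :
    ∃ b ∈ β, ∃ n, G.PathIn S a b n := by
  obtain ⟨b, hb, hbβ⟩ := h (S.filter fun v => ∃ n, G.PathIn S a v n) (Finset.filter_subset _ _)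
    (Finset.mem_filter.2 ⟨ha, 0, PathIn.refl ha⟩) (by
      intro v hv w hw hvw
      obtain ⟨_, n, hn⟩ := Finset.mem_filter.1 hv
      exact Finset.mem_filter.2 ⟨hw, hn.extend hvw hw⟩)
  exact ⟨b, hbβ, (Finset.mem_filter.1 hb).2⟩

/-- The set of vertices of `S` joined to `β` inside `S`. -/
noncomputable def compOf (G : SimpleGraph V) (S : Finset V) (β : Set V) : Finset V :=
  S.filter fun v => ∃ b ∈ β, ∃ n, G.PathIn S v b n

theorem compOf_subset {S : Finset V} {β : Set V} : G.compOf S β ⊆ S := Finset.filter_subset _ _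

theorem mem_compOf_of_mem {S : Finset V} {β : Set V} {v : V} (hv : v ∈ S) (h : v ∈ β) :
    v ∈ G.compOf S β :=
  Finset.mem_filter.2 ⟨hv, v, h, 0, PathIn.refl hv⟩

theorem compOf_closed {S : Finset V} {β : Set V} {v w : V} (hv : v ∈ G.compOf S β) (hw : w ∈ S)
    (hvw : G.Adj v w) : w ∈ G.compOf S β := by
  obtain ⟨_, b, hb, n, hn⟩ := Finset.mem_filter.1 hv
  obtain ⟨m, hm⟩ := hn.symm.extend hvw hw
  exact Finset.mem_filter.2 ⟨hw, b, hb, m, hm.symm⟩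

/-- A nonempty subset of the component either meets `β` or has an edge to the rest of it. -/
theorem compOf_edge {S : Finset V} {β : Set V} {D : Finset V} (hD : D ⊆ G.compOf S β)
    (hne : D.Nonempty) (hβ : ∀ v ∈ D, v ∉ β) :
    ∃ v ∈ D, ∃ w ∈ G.compOf S β, G.Adj v w ∧ w ∉ D := by
  obtain ⟨v, hv⟩ := hne
  obtain ⟨_, b, hb, n, hn⟩ := Finset.mem_filter.1 (hD hv)
  obtain ⟨u, hu, w, hw, huw, hwD⟩ := hn.exists_edge hv fun hbD => hβ b hbD hb
  exact ⟨u, hu, w, compOf_closed (hD hu) hw huw, huw, hwD⟩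

theorem degIn_union {A B : Finset V} (h : Disjoint A B) (v : V) :
    G.degIn (A ∪ B) v = G.degIn A v + G.degIn B v := by
  rw [degIn, Finset.filter_union, Finset.card_union_of_disjoint
    (Finset.disjoint_filter_filter h)]
  rfl

theorem degIn_mono {A B : Finset V} (h : A ⊆ B) (v : V) : G.degIn A v ≤ G.degIn B v :=
  Finset.card_le_card (Finset.filter_subset_filter _ h)

theorem degIn_le_card (A : Finset V) (v : V) : G.degIn A v ≤ A.card := Finset.card_filter_le _ _

theorem degIn_pos {A : Finset V} {v : V} : 0 < G.degIn A v ↔ ∃ w ∈ A, G.Adj v w := by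
  rw [degIn, Finset.card_pos]
  simp [Finset.Nonempty]

theorem degIn_eq_zero {A : Finset V} {v : V} : G.degIn A v = 0 ↔ ∀ w ∈ A, ¬ G.Adj v w := by
  rw [degIn, Finset.card_eq_zero, Finset.filter_eq_empty_iff]

theorem degIn_eq_card {A : Finset V} {v : V} : G.degIn A v = A.card ↔ ∀ w ∈ A, G.Adj v w := by
  rw [degIn, Finset.card_filter_eq_iff]

theorem degIn_singleton (a v : V) : G.degIn {a} v = if G.Adj v a then 1 else 0 := by
  rw [degIn, Finset.filter_singleton]
  split_ifs <;> rfl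

theorem two_le_degIn {A : Finset V} {v : V} :
    2 ≤ G.degIn A v ↔ ∃ a ∈ A, ∃ b ∈ A, a ≠ b ∧ G.Adj v a ∧ G.Adj v b := by
  rw [degIn, ← Nat.lt_iff_add_one_le, Finset.one_lt_card]
  simp only [Finset.mem_filter]
  exact ⟨fun ⟨a, ⟨ha, h1⟩, b, ⟨hb, h2⟩, h3⟩ => ⟨a, ha, b, hb, h3, h1, h2⟩,
    fun ⟨a, ha, b, hb, h3, h1, h2⟩ => ⟨a, ⟨ha, h1⟩, b, ⟨hb, h2⟩, h3⟩⟩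

theorem degIn_congr {A B : Finset V} {v : V} (h : ∀ w, G.Adj v w → (w ∈ A ↔ w ∈ B)) :
    G.degIn A v = G.degIn B v := by
  unfold degIn
  congr 1
  ext w
  simp only [Finset.mem_filter]
  exact ⟨fun h' => ⟨(h w h'.2).1 h'.1, h'.2⟩, fun h' => ⟨(h w h'.2).2 h'.1, h'.2⟩⟩

theorem mem_nbr {E : Finset V} {v : V} : v ∈ G.nbr E ↔ ∃ e ∈ E, G.Adj e v := Iff.rfl

theorem mem_nbr_singleton {a v : V} : v ∈ G.nbr {a} ↔ G.Adj a v := by simp [nbr]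

theorem mem_nbr_iff_degIn {E : Finset V} {v : V} : v ∈ G.nbr E ↔ 0 < G.degIn E v := by
  rw [degIn_pos, mem_nbr]
  simp only [G.adj_comm]

theorem wdeg_symm (W : Finset V) (α β : Set V) (v : V) : G.wdeg W α β v = G.wdeg W β α v := by
  unfold wdeg; omega

theorem Rooted.symm {W : Finset V} {α β : Set V} {k : ℕ} (h : G.Rooted W α β k) :
    G.Rooted W β α k where
  nonempty := h.nonempty
  closed D hD hne hcl := (h.closed D hD hne hcl).symm
  cut D hD hne h1 h2 := h.cut D hD hne h2 h1
  deg v hv := by rw [wdeg_symm]; exact h.deg v hv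
  sum u hu v hv huv := by rw [wdeg_symm, G.wdeg_symm W β α v]; exact h.sum u hu v hv huv

theorem lens_symm {W : Finset V} {α β : Set V} : G.Lens W α β = G.Lens W β α := by
  ext n
  exact ⟨fun ⟨a, ha, b, hb, h⟩ => ⟨b, hb, a, ha, h.symm⟩,
    fun ⟨a, ha, b, hb, h⟩ => ⟨b, hb, a, ha, h.symm⟩⟩

/-! ### Pieces, contraction of cores and pendant sets -/

/-- The main statement for all sets with fewer than `N` vertices. -/
def GoodBelow (G : SimpleGraph V) (N : ℕ) : Prop :=
  ∀ (W : Finset V) (α β : Set V) (k : ℕ), W.card < N → G.Rooted W α β k →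
    GoodSet k (G.Lens W α β)

/-- `C` is a union of components of `W \ H`, all joined to `β`, that inherits the connectivity and
degree conditions of a rooted set `W`. -/
structure Piece (G : SimpleGraph V) (W H C : Finset V) (α β : Set V) (k : ℕ) : Prop where
  nonempty : C.Nonempty
  subC : C ⊆ W
  subH : H ⊆ W
  disj : Disjoint H C
  closed : ∀ v ∈ C, ∀ w ∈ W, G.Adj v w → w ∈ C ∨ w ∈ H
  edge : ∀ D ⊆ C, D.Nonempty → (∀ v ∈ D, v ∉ β) → ∃ v ∈ D, ∃ w ∈ C, G.Adj v w ∧ w ∉ D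
  out : ∀ D ⊆ C, D.Nonempty → ∃ v ∈ D, ∃ w ∈ W, G.Adj v w ∧ w ∉ D
  rob : ∀ D ⊆ C, D.Nonempty → (∀ v ∈ D, v ∉ β) →
    ∀ c, ∃ v ∈ D, ∃ w ∈ W, G.Adj v w ∧ w ∉ D ∧ w ≠ c
  deg : ∀ v ∈ C, k + 1 ≤ G.wdeg W α β v
  sum : ∀ u ∈ C, ∀ v ∈ C, G.Adj u v → 2 * k + 3 ≤ G.wdeg W α β u + G.wdeg W α β v

/-- `D` is attached to the rest of `C` by at most one vertex; `γ` is the set of vertices through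
which `D` is left on the way to `β`. -/
structure Pendant (G : SimpleGraph V) (C D : Finset V) (β γ : Set V) : Prop where
  sub : D ⊆ C
  nonempty : D.Nonempty
  type : (γ = β ∧ (∃ v ∈ D, v ∈ β) ∧ ∀ v ∈ D, ∀ w ∈ C, G.Adj v w → w ∈ D) ∨
    ∃ c ∈ C, c ∉ D ∧ γ = G.nbr {c} ∧ (∀ v ∈ D, v ∉ β) ∧
      ∀ v ∈ D, ∀ w ∈ C, G.Adj v w → w ∈ D ∨ w = c

/-- A loss of at most `l` per vertex costs an edge at most `2 * l`, so both degree conditions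
survive with the same decrease of `k`. -/
theorem rooted_deg {W D : Finset V} {α β α' β' : Set V} {k l : ℕ} (hl : l ≤ k)
    (hdeg : ∀ v ∈ D, k + 1 ≤ G.wdeg W α β v)
    (hsum : ∀ u ∈ D, ∀ v ∈ D, G.Adj u v → 2 * k + 3 ≤ G.wdeg W α β u + G.wdeg W α β v)
    (hloss : ∀ v ∈ D, G.wdeg W α β v ≤ G.wdeg D α' β' v + l) :
    (∀ v ∈ D, k - l + 1 ≤ G.wdeg D α' β' v) ∧
    (∀ u ∈ D, ∀ v ∈ D, G.Adj u v → 2 * (k - l) + 3 ≤ G.wdeg D α' β' u + G.wdeg D α' β' v) := by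
  refine ⟨fun v hv => ?_, fun u hu v hv huv => ?_⟩
  · have := hdeg v hv
    have := hloss v hv
    omega
  · have := hsum u hu v hv huv
    have := hloss v hv
    have := hloss u hu
    omega

namespace Piece

variable {W H C : Finset V} {α β : Set V} {k : ℕ}

theorem degIn_eq (P : G.Piece W H C α β k) {v : V} (hv : v ∈ C) :
    G.degIn W v = G.degIn C v + G.degIn H v := by
  rw [add_comm, ← degIn_union P.disj]
  refine degIn_congr fun w hvw => ⟨fun hw => ?_, fun hw => ?_⟩
  · rw [Finset.mem_union]; exact (P.closed v hv w hw hvw).symm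
  · exact (Finset.mem_union.1 hw).elim (fun h => P.subH h) fun h => P.subC h

theorem notMem (P : G.Piece W H C α β k) {v : V} (hv : v ∈ C) : v ∉ H :=
  fun h => Finset.disjoint_left.1 P.disj h hv

theorem exists_pathIn (P : G.Piece W H C α β k) {v : V} (hv : v ∈ C) :
    ∃ b ∈ β, ∃ n, G.PathIn C v b n := by
  refine SimpleGraph.exists_pathIn hv fun D hD hvD hcl => ?_
  by_contra hcon
  push Not at hcon
  obtain ⟨u, hu, w, hw, huw, hwD⟩ := P.edge D hD ⟨v, hvD⟩ hcon
  exact hwD (hcl u hu w hw huw)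

/-- Contracting the exits `E` of the core `H` gives a rooted set, or there is a pendant set that is
not attached to `E`. -/
theorem rooted_or_pendant (P : G.Piece W H C α β k) {E : Finset V} {l : ℕ} (hl : l ≤ k)
    (hloss : ∀ v ∈ C, G.degIn H v + (if v ∈ α then 1 else 0) ≤
      (if v ∈ G.nbr E then 1 else 0) + l) :
    G.Rooted C (G.nbr E) β (k - l) ∨
      ∃ D γ, G.Pendant C D β γ ∧ ∀ v ∈ D, v ∉ G.nbr E := by
  by_contra hcon
  push Not at hcon
  obtain ⟨hcon, hpend⟩ := hcon
  -- The contracted core replaces the first root, so an edge to that root is lost along with those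
  -- into `H`; what comes back is at most one edge, to the contraction of `E`.
  have hd := rooted_deg (G := G) (W := W) (D := C) (α' := G.nbr E) (β' := β) hl P.deg P.sum
    (fun v hv => by
      have := hloss v hv
      have := P.degIn_eq hv
      unfold wdeg
      omega)
  refine hcon ⟨P.nonempty, fun D hD hne hcl => ?_, fun D hD hne h1 h2 c => ?_, hd.1, hd.2⟩
  · have hβ : ∃ v ∈ D, v ∈ β := by
      by_contra hβ
      push Not at hβ
      obtain ⟨u, hu, w, hw, huw, hwD⟩ := P.edge D hD hne hβ
      exact hwD (hcl u hu w hw huw)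
    exact ⟨hpend D β ⟨hD, hne, Or.inl ⟨rfl, hβ, hcl⟩⟩, hβ⟩
  -- A set missing both new roots whose only exit is `w` is a pendant set of the second type.
  · by_contra hc
    push Not at hc
    obtain ⟨u, hu, w, hw, huw, hwD⟩ := P.edge D hD hne h2
    obtain rfl := hc u hu w hw huw hwD
    obtain ⟨v, hv, hvE⟩ := hpend D (G.nbr {w}) ⟨hD, hne, Or.inr ⟨w, hw, hwD, rfl, h2,
      fun v hv z hz hvz => or_iff_not_imp_left.2 fun hzD => hc v hv z hz hvz hzD⟩⟩
    exact h1 v hv hvE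

/-- Edges from `D` to the attaching vertex become edges to the new second root, so nothing is lost
on that side. A closed part of `D` missing `F` could leave only through the attaching vertex, or not
at all, which `rob` and `out` exclude. -/
theorem pendant_rooted (P : G.Piece W H C α β k) {D : Finset V} {γ : Set V}
    (Q : G.Pendant C D β γ) {F : Finset V} {l : ℕ} (hl : l ≤ k)
    (hF : ∀ v ∈ D, ∀ h ∈ H, G.Adj v h → h ∈ F)
    (hloss : ∀ v ∈ D, G.degIn H v + (if v ∈ α then 1 else 0) ≤
      (if v ∈ G.nbr F then 1 else 0) + l) :
    G.Rooted D (G.nbr F) γ (k - l) := by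
  have hd := rooted_deg (G := G) (W := W) (D := D) (α' := G.nbr F) (β' := γ) hl
    (fun v hv => P.deg v (Q.sub hv)) (fun u hu v hv => P.sum u (Q.sub hu) v (Q.sub hv))
    (fun v hv => by
      have h1 := hloss v hv
      have h2 := P.degIn_eq (Q.sub hv)
      have h3 : G.degIn C v + (if v ∈ β then 1 else 0) =
          G.degIn D v + (if v ∈ γ then 1 else 0) := by
        rcases Q.type with ⟨rfl, _, h⟩ | ⟨c, hc, hcD, rfl, hβ, h⟩
        · rw [degIn_congr (A := C) (B := D) fun w hvw =>
            ⟨fun hw => h v hv w hw hvw, fun hw => Q.sub hw⟩]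
        · have : G.degIn C v = G.degIn (D ∪ {c}) v := degIn_congr fun w hvw =>
            ⟨fun hw => by
              rw [Finset.mem_union, Finset.mem_singleton]; exact h v hv w hw hvw, fun hw => by
              rcases Finset.mem_union.1 hw with hw | hw
              · exact Q.sub hw
              · rw [Finset.mem_singleton.1 hw]; exact hc⟩
          rw [this, degIn_union (Finset.disjoint_singleton_right.2 hcD), degIn_singleton,
            if_neg (hβ v hv), mem_nbr_singleton, G.adj_comm]
          rfl
      unfold wdeg
      omega)
  -- a closed subset of `D` meets `γ`
  have hγ : ∀ D' ⊆ D, D'.Nonempty → (∀ v ∈ D', ∀ w ∈ D, G.Adj v w → w ∈ D') →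
      ∃ v ∈ D', v ∈ γ := by
    intro D' hD' hne hcl
    by_contra hcon
    push Not at hcon
    rcases Q.type with ⟨rfl, _, h⟩ | ⟨c, hc, hcD, rfl, hβ, h⟩
    · obtain ⟨u, hu, w, hw, huw, hwD⟩ := P.edge D' (hD'.trans Q.sub) hne hcon
      exact hwD (hcl u hu w (h u (hD' hu) w hw huw) huw)
    · obtain ⟨u, hu, w, hw, huw, hwD⟩ := P.edge D' (hD'.trans Q.sub) hne
        fun v hv => hβ v (hD' hv)
      rcases h u (hD' hu) w hw huw with h1 | rfl
      · exact hwD (hcl u hu w h1 huw)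
      · exact hcon u hu (mem_nbr_singleton.2 huw.symm)
  refine ⟨Q.nonempty, fun D' hD' hne hcl => ⟨?_, hγ D' hD' hne hcl⟩,
    fun D' hD' hne h1 h2 c' => ?_, hd.1, hd.2⟩
  · by_contra hcon
    push Not at hcon
    have hout : ∀ v ∈ D', ∀ w ∈ W, G.Adj v w → w ∉ D' → w ∈ C ∧ w ∉ D := by
      intro v hv w hw hvw hwD
      rcases P.closed v (Q.sub (hD' hv)) w hw hvw with h | h
      · exact ⟨h, fun h' => hwD (hcl v hv w h' hvw)⟩
      · exact absurd ⟨w, hF v (hD' hv) w h hvw, hvw.symm⟩ (hcon v hv)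
    rcases Q.type with ⟨rfl, _, h⟩ | ⟨c, hc, hcD, rfl, hβ, h⟩
    · obtain ⟨v, hv, w, hw, hvw, hwD⟩ := P.out D' (hD'.trans Q.sub) hne
      obtain ⟨h3, h4⟩ := hout v hv w hw hvw hwD
      exact h4 (h v (hD' hv) w h3 hvw)
    · obtain ⟨v, hv, w, hw, hvw, hwD, hwc⟩ := P.rob D' (hD'.trans Q.sub) hne
        (fun v hv => hβ v (hD' hv)) c
      obtain ⟨h3, h4⟩ := hout v hv w hw hvw hwD
      exact (h v (hD' hv) w h3 hvw).elim h4 hwc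
  · have hβ' : ∀ v ∈ D', v ∉ β := by
      rcases Q.type with ⟨rfl, _, h⟩ | ⟨c, hc, hcD, rfl, hβ, h⟩
      · exact h2
      · exact fun v hv => hβ v (hD' hv)
    obtain ⟨v, hv, w, hw, hvw, hwD, hwc⟩ := P.rob D' (hD'.trans Q.sub) hne hβ' c'
    refine ⟨v, hv, w, ?_, hvw, hwD, hwc⟩
    rcases P.closed v (Q.sub (hD' hv)) w hw hvw with h | h
    · rcases Q.type with ⟨rfl, _, h3⟩ | ⟨c, hc, hcD, rfl, hβ, h3⟩
      · exact h3 v (hD' hv) w h hvw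
      · rcases h3 v (hD' hv) w h hvw with h4 | rfl
        · exact h4
        · exact absurd (mem_nbr_singleton.2 hvw.symm) (h2 v hv)
    · exact absurd ⟨w, hF v (hD' hv) w h hvw, hvw.symm⟩ (h1 v hv)

/-- If `D` is attached to the rest of `C` only by `c`, then `c` is joined to `β` outside `D`. -/
theorem exists_pathIn_sdiff (P : G.Piece W H C α β k) {D : Finset V} {c : V} (hD : D ⊆ C)
    (hβ : ∀ v ∈ D, v ∉ β) (hc : c ∈ C) (hcD : c ∉ D)
    (hcl : ∀ v ∈ D, ∀ w ∈ C, G.Adj v w → w ∈ D ∨ w = c) :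
    ∃ b ∈ β, ∃ m, G.PathIn (C \ D) c b m := by
  refine SimpleGraph.exists_pathIn (Finset.mem_sdiff.2 ⟨hc, hcD⟩) fun R hR hcR hclR => ?_
  by_contra hcon
  push Not at hcon
  obtain ⟨u, hu, w, hw, huw, hwn⟩ := P.edge (R ∪ D)
    (Finset.union_subset (hR.trans Finset.sdiff_subset) hD)
    ⟨c, Finset.mem_union_left _ hcR⟩ (fun v hv => (Finset.mem_union.1 hv).elim
      (hcon v) (hβ v))
  rw [Finset.mem_union, not_or] at hwn
  rcases Finset.mem_union.1 hu with hu | hu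
  · exact hwn.1 (hclR u hu w (Finset.mem_sdiff.2 ⟨hw, hwn.2⟩) huw)
  · rcases hcl u hu w hw huw with h1 | rfl
    · exact hwn.2 h1
    · exact hwn.1 hcR

/-- All paths are prolonged by one fixed path outside `D` from the attaching vertex to `β`, which
shifts the lengths by a constant. -/
theorem pendant_lift (P : G.Piece W H C α β k) {D : Finset V} {γ : Set V}
    (Q : G.Pendant C D β γ) (α' : Set V) :
    ∃ m, ∀ n ∈ G.Lens D α' γ, n + m ∈ G.Lens C α' β := by
  rcases Q.type with ⟨rfl, _, h⟩ | ⟨c, hc, hcD, rfl, hβ, h⟩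
  · exact ⟨0, fun n ⟨a, ha, b, hb, hp⟩ => ⟨a, ha, b, hb, hp.mono Q.sub⟩⟩
  · obtain ⟨b, hb, m, hm⟩ := P.exists_pathIn_sdiff Q.sub hβ hc hcD h
    refine ⟨m + 1, fun n ⟨a, ha, g, hg, hp⟩ => ⟨a, ha, b, hb, ?_⟩⟩
    have := hp.join (mem_nbr_singleton.1 hg).symm hm Finset.disjoint_sdiff
    rw [show n + (m + 1) = n + m + 1 by omega]
    exact this.mono (Finset.union_subset Q.sub Finset.sdiff_subset)

/-- Joining a path in the core to a path in the component. -/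
theorem lens_core (P : G.Piece W H C α β k) {E : Finset V} {m n : ℕ}
    (hE : ∀ e ∈ E, ∃ a ∈ α, G.PathIn H e a m) (hn : n ∈ G.Lens C (G.nbr E) β) :
    m + n + 1 ∈ G.Lens W α β := by
  obtain ⟨v, ⟨e, he, hev⟩, b, hb, hp⟩ := hn
  obtain ⟨a, ha, hq⟩ := hE e he
  exact ⟨a, ha, b, hb, (hq.symm.join hev hp P.disj).mono (Finset.union_subset P.subH P.subC)⟩

/-- The path in `C` dictates the vertex of `E` at which the core is entered, so the same lengths
must be available from every vertex of `E`. -/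
theorem good_consecutive (P : G.Piece W H C α β k) {E : Finset V} {q p a₀ l : ℕ}
    (hq : GoodSet q (G.Lens C (G.nbr E) β)) (hq2 : 2 ≤ q) (hl : l ≤ p + q)
    (hE : ∀ e ∈ E, ∀ i ≤ p, ∃ a ∈ α, G.PathIn H e a (a₀ + i)) : GoodSet l (G.Lens W α β) :=
  hq.add_consecutive (a₀ := a₀) hq2 hl 1 fun i hi _ hn => P.lens_core (fun e he => hE e he i hi) hn

theorem good_even (P : G.Piece W H C α β k) {E : Finset V} {q p a₀ l : ℕ}
    (hq : GoodSet q (G.Lens C (G.nbr E) β)) (hq1 : 1 ≤ q) (hp : 1 ≤ p) (hl : l + 1 ≤ p + q)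
    (hE : ∀ e ∈ E, ∀ i < p, ∃ a ∈ α, G.PathIn H e a (a₀ + 2 * i)) : GoodSet l (G.Lens W α β) :=
  hq.add_even (a₀ := a₀) hp hq1 hl 1 fun i hi _ hn => P.lens_core (fun e he => hE e he i hi) hn

/-- A vertex of the component at which `p + 1` consecutive lengths are available. -/
theorem good_exit (P : G.Piece W H C α β k) {u : V} (hu : u ∈ C) {a₀ : ℕ}
    (h : ∀ i ≤ k, ∃ a ∈ α, G.PathIn (insert u H) u a (a₀ + i)) : GoodSet k (G.Lens W α β) := by
  obtain ⟨b, hb, n, hn⟩ := P.exists_pathIn hu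
  refine Or.inl ⟨a₀ + n, fun i hi => ?_⟩
  obtain ⟨a, ha, hp⟩ := h i hi
  refine ⟨a, ha, b, hb, ?_⟩
  rw [show a₀ + n + i = a₀ + i + n by omega]
  refine (hp.symm.append hn fun v hv hv' => ?_).mono (Finset.union_subset
    (Finset.insert_subset (P.subC hu) P.subH) P.subC)
  rcases Finset.mem_insert.1 hv with h1 | h1
  · exact h1
  · exact absurd h1 (P.notMem hv')

end Piece

/-! ### Connectivity of a minimal counterexample -/

/-- A minimal counterexample. -/
structure MinBad (G : SimpleGraph V) (W : Finset V) (α β : Set V) (k : ℕ) : Prop where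
  rooted : G.Rooted W α β k
  below : G.GoodBelow W.card
  bad : ¬ GoodSet k (G.Lens W α β)

theorem Rooted.connected {W : Finset V} {α β : Set V} {k : ℕ} (h : G.Rooted W α β k) :
    ∃ n, n ∈ G.Lens W α β := by
  have h0 : ∃ a ∈ W, a ∈ α :=
    (h.closed W le_rfl h.nonempty fun _ _ _ hw _ => hw).1
  obtain ⟨a, ha, haα⟩ := h0
  obtain ⟨b, hb, n, hn⟩ := exists_pathIn ha (β := β) fun D hD haD hcl =>
    (h.closed D hD ⟨a, haD⟩ hcl).2
  exact ⟨n, a, haα, b, hb, hn⟩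

namespace MinBad

variable {W : Finset V} {α β : Set V} {k : ℕ}

theorem symm (M : G.MinBad W α β k) : G.MinBad W β α k :=
  ⟨M.rooted.symm, M.below, by rw [lens_symm]; exact M.bad⟩

theorem two_le (M : G.MinBad W α β k) : 2 ≤ k := by
  by_contra hk
  obtain ⟨n, hn⟩ := M.rooted.connected
  refine M.bad (Or.inr ⟨n, fun i hi => ?_⟩)
  rwa [show n + 2 * i = n by omega]

theorem good_of_rooted (M : G.MinBad W α β k) {D : Finset V} {α' β' : Set V} {l : ℕ}
    (hD : D ⊆ W) (hne : D ≠ W) (h : G.Rooted D α' β' l) : GoodSet l (G.Lens D α' β') :=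
  M.below D α' β' l (Finset.card_lt_card (hD.ssubset_of_ne hne)) h

/-- A proper closed subset would inherit every condition with the same `k`, and by minimality it
would already contain the required paths. -/
theorem conn (M : G.MinBad W α β k) {D : Finset V} (hD : D ⊆ W) (hne : D.Nonempty)
    (hcl : ∀ v ∈ D, ∀ w ∈ W, G.Adj v w → w ∈ D) : D = W := by
  by_contra hDW
  have hd := rooted_deg (G := G) (W := W) (D := D) (α' := α) (β' := β) (Nat.zero_le k)
    (fun v hv => M.rooted.deg v (hD hv))
    (fun u hu v hv => M.rooted.sum u (hD hu) v (hD hv))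
    (fun v hv => by
      have : G.degIn W v = G.degIn D v :=
        degIn_congr fun w hvw => ⟨fun hw => hcl v hv w hw hvw, fun hw => hD hw⟩
      unfold wdeg
      omega)
  have hr : G.Rooted D α β k := by
    refine ⟨hne, fun D' hD' hne' hcl' => ?_, fun D' hD' hne' h1 h2 c => ?_, hd.1, hd.2⟩
    · exact M.rooted.closed D' (hD'.trans hD) hne' fun v hv w hw hvw =>
        hcl' v hv w (hcl v (hD' hv) w hw hvw) hvw
    · obtain ⟨v, hv, w, hw, hvw, h⟩ := M.rooted.cut D' (hD'.trans hD) hne' h1 h2 c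
      exact ⟨v, hv, w, hcl v (hD' hv) w hw hvw, hvw, h⟩
  exact M.bad ((M.good_of_rooted hD hDW hr).mono le_rfl 0 fun n ⟨a, ha, b, hb, hp⟩ =>
    ⟨a, ha, b, hb, hp.mono hD⟩)

theorem out (M : G.MinBad W α β k) {D : Finset V} (hD : D ⊆ W) (hne : D.Nonempty)
    (hDW : D ≠ W) : ∃ v ∈ D, ∃ w ∈ W, G.Adj v w ∧ w ∉ D := by
  by_contra hcon
  push Not at hcon
  exact hDW (M.conn hD hne hcon)

/-- If `D` could be left only through one vertex `w`, then `w` could replace the second root for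
`D`. This costs no degree because `D` misses `β`, and all paths continue along one path from `w` to
`β` outside `D`. -/
theorem cut_right (M : G.MinBad W α β k) {D : Finset V} (hD : D ⊆ W) (hne : D.Nonempty)
    (hDW : D ≠ W) (hβ : ∀ v ∈ D, v ∉ β) (c : V) :
    ∃ v ∈ D, ∃ w ∈ W, G.Adj v w ∧ w ∉ D ∧ w ≠ c := by
  by_contra hcon
  push Not at hcon
  obtain ⟨u, hu, w, hw, huw, hwD⟩ := M.out hD hne hDW
  obtain rfl := hcon u hu w hw huw hwD
  have hcl : ∀ v ∈ D, ∀ z ∈ W, G.Adj v z → z ∈ D ∨ z = w := fun v hv z hz hvz =>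
    or_iff_not_imp_left.2 (hcon v hv z hz hvz)
  have hd := rooted_deg (G := G) (W := W) (D := D) (α' := α) (β' := G.nbr {w}) (Nat.zero_le k)
    (fun v hv => M.rooted.deg v (hD hv))
    (fun u hu v hv => M.rooted.sum u (hD hu) v (hD hv))
    (fun v hv => by
      have : G.degIn W v = G.degIn (D ∪ {w}) v :=
        degIn_congr fun z hvz => ⟨fun hz => by
          rw [Finset.mem_union, Finset.mem_singleton]; exact hcl v hv z hz hvz, fun hz => by
          rcases Finset.mem_union.1 hz with hz | hz
          · exact hD hz
          · rw [Finset.mem_singleton.1 hz]; exact hw⟩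
      unfold wdeg
      rw [this, degIn_union (Finset.disjoint_singleton_right.2 hwD), degIn_singleton,
        if_neg (hβ v hv), mem_nbr_singleton, G.adj_comm w v]
      omega)
  have hr : G.Rooted D α (G.nbr {w}) k := by
    refine ⟨hne, fun D' hD' hne' hcl' => ⟨?_, ?_⟩, fun D' hD' hne' h1 h2 c => ?_, hd.1, hd.2⟩
    · by_contra hα
      push Not at hα
      obtain ⟨v, hv, z, hz, hvz, hzD, hzw⟩ := M.rooted.cut D' (hD'.trans hD) hne' hα
        (fun v hv => hβ v (hD' hv)) w
      exact hzD (hcl' v hv z ((hcl v (hD' hv) z hz hvz).resolve_right hzw) hvz)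
    · by_contra hw'
      push Not at hw'
      obtain ⟨-, v, hv, hvβ⟩ := M.rooted.closed D' (hD'.trans hD) hne' fun v hv z hz hvz => by
        rcases hcl v (hD' hv) z hz hvz with h | rfl
        · exact hcl' v hv z h hvz
        · exact absurd (mem_nbr_singleton.2 hvz.symm) (hw' v hv)
      exact hβ v (hD' hv) hvβ
    · obtain ⟨v, hv, z, hz, hvz, hzD, hzc⟩ := M.rooted.cut D' (hD'.trans hD) hne' h1
        (fun v hv => hβ v (hD' hv)) c
      rcases hcl v (hD' hv) z hz hvz with h | rfl
      · exact ⟨v, hv, z, h, hvz, hzD, hzc⟩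
      · exact absurd (mem_nbr_singleton.2 hvz.symm) (h2 v hv)
  obtain ⟨b, hb, m, hm⟩ : ∃ b ∈ β, ∃ m, G.PathIn (W \ D) w b m := by
    refine exists_pathIn (Finset.mem_sdiff.2 ⟨hw, hwD⟩) fun R hR hwR hclR => ?_
    by_contra hcon
    push Not at hcon
    obtain ⟨-, v, hv, hvβ⟩ := M.rooted.closed (R ∪ D)
      (Finset.union_subset (hR.trans Finset.sdiff_subset) hD)
      ⟨w, Finset.mem_union_left _ hwR⟩ (fun v hv z hz hvz => by
        by_cases hzD : z ∈ D
        · exact Finset.mem_union_right _ hzD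
        refine Finset.mem_union_left _ ?_
        rcases Finset.mem_union.1 hv with hv | hv
        · exact hclR v hv z (Finset.mem_sdiff.2 ⟨hz, hzD⟩) hvz
        · rcases hcl v hv z hz hvz with h | rfl
          · exact absurd h hzD
          · exact hwR)
    exact (Finset.mem_union.1 hv).elim (fun h => hcon v h hvβ) fun h => hβ v h hvβ
  refine M.bad ((M.good_of_rooted hD hDW hr).mono le_rfl (m + 1) ?_)
  rintro n ⟨a, ha, g, hg, hp⟩
  refine ⟨a, ha, b, hb, ?_⟩
  have := hp.join (mem_nbr_singleton.1 hg).symm hm Finset.disjoint_sdiff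
  rw [show n + (m + 1) = n + m + 1 by omega]
  exact this.mono (Finset.union_subset hD Finset.sdiff_subset)

theorem cut_left (M : G.MinBad W α β k) {D : Finset V} (hD : D ⊆ W) (hne : D.Nonempty)
    (hDW : D ≠ W) (hα : ∀ v ∈ D, v ∉ α) (c : V) :
    ∃ v ∈ D, ∃ w ∈ W, G.Adj v w ∧ w ∉ D ∧ w ≠ c :=
  M.symm.cut_right hD hne hDW hα c

/-- A single vertex of `W` in `β` would be the only exit from the rest of `W`, against `cut_right`.
-/
theorem exists_right (M : G.MinBad W α β k) (c : V) : ∃ v ∈ W, v ∈ β ∧ v ≠ c := by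
  by_contra hcon
  push Not at hcon
  obtain ⟨-, b, hb, hbβ⟩ := M.rooted.closed W le_rfl M.rooted.nonempty fun _ _ _ hw _ => hw
  obtain rfl := hcon b hb hbβ
  have hne : (W.erase b).Nonempty := by
    have h1 := M.rooted.deg b hb
    have h2 := M.two_le
    have h3 : 0 < G.degIn W b := by
      unfold wdeg at h1
      split_ifs at h1 <;> omega
    obtain ⟨w, hw, hbw⟩ := degIn_pos.1 h3
    exact ⟨w, Finset.mem_erase.2 ⟨hbw.ne', hw⟩⟩
  obtain ⟨v, hv, w, hw, hvw, hwn, hwb⟩ := M.cut_right (Finset.erase_subset b W) hne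
    (fun h => by
      have : b ∈ W.erase b := by rw [h]; exact hb
      exact Finset.notMem_erase b W this)
    (fun v hv hvβ => (Finset.mem_erase.1 hv).1 (hcon v (Finset.mem_erase.1 hv).2 hvβ)) b
  exact hwn (Finset.mem_erase.2 ⟨hwb, hw⟩)

theorem exists_left (M : G.MinBad W α β k) (c : V) : ∃ v ∈ W, v ∈ α ∧ v ≠ c :=
  M.symm.exists_right c

/-- A minimal counterexample with `k ≥ 3` has no cut vertex. -/
theorem no_cut (M : G.MinBad W α β k) (hk : 3 ≤ k) {D : Finset V} (hD : D ⊆ W)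
    (hne : D.Nonempty) (c : V) (hcl : ∀ v ∈ D, ∀ w ∈ W, G.Adj v w → w ∈ D ∨ w = c) :
    ∀ w ∈ W, w ∈ D ∨ w = c := by
  by_contra hcon
  push Not at hcon
  obtain ⟨z, hz, hzD, hzc⟩ := hcon
  have hDW : D ≠ W := fun h => hzD (h ▸ hz)
  obtain ⟨u, hu, w, hw, huw, hwD⟩ := M.out hD hne hDW
  obtain rfl : w = c := (hcl u hu w hw huw).resolve_left hwD
  -- one side of the cut vertex
  have key : ∀ {α β : Set V}, G.MinBad W α β k → ∀ {D : Finset V}, D ⊆ W → D.Nonempty → D ≠ W →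
      w ∉ D → (∀ v ∈ D, ∀ z ∈ W, G.Adj v z → z ∈ D ∨ z = w) →
      GoodSet (k - 1) (G.Lens D α (G.nbr {w})) := by
    intro α β M D hD hne hDW hwD hcl
    -- One unit is lost, because a vertex of `D` may be joined both to `w` and to the second root,
    -- and only the edge to `w` still counts.
    have hd := rooted_deg (G := G) (W := W) (D := D) (α' := α) (β' := G.nbr {w})
      (show 1 ≤ k by omega) (fun v hv => M.rooted.deg v (hD hv))
      (fun u hu v hv => M.rooted.sum u (hD hu) v (hD hv))
      (fun v hv => by
        have : G.degIn W v = G.degIn (D ∪ {w}) v :=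
          degIn_congr fun z hvz => ⟨fun hz => by
            rw [Finset.mem_union, Finset.mem_singleton]; exact hcl v hv z hz hvz, fun hz => by
            rcases Finset.mem_union.1 hz with hz | hz
            · exact hD hz
            · rw [Finset.mem_singleton.1 hz]; exact hw⟩
        unfold wdeg
        rw [this, degIn_union (Finset.disjoint_singleton_right.2 hwD), degIn_singleton,
          mem_nbr_singleton, G.adj_comm w v]
        split_ifs <;> omega)
    refine M.good_of_rooted hD hDW ⟨hne, fun D' hD' hne' hcl' => ⟨?_, ?_⟩,
      fun D' hD' hne' h1 h2 c => ?_, hd.1, hd.2⟩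
    · by_contra hα
      push Not at hα
      obtain ⟨v, hv, z, hz, hvz, hzD, hzw⟩ := M.cut_left (hD'.trans hD) hne'
        (fun h => hwD (hD' (h ▸ hw))) hα w
      exact hzD (hcl' v hv z ((hcl v (hD' hv) z hz hvz).resolve_right hzw) hvz)
    · obtain ⟨v, hv, z, hz, hvz, hzD⟩ := M.out (hD'.trans hD) hne' (fun h => hwD (hD' (h ▸ hw)))
      rcases hcl v (hD' hv) z hz hvz with h | rfl
      · exact absurd (hcl' v hv z h hvz) hzD
      · exact ⟨v, hv, mem_nbr_singleton.2 hvz.symm⟩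
    · obtain ⟨v, hv, z, hz, hvz, hzD, hzc⟩ := M.cut_left (hD'.trans hD) hne'
        (fun h => hwD (hD' (h ▸ hw))) h1 c
      rcases hcl v (hD' hv) z hz hvz with h | rfl
      · exact ⟨v, hv, z, h, hvz, hzD, hzc⟩
      · exact absurd (mem_nbr_singleton.2 hvz.symm) (h2 v hv)
  set S := W \ (insert w D) with hS
  have hzS : z ∈ S := by simp [hS, hz, hzD, hzc]
  have h1 := key M hD hne hDW hwD hcl
  have h2 := key M.symm (D := S) Finset.sdiff_subset ⟨z, hzS⟩
    (fun h => by
      have : w ∈ S := by rw [h]; exact hw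
      simp [hS] at this)
    (by simp [hS]) (fun v hv x hx hvx => by
      by_contra hcon
      push Not at hcon
      have hxD : x ∈ D := by
        by_contra hxD
        exact hcon.1 (by simp [hS, hx, hxD, hcon.2])
      rw [hS, Finset.mem_sdiff, Finset.mem_insert, not_or] at hv
      exact (hcl x hxD v hv.1 hvx.symm).elim hv.2.2 hv.2.1)
  -- The two sides carry `k - 1` each, hence `2 * (k - 1) - 1` together, which reaches `k` since `3
  -- ≤ k`. The shift by two counts the edges at `w`.
  refine M.bad (h1.add h2 (by omega) (by omega) (by omega) 2 ?_)
  rintro m ⟨a, ha, g, hg, hp⟩ n ⟨b, hb, g', hg', hq⟩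
  refine ⟨a, ha, b, hb, ?_⟩
  have h3 := hp.join (mem_nbr_singleton.1 hg).symm (PathIn.refl (Finset.mem_singleton_self w))
    (Finset.disjoint_singleton_right.2 hwD)
  have h4 := h3.join (mem_nbr_singleton.1 hg') hq.symm (by
    rw [Finset.disjoint_left]
    intro x hx hxS
    rw [hS, Finset.mem_sdiff, Finset.mem_insert, not_or] at hxS
    rcases Finset.mem_union.1 hx with h | h
    · exact hxS.2.2 h
    · exact hxS.2.1 (Finset.mem_singleton.1 h))
  rw [show m + n + 2 = m + 0 + 1 + n + 1 by omega]
  exact h4.mono (Finset.union_subset (Finset.union_subset hD (by simpa using hw))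
    Finset.sdiff_subset)

theorem piece (M : G.MinBad W α β k) {H : Finset V} (hH : H ⊆ W) (hne : H.Nonempty)
    (hC : (G.compOf (W \ H) β).Nonempty) : G.Piece W H (G.compOf (W \ H) β) α β k where
  nonempty := hC
  subC := compOf_subset.trans Finset.sdiff_subset
  subH := hH
  disj := Finset.disjoint_of_subset_right compOf_subset Finset.disjoint_sdiff
  closed v hv w hw hvw := by
    by_cases hwH : w ∈ H
    · exact Or.inr hwH
    · exact Or.inl (compOf_closed hv (Finset.mem_sdiff.2 ⟨hw, hwH⟩) hvw)
  edge D hD hne' hβ := compOf_edge hD hne' hβ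
  out D hD hne' := M.out (hD.trans (compOf_subset.trans Finset.sdiff_subset)) hne' fun h => by
    obtain ⟨x, hx⟩ := hne
    exact (Finset.mem_sdiff.1 (compOf_subset (hD (h ▸ hH hx)))).2 hx
  rob D hD hne' hβ := M.cut_right (hD.trans (compOf_subset.trans Finset.sdiff_subset)) hne'
    (fun h => by
      obtain ⟨x, hx⟩ := hne
      exact (Finset.mem_sdiff.1 (compOf_subset (hD (h ▸ hH hx)))).2 hx) hβ
  deg v hv := M.rooted.deg v (Finset.mem_sdiff.1 (compOf_subset hv)).1
  sum u hu v hv := M.rooted.sum u (Finset.mem_sdiff.1 (compOf_subset hu)).1 v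
    (Finset.mem_sdiff.1 (compOf_subset hv)).1

theorem good_piece (M : G.MinBad W α β k) {H C D : Finset V} (P : G.Piece W H C α β k)
    (hH : H.Nonempty) (hD : D ⊆ C) {α' β' : Set V} {l : ℕ} (h : G.Rooted D α' β' l) :
    GoodSet l (G.Lens D α' β') :=
  M.good_of_rooted (hD.trans P.subC) (fun h' => by
    obtain ⟨x, hx⟩ := hH
    exact P.notMem (hD (h' ▸ P.subH hx)) hx) h

/-- Every core has a vertex from which `β` is reached outside the core. -/
theorem exists_exit (M : G.MinBad W α β k) {H : Finset V} (hH : H ⊆ W) (hne : H.Nonempty) :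
    ∃ e ∈ H, ∃ b ∈ β, ∃ n, G.PathIn (insert e (W \ H)) e b n := by
  obtain ⟨x, hx⟩ := hne
  obtain ⟨b, hb, n, hn⟩ := exists_pathIn (hH hx) (β := β) fun D hD hxD hcl =>
    (M.rooted.closed D hD ⟨x, hxD⟩ hcl).2
  obtain ⟨e, he, m, hm⟩ := hn.last_of_mem hx
  exact ⟨e, he, b, hb, m, hm⟩

end MinBad

/-! ### Path lengths inside the cores -/

/-- Joining a path in `H` to a path outside `H` at a common vertex. -/
theorem lens_of_exit {W H S : Finset V} {α β : Set V} {e a b : V} {m n : ℕ} (hH : H ⊆ W)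
    (hS : S ⊆ W) (hHS : Disjoint H S) (ha : a ∈ α) (hp : G.PathIn H e a m)
    (hb : b ∈ β) (hq : G.PathIn (insert e S) e b n) : m + n ∈ G.Lens W α β := by
  refine ⟨a, ha, b, hb, (hp.symm.append hq fun v hv hv' => ?_).mono (Finset.union_subset hH
    (Finset.insert_subset (hH hp.mem_left) hS))⟩
  exact (Finset.mem_insert.1 hv').resolve_right (Finset.disjoint_left.1 hHS hv)

theorem exists_pathIn_clique {K : Finset V} (hK : G.IsClique (K : Set V)) {h : V} (hh : h ∈ K)
    {n : ℕ} (hn : n < K.card) : ∃ a ∈ K, G.PathIn K h a n := by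
  induction n generalizing K h with
  | zero => exact ⟨h, hh, PathIn.refl hh⟩
  | succ n ih =>
    have hc := Finset.card_erase_of_mem hh
    obtain ⟨h', hh'⟩ : (K.erase h).Nonempty := Finset.card_pos.1 (by omega)
    obtain ⟨a, ha, hp⟩ := ih (hK.subset (Finset.coe_subset.2 (Finset.erase_subset h K))) hh'
      (by omega)
    refine ⟨a, Finset.mem_of_mem_erase ha, hh, h', ?_, hp⟩
    exact hK hh (Finset.mem_of_mem_erase hh') (Finset.ne_of_mem_erase hh').symm

/-- The path alternates between the two sides. A path with both ends in `B` uses one more vertex of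
`B` than of `Z`, whence the asymmetric bounds. -/
theorem exists_pathIn_even {Z B : Finset V} (hd : Disjoint Z B)
    (hZB : ∀ z ∈ Z, ∀ b ∈ B, G.Adj z b) {b : V} (hb : b ∈ B) {j : ℕ} (hZ : j ≤ Z.card)
    (hB : j + 1 ≤ B.card) : ∃ a ∈ B, G.PathIn (Z ∪ B) b a (2 * j) := by
  induction j generalizing Z B b with
  | zero => exact ⟨b, hb, PathIn.refl (Finset.mem_union_right _ hb)⟩
  | succ j ih =>
    obtain ⟨z, hz⟩ : Z.Nonempty := Finset.card_pos.1 (by omega)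
    have hc := Finset.card_erase_of_mem hb
    have hc' := Finset.card_erase_of_mem hz
    obtain ⟨b', hb'⟩ : (B.erase b).Nonempty := Finset.card_pos.1 (by omega)
    obtain ⟨a, ha, hp⟩ := ih (Z := Z.erase z) (B := B.erase b)
      (Finset.disjoint_of_subset_left (Finset.erase_subset _ _)
        (Finset.disjoint_of_subset_right (Finset.erase_subset _ _) hd))
      (fun z hz b hb => hZB z (Finset.mem_of_mem_erase hz) b (Finset.mem_of_mem_erase hb)) hb'
      (by omega) (by omega)
    have hbZ : b ∉ Z := fun h => Finset.disjoint_left.1 hd h hb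
    have hzB : z ∉ B := Finset.disjoint_left.1 hd hz
    refine ⟨a, Finset.mem_of_mem_erase ha, ?_⟩
    rw [show 2 * (j + 1) = 2 * j + 1 + 1 by ring]
    have h1 : G.PathIn (Z ∪ B.erase b) z a (2 * j + 1) := by
      refine hp.cons (hZB z hz b' (Finset.mem_of_mem_erase hb')) (Finset.mem_union_left _ hz) ?_
        (Finset.union_subset_union_left (Finset.erase_subset _ _))
      simp [hzB]
    refine h1.cons (hZB z hz b hb).symm (Finset.mem_union_right _ hb) ?_
      (Finset.union_subset_union_right (Finset.erase_subset _ _))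
    simp [hbZ]

theorem exists_pathIn_odd {Z B : Finset V} (hd : Disjoint Z B)
    (hZB : ∀ z ∈ Z, ∀ b ∈ B, G.Adj z b) {z : V} (hz : z ∈ Z) {j : ℕ} (hZ : j + 1 ≤ Z.card)
    (hB : j + 1 ≤ B.card) : ∃ a ∈ B, G.PathIn (Z ∪ B) z a (1 + 2 * j) := by
  obtain ⟨b, hb⟩ : B.Nonempty := Finset.card_pos.1 (by omega)
  have hc' := Finset.card_erase_of_mem hz
  obtain ⟨a, ha, hp⟩ := exists_pathIn_even (G := G) (Z := Z.erase z) (B := B)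
    (Finset.disjoint_of_subset_left (Finset.erase_subset _ _) hd)
    (fun z hz b hb => hZB z (Finset.mem_of_mem_erase hz) b hb) hb (j := j) (by omega) hB
  refine ⟨a, ha, ?_⟩
  rw [add_comm]
  refine hp.cons (hZB z hz b hb) (Finset.mem_union_left _ hz) ?_
    (Finset.union_subset_union_left (Finset.erase_subset _ _))
  simp [Finset.disjoint_left.1 hd hz]

/-- Paths from a clique `Z` to a set `T` complete to it. -/
theorem exists_pathIn_mixed {Z T : Finset V} (hd : Disjoint Z T) (hZ : G.IsClique (Z : Set V))
    (hZT : ∀ z ∈ Z, ∀ b ∈ T, G.Adj z b) {z : V} (hz : z ∈ Z) (hT : 1 ≤ T.card)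
    (hTZ : T.card ≤ Z.card) {n : ℕ} (hn : 1 ≤ n) (hn' : n + 1 ≤ Z.card + T.card) :
    ∃ a ∈ T, G.PathIn (Z ∪ T) z a n := by
  induction hN : Z.card using Nat.strong_induction_on generalizing Z T z n with
  | _ N ih =>
    by_cases hnZ : n ≤ Z.card
    -- Short paths stay in the clique and enter `T` with their last step.
    · obtain ⟨n, rfl⟩ : ∃ n', n = n' + 1 := ⟨n - 1, by omega⟩
      obtain ⟨b, hb⟩ : T.Nonempty := Finset.card_pos.1 hT
      obtain ⟨a, ha, hp⟩ := exists_pathIn_clique hZ hz (n := n) (by omega)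
      have := hp.join (hZT a ha b hb) (PathIn.refl (Finset.mem_singleton_self b))
        (Finset.disjoint_singleton_right.2 fun h => Finset.disjoint_left.1 hd h hb)
      exact ⟨b, hb, this.mono (Finset.union_subset_union_right (Finset.singleton_subset_iff.2 hb))⟩
    -- Long paths begin with a detour through some `b` in `T`. It takes two steps and one vertex
    -- from each part, so the rest is in range again.
    · obtain ⟨n, rfl⟩ : ∃ n', n = n' + 1 + 1 := ⟨n - 2, by omega⟩
      obtain ⟨b, hb⟩ : T.Nonempty := Finset.card_pos.1 hT
      have hc := Finset.card_erase_of_mem hb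
      have hc' := Finset.card_erase_of_mem hz
      obtain ⟨z', hz'⟩ : (Z.erase z).Nonempty := Finset.card_pos.1 (by omega)
      obtain ⟨a, ha, hp⟩ := ih (Z.erase z).card (by omega) (Z := Z.erase z) (T := T.erase b)
        (Finset.disjoint_of_subset_left (Finset.erase_subset _ _)
          (Finset.disjoint_of_subset_right (Finset.erase_subset _ _) hd))
        (hZ.subset (Finset.coe_subset.2 (Finset.erase_subset z Z)))
        (fun z hz b hb => hZT z (Finset.mem_of_mem_erase hz) b (Finset.mem_of_mem_erase hb)) hz'
        (by omega) (by omega) (n := n) (by omega) (by omega) rfl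
      have hbZ : b ∉ Z := fun h => Finset.disjoint_left.1 hd h hb
      have hzT : z ∉ T := Finset.disjoint_left.1 hd hz
      refine ⟨a, Finset.mem_of_mem_erase ha, ?_⟩
      have h1 : G.PathIn (Z.erase z ∪ T) b a (n + 1) := by
        refine hp.cons (hZT z' (Finset.mem_of_mem_erase hz') b hb).symm
          (Finset.mem_union_right _ hb) ?_
          (Finset.union_subset_union_right (Finset.erase_subset _ _))
        simp [hbZ]
      refine h1.cons (hZT z hz b hb) (Finset.mem_union_left _ hz) ?_
        (Finset.union_subset_union_left (Finset.erase_subset _ _))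
      simp [hzT]

theorem exists_pathIn_mixed' {Z T : Finset V} (hd : Disjoint Z T) (hZ : G.IsClique (Z : Set V))
    (hZT : ∀ z ∈ Z, ∀ b ∈ T, G.Adj z b) {b : V} (hb : b ∈ T) (hT : 2 ≤ T.card)
    (hTZ : T.card ≤ Z.card + 1) {n : ℕ} (hn : 2 ≤ n) (hn' : n + 1 ≤ Z.card + T.card) :
    ∃ a ∈ T, G.PathIn (Z ∪ T) b a n := by
  obtain ⟨n, rfl⟩ : ∃ n', n = n' + 1 := ⟨n - 1, by omega⟩
  have hc := Finset.card_erase_of_mem hb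
  obtain ⟨z, hz⟩ : Z.Nonempty := Finset.card_pos.1 (by omega)
  obtain ⟨a, ha, hp⟩ := exists_pathIn_mixed (T := T.erase b)
    (Finset.disjoint_of_subset_right (Finset.erase_subset _ _) hd) hZ
    (fun z hz b hb => hZT z hz b (Finset.mem_of_mem_erase hb)) hz (by omega) (by omega)
    (n := n) (by omega) (by omega)
  have hbZ : b ∉ Z := fun h => Finset.disjoint_left.1 hd h hb
  refine ⟨a, Finset.mem_of_mem_erase ha, hp.cons (hZT z hz b hb).symm
    (Finset.mem_union_right _ hb) ?_ (Finset.union_subset_union_right (Finset.erase_subset _ _))⟩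
  simp [hbZ]

theorem GoodBelow.good {N : ℕ} (hN : G.GoodBelow N) {C D : Finset V} (hC : C.card < N)
    (hD : D ⊆ C) {α β : Set V} {k : ℕ} (h : G.Rooted D α β k) : GoodSet k (G.Lens D α β) :=
  hN D α β k ((Finset.card_le_card hD).trans_lt hC) h

/-! ### Replacing a root, and 4-cycles through a root -/

namespace Piece

variable {W H C : Finset V} {α β : Set V} {k : ℕ}

/-- Without a neighbour in the core, a pendant set would be separated from the rest of `W` by at
most one vertex. Hence contracting the whole core never meets the pendant obstruction. -/
theorem pendant_meets (P : G.Piece W H C α β k) {D : Finset V} {γ : Set V}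
    (Q : G.Pendant C D β γ) : ∃ v ∈ D, v ∈ G.nbr H := by
  by_contra hcon
  push Not at hcon
  have hH : ∀ v ∈ D, ∀ w ∈ W, G.Adj v w → w ∈ C := fun v hv w hw hvw =>
    (P.closed v (Q.sub hv) w hw hvw).resolve_right fun h => hcon v hv ⟨w, h, hvw.symm⟩
  rcases Q.type with ⟨-, -, h⟩ | ⟨c, -, -, -, hβ, h⟩
  · obtain ⟨v, hv, w, hw, hvw, hwD⟩ := P.out D Q.sub Q.nonempty
    exact hwD (h v hv w (hH v hv w hw hvw) hvw)
  · obtain ⟨v, hv, w, hw, hvw, hwD, hwc⟩ := P.rob D Q.sub Q.nonempty hβ c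
    exact (h v hv w (hH v hv w hw hvw) hvw).elim hwD hwc

/-- Contracting the whole core. -/
theorem rooted_core (P : G.Piece W H C α β k) {l : ℕ} (hl : l ≤ k)
    (hloss : ∀ v ∈ C, G.degIn H v + (if v ∈ α then 1 else 0) ≤
      (if v ∈ G.nbr H then 1 else 0) + l) :
    G.Rooted C (G.nbr H) β (k - l) := by
  refine (P.rooted_or_pendant hl hloss).resolve_right ?_
  rintro ⟨D, γ, Q, hD⟩
  obtain ⟨v, hv, hvH⟩ := P.pendant_meets Q
  exact hD v hv hvH

end Piece

namespace MinBad

variable {W : Finset V} {α β : Set V} {k : ℕ}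

theorem ne_of_sub (M : G.MinBad W α β k) {D : Finset V} (hβ : ∀ v ∈ D, v ∉ β) : D ≠ W := by
  rintro rfl
  obtain ⟨b, hb, hbβ, -⟩ := M.exists_right (Classical.choose M.rooted.nonempty)
  exact hβ b hb hbβ

/-- A piece in which a single vertex `e` takes the role of the second root. -/
theorem reroot (M : G.MinBad W α β k) {S H : Finset V} {e : V} {α' : Set V} (hS : S ⊆ W)
    (hd : Disjoint H S) (heS : e ∉ S) (heH : e ∉ H)
    (hβ : ∀ v ∈ S, v ∉ β) (hα : ∀ v ∈ S, v ∈ α → v ∈ α')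
    (hcl : ∀ v ∈ S, ∀ w ∈ W, G.Adj v w → w ∈ S ∨ w ∈ H ∨ w = e)
    (hne : ∃ v ∈ S, G.Adj e v) :
    G.Piece (S ∪ H) H (G.compOf S (G.nbr {e})) α' (G.nbr {e}) k := by
  have hsub : ∀ v ∈ S, ∀ w ∈ W, G.Adj v w → w ≠ e → w ∈ S ∪ H := fun v hv w hw hvw hwe => by
    rcases hcl v hv w hw hvw with h | h | h
    · exact Finset.mem_union_left _ h
    · exact Finset.mem_union_right _ h
    · exact absurd h hwe
  have hrob : ∀ D ⊆ G.compOf S (G.nbr {e}), D.Nonempty → ∀ c,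
      ∃ v ∈ D, ∃ w ∈ W, G.Adj v w ∧ w ∉ D ∧ w ≠ c := fun D hD hne' c =>
    M.cut_right (hD.trans (compOf_subset.trans hS)) hne'
      (M.ne_of_sub fun v hv => hβ v (compOf_subset (hD hv)))
      (fun v hv => hβ v (compOf_subset (hD hv))) c
  have hwdeg : ∀ v ∈ S, G.wdeg W α β v ≤ G.wdeg (S ∪ H) α' (G.nbr {e}) v := by
    intro v hv
    have h1 : G.degIn W v ≤ G.degIn ((S ∪ H) ∪ {e}) v := by
      refine Finset.card_le_card fun w hw => ?_
      obtain ⟨hw, hvw⟩ := Finset.mem_filter.1 hw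
      refine Finset.mem_filter.2 ⟨?_, hvw⟩
      by_cases hwe : w = e
      · exact Finset.mem_union_right _ (Finset.mem_singleton.2 hwe)
      · exact Finset.mem_union_left _ (hsub v hv w hw hvw hwe)
    rw [degIn_union (by simp [heS, heH]), degIn_singleton] at h1
    have h2 := hα v hv
    unfold wdeg
    rw [if_neg (hβ v hv), mem_nbr_singleton, G.adj_comm e v]
    split_ifs at h1 ⊢ <;> first | omega | exact absurd (h2 ‹_›) ‹_›
  refine ⟨?_, compOf_subset.trans Finset.subset_union_left, Finset.subset_union_right,
    Finset.disjoint_of_subset_right compOf_subset hd, ?_, fun D hD hne' h => compOf_edge hD hne' h,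
    ?_, ?_, ?_, ?_⟩
  · obtain ⟨v, hv, hev⟩ := hne
    exact ⟨v, mem_compOf_of_mem hv (mem_nbr_singleton.2 hev)⟩
  · intro v hv w hw hvw
    rcases Finset.mem_union.1 hw with h | h
    · exact Or.inl (compOf_closed hv h hvw)
    · exact Or.inr h
  · intro D hD hne'
    -- Forbidding `e` as the exit keeps the new neighbour inside `S ∪ H`.
    obtain ⟨v, hv, w, hw, hvw, hwD, hwe⟩ := hrob D hD hne' e
    exact ⟨v, hv, w, hsub v (compOf_subset (hD hv)) w hw hvw hwe, hvw, hwD⟩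
  · intro D hD hne' h c
    obtain ⟨v, hv, w, hw, hvw, hwD, hwc⟩ := hrob D hD hne' c
    refine ⟨v, hv, w, hsub v (compOf_subset (hD hv)) w hw hvw ?_, hvw, hwD, hwc⟩
    rintro rfl
    exact h v hv (mem_nbr_singleton.2 hvw.symm)
  · intro v hv
    have hv := compOf_subset hv
    exact (M.rooted.deg v (hS hv)).trans (hwdeg v hv)
  · intro u hu v hv huv
    have hv := compOf_subset hv
    have hu := compOf_subset hu
    exact (M.rooted.sum u (hS hu) v (hS hv) huv).trans (add_le_add (hwdeg u hu) (hwdeg v hv))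

/-- The vertex set of a part attached to two vertices only. -/
theorem good_between (M : G.MinBad W α β k) {D : Finset V} {p q : V} (hD : D ⊆ W)
    (hne : D.Nonempty) (hp : p ∉ D) (hq : q ∉ D) (hpq : p ≠ q) (hα : ∀ v ∈ D, v ∉ α)
    (hβ : ∀ v ∈ D, v ∉ β) (hcl : ∀ v ∈ D, ∀ w ∈ W, G.Adj v w → w ∈ D ∨ w = p ∨ w = q) :
    GoodSet k (G.Lens D (G.nbr {p}) (G.nbr {q})) := by
  have hcut : ∀ D' ⊆ D, D'.Nonempty → ∀ c,
      ∃ v ∈ D', ∃ w ∈ W, G.Adj v w ∧ w ∉ D' ∧ w ≠ c := fun D' hD' hne' c =>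
    M.cut_right (hD'.trans hD) hne' (M.ne_of_sub fun v hv => hβ v (hD' hv))
      (fun v hv => hβ v (hD' hv)) c
  have hd := rooted_deg (G := G) (W := W) (D := D) (α' := G.nbr {p}) (β' := G.nbr {q})
    (Nat.zero_le k) (fun v hv => M.rooted.deg v (hD hv))
    (fun u hu v hv => M.rooted.sum u (hD hu) v (hD hv)) (fun v hv => by
      have h1 : G.degIn W v ≤ G.degIn (D ∪ {p} ∪ {q}) v := by
        refine Finset.card_le_card fun w hw => ?_
        obtain ⟨hw, hvw⟩ := Finset.mem_filter.1 hw
        refine Finset.mem_filter.2 ⟨?_, hvw⟩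
        have := hcl v hv w hw hvw
        simp only [Finset.mem_union, Finset.mem_singleton]
        tauto
      rw [degIn_union (by simp [hq, hpq.symm]), degIn_union (by simp [hp]), degIn_singleton,
        degIn_singleton] at h1
      unfold wdeg
      rw [if_neg (hα v hv), if_neg (hβ v hv), mem_nbr_singleton, mem_nbr_singleton,
        G.adj_comm p v, G.adj_comm q v]
      omega)
  refine M.good_of_rooted hD (M.ne_of_sub hβ) ⟨hne, fun D' hD' hne' hcl' => ⟨?_, ?_⟩,
    fun D' hD' hne' h1 h2 c => ?_, hd.1, hd.2⟩
  · obtain ⟨v, hv, w, hw, hvw, hwD, hwq⟩ := hcut D' hD' hne' q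
    rcases hcl v (hD' hv) w hw hvw with h | rfl | h
    · exact absurd (hcl' v hv w h hvw) hwD
    · exact ⟨v, hv, mem_nbr_singleton.2 hvw.symm⟩
    · exact absurd h hwq
  · obtain ⟨v, hv, w, hw, hvw, hwD, hwq⟩ := hcut D' hD' hne' p
    rcases hcl v (hD' hv) w hw hvw with h | h | rfl
    · exact absurd (hcl' v hv w h hvw) hwD
    · exact absurd h hwq
    · exact ⟨v, hv, mem_nbr_singleton.2 hvw.symm⟩
  · obtain ⟨v, hv, w, hw, hvw, hwD, hwc⟩ := hcut D' hD' hne' c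
    refine ⟨v, hv, w, ?_, hvw, hwD, hwc⟩
    rcases hcl v (hD' hv) w hw hvw with h | rfl | rfl
    · exact h
    · exact absurd (mem_nbr_singleton.2 hvw.symm) (h1 v hv)
    · exact absurd (mem_nbr_singleton.2 hvw.symm) (h2 v hv)

/-- From a set `H` one reaches `β` avoiding a given vertex `u`. -/
theorem exists_exit_avoiding (M : G.MinBad W α β k) {H : Finset V} {u : V} (hH : H ⊆ W)
    (hne : H.Nonempty) (huH : u ∉ H) :
    ∃ e ∈ H, ∃ b ∈ β, ∃ n, G.PathIn (insert e (W \ insert u H)) e b n := by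
  obtain ⟨x, hx⟩ := hne
  obtain ⟨b, hb, n, hn⟩ := exists_pathIn (S := W.erase u) (a := x) (β := β) (G := G)
    (Finset.mem_erase.2 ⟨fun h => huH (h ▸ hx), hH hx⟩) fun D hD hxD hcl => by
      by_contra hcon
      push Not at hcon
      obtain ⟨v, hv, w, hw, hvw, hwD, hwu⟩ := M.cut_right (hD.trans (Finset.erase_subset _ _))
        ⟨x, hxD⟩ (M.ne_of_sub hcon) hcon u
      exact hwD (hcl v hv w (Finset.mem_erase.2 ⟨hwu, hw⟩) hvw)
  obtain ⟨e, he, m, hm⟩ := hn.last_of_mem hx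
  refine ⟨e, he, b, hb, m, hm.mono (Finset.insert_subset_insert _ fun v hv => ?_)⟩
  simp only [Finset.mem_sdiff, Finset.mem_erase, Finset.mem_insert] at hv ⊢
  tauto

theorem card_lt {C : Finset V} (hC : C ⊆ W) {h : V} (hh : h ∈ W) (hhC : h ∉ C) :
    C.card < W.card :=
  Finset.card_lt_card ⟨hC, fun h' => hhC (h' hh)⟩

theorem exists_mem_left (M : G.MinBad W α β k) : ∃ a ∈ W, a ∈ α :=
  have ⟨v, _⟩ := M.rooted.nonempty
  have ⟨a, ha, haα, _⟩ := M.exists_left v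
  ⟨a, ha, haα⟩

theorem exists_mem_right (M : G.MinBad W α β k) : ∃ a ∈ W, a ∈ β := M.symm.exists_mem_left

/-- Contracting all neighbours of the first root costs nothing here: a vertex outside them has at
most one edge into them, and it becomes the edge to the new root. So the contraction would be a
smaller instance with the same `k`, unless `β` has no vertex outside `α`. -/
theorem sub_of_degIn_le_one (M : G.MinBad W α β k)
    (h : ∀ u ∈ W, G.degIn (W.filter (· ∈ α)) u ≤ 1) : ∀ v ∈ W, v ∈ β → v ∈ α := by
  intro v hv hvβ
  by_contra hvα
  set A := W.filter (· ∈ α) with hA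
  obtain ⟨a, ha, haα⟩ := M.exists_mem_left
  have haA : a ∈ A := Finset.mem_filter.2 ⟨ha, haα⟩
  have hAW : A ⊆ W := Finset.filter_subset _ _
  have P := M.piece hAW ⟨a, haA⟩ ⟨v, mem_compOf_of_mem (S := W \ A)
    (Finset.mem_sdiff.2 ⟨hv, fun h' => hvα (Finset.mem_filter.1 h').2⟩) hvβ⟩
  have hR := P.rooted_core (l := 0) (Nat.zero_le k) (fun u hu => by
    have hu' := P.subC hu
    have huα : u ∉ α := fun h' => P.notMem hu (Finset.mem_filter.2 ⟨hu', h'⟩)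
    have h1 := h u hu'
    rw [if_neg huα]
    simp only [mem_nbr_iff_degIn]
    split_ifs <;> omega)
  refine M.bad ((M.good_piece P ⟨a, haA⟩ le_rfl hR).mono le_rfl 1 fun n hn => ?_)
  have := P.lens_core (m := 0) (fun e he => ⟨e, (Finset.mem_filter.1 he).2, PathIn.refl he⟩) hn
  rwa [show n + 1 = 0 + n + 1 by omega]

/-- Some vertex has two neighbours that are joined to the first root. -/
theorem exists_two_nbrs (M : G.MinBad W α β k) :
    ∃ u ∈ W, 2 ≤ G.degIn (W.filter (· ∈ α)) u := by
  by_contra hcon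
  push Not at hcon
  have hle : ∀ u ∈ W, G.degIn (W.filter (· ∈ α)) u ≤ 1 := fun u hu =>
    Nat.le_of_lt_succ (hcon u hu)
  have h1 := M.sub_of_degIn_le_one hle
  have h2 := M.symm.sub_of_degIn_le_one fun u hu => (degIn_mono (fun v hv =>
    Finset.mem_filter.2 ⟨(Finset.mem_filter.1 hv).1, h1 v (Finset.mem_filter.1 hv).1
      (Finset.mem_filter.1 hv).2⟩) u).trans (hle u hu)
  set A := W.filter (· ∈ α) with hA
  have hAW : A ⊆ W := Finset.filter_subset _ _
  have hk := M.two_le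
  have hw : ∀ b ∈ A, G.wdeg W α β b = G.degIn (W \ A) b + G.degIn A b + 2 := by
    intro b hb
    obtain ⟨hbW, hbα⟩ := Finset.mem_filter.1 hb
    rw [← degIn_union Finset.sdiff_disjoint, Finset.sdiff_union_of_subset hAW]
    unfold wdeg
    rw [if_pos hbα, if_pos (h2 b hbW hbα)]
  -- Otherwise all weighted degrees in `A` are at most `3`. As `k + 1 ≥ 3`, there is an edge inside
  -- `A`, and its degree sum is at most `6 < 2 * k + 3`.
  obtain ⟨b, hb, hbo⟩ : ∃ b ∈ A, 0 < G.degIn (W \ A) b := by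
    by_contra hno
    push Not at hno
    obtain ⟨b, hb, hbα⟩ := M.exists_mem_left
    have hbA : b ∈ A := Finset.mem_filter.2 ⟨hb, hbα⟩
    have e1 := M.rooted.deg b hb
    have e2 := hw b hbA
    have e3 := hno b hbA
    have e4 := hle b hb
    obtain ⟨c, hc, hbc⟩ := degIn_pos.1 (show 0 < G.degIn A b by omega)
    have e5 := M.rooted.sum b hb c (hAW hc) hbc
    have e6 := hw c hc
    have e7 := hno c hc
    have e8 := hle c (hAW hc)
    omega
  obtain ⟨v, hv, hbv⟩ := degIn_pos.1 hbo
  have hbW := hAW hb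
  have hbα := (Finset.mem_filter.1 hb).2
  have hout : ∀ v ∈ W \ A, v ∉ α := fun v hv h' =>
    (Finset.mem_sdiff.1 hv).2 (Finset.mem_filter.2 ⟨(Finset.mem_sdiff.1 hv).1, h'⟩)
  -- Both roots have the same neighbours `A`. So `b` becomes the second root and the rest of `A` is
  -- contracted to the first, again without loss.
  have P := M.reroot (S := W \ A) (H := A.erase b) (e := b) (α' := α) Finset.sdiff_subset
    (Finset.disjoint_of_subset_left (Finset.erase_subset _ _) Finset.disjoint_sdiff)
    (by simp [hb]) (Finset.notMem_erase _ _)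
    (fun v hv h' => hout v hv (h1 v (Finset.mem_sdiff.1 hv).1 h')) (fun v _ h' => h')
    (fun u _ w hw _ => by
      by_cases hwA : w ∈ A
      · by_cases hwb : w = b
        · exact Or.inr (Or.inr hwb)
        · exact Or.inr (Or.inl (Finset.mem_erase.2 ⟨hwb, hwA⟩))
      · exact Or.inl (Finset.mem_sdiff.2 ⟨hw, hwA⟩)) ⟨v, hv, hbv⟩
  have hR := P.rooted_core (l := 0) (Nat.zero_le k) (fun u hu => by
    have hu' := compOf_subset hu
    have huα : u ∉ α := hout u hu'
    have h1 := (degIn_mono (Finset.erase_subset b A) u).trans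
      (hle u (Finset.mem_sdiff.1 hu').1)
    rw [if_neg huα]
    simp only [mem_nbr_iff_degIn]
    split_ifs <;> omega)
  have hbS : b ∉ W \ A ∪ A.erase b := by simp [hb]
  have hsub : W \ A ∪ A.erase b ⊆ W :=
    Finset.union_subset Finset.sdiff_subset ((Finset.erase_subset _ _).trans hAW)
  refine M.bad ((M.below.good (card_lt (P.subC.trans hsub) hbW fun h' => hbS (P.subC h')) le_rfl
    hR).mono le_rfl 2 fun n hn => ?_)
  obtain ⟨a, ha, g, hg, hp⟩ := P.lens_core (α := α) (m := 0) (fun e he =>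
    ⟨e, (Finset.mem_filter.1 (Finset.mem_of_mem_erase he)).2, PathIn.refl he⟩) hn
  refine ⟨a, ha, b, h2 b hbW hbα, ?_⟩
  rw [show n + 2 = 0 + n + 1 + 0 + 1 by omega]
  exact (hp.join (mem_nbr_singleton.1 hg).symm (PathIn.refl (Finset.mem_singleton_self b))
    (Finset.disjoint_singleton_right.2 hbS)).mono (Finset.union_subset hsub (by simpa using hbW))

/-- A vertex with two neighbours in `α` closes a 4-cycle with the first root. Going round it either
way gives two lengths that differ by two, which is all that `k = 2` asks for. -/
theorem three_le (M : G.MinBad W α β k) : 3 ≤ k := by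
  by_contra hk
  obtain ⟨u, hu, h2⟩ := M.exists_two_nbrs
  obtain ⟨b, hb, b', hb', hbb, hub, hub'⟩ := two_le_degIn.1 h2
  obtain ⟨hbW, hbα⟩ := Finset.mem_filter.1 hb
  obtain ⟨hbW', hbα'⟩ := Finset.mem_filter.1 hb'
  have hH : ({b, b'} : Finset V) ⊆ W := by
    intro v hv
    rcases Finset.mem_insert.1 hv with rfl | hv
    · exact hbW
    · rwa [Finset.mem_singleton.1 hv]
  obtain ⟨e, he, c, hc, n, hn⟩ := M.exists_exit_avoiding (H := {b, b'}) (u := u) hH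
    (Finset.insert_nonempty _ _) (by simp [hub.ne, hub'.ne])
  have key : ∀ i < 2, ∃ a ∈ α, G.PathIn (insert u {b, b'}) e a (2 * i) := by
    intro i hi
    have h : ∃ j ∈ ({b, b'} : Finset V), _ := exists_pathIn_even (G := G) (Z := {u})
      (B := {b, b'}) (by simp [hub.ne, hub'.ne]) (by simp [hub, hub']) he (j := i)
      (by simp; omega) (by rw [Finset.card_pair hbb]; omega)
    obtain ⟨a, ha, hp⟩ := h
    refine ⟨a, ?_, hp⟩
    rcases Finset.mem_insert.1 ha with rfl | ha
    · exact hbα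
    · rwa [Finset.mem_singleton.1 ha]
  refine M.bad (Or.inr ⟨n, fun i hi => ?_⟩)
  obtain ⟨a, ha, hp⟩ := key i (by omega)
  rw [add_comm]
  exact lens_of_exit (Finset.insert_subset hu hH) Finset.sdiff_subset Finset.disjoint_sdiff ha hp
    hc hn

/-! ### Clique cores: the neighbours of a root are independent -/

/-- A clique through which a set missing both roots is attached. -/
theorem split_clique (M : G.MinBad W α β k) {Z D : Finset V} (hZ : G.IsClique (Z : Set V))
    (hZ2 : 2 ≤ Z.card) (hZk : Z.card ≤ k) (hD : D ⊆ W) (hne : D.Nonempty)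
    (hα : ∀ v ∈ D, v ∉ α) (hβ : ∀ v ∈ D, v ∉ β) (hZD : Disjoint Z D)
    (hcl : ∀ v ∈ D, ∀ w ∈ W, G.Adj v w → w ∈ D ∨ w ∈ Z) (hZW : Z ⊆ W) (c : ℕ)
    (hends : ∀ p ∈ Z, ∀ q ∈ Z, p ≠ q → ∀ n, G.PathIn (Z ∪ D) p q n → n + c ∈ G.Lens W α β) :
    False := by
  obtain ⟨v, hv, e, he, hve, heD⟩ := M.out hD hne (M.ne_of_sub hβ)
  have heZ := (hcl v hv e he hve).resolve_left heD
  have hc := Finset.card_erase_of_mem heZ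
  have P := M.reroot (S := D) (H := Z.erase e) (e := e) (α' := (Z.erase e : Finset V)) hD
    (Finset.disjoint_of_subset_left (Finset.erase_subset _ _) hZD)
    heD (Finset.notMem_erase _ _) hβ (fun v hv h' => absurd h' (hα v hv))
    (fun u hu w hw huw => by
      rcases hcl u hu w hw huw with h | h
      · exact Or.inl h
      · by_cases hwb : w = e
        · exact Or.inr (Or.inr hwb)
        · exact Or.inr (Or.inl (Finset.mem_erase.2 ⟨hwb, h⟩))) ⟨v, hv, hve.symm⟩
  -- The contracted clique has `Z.card - 1` vertices, so the loss is `Z.card - 2`. Its path lengths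
  -- `0, …, Z.card - 2` return exactly that.
  have hR := P.rooted_core (l := Z.card - 2) (by omega) (fun u hu => by
    have huH := P.notMem hu
    have h1 := degIn_le_card (G := G) (Z.erase e) u
    rw [if_neg (by exact_mod_cast huH)]
    simp only [mem_nbr_iff_degIn]
    split_ifs <;> omega)
  have hsub : D ∪ Z.erase e ⊆ Z ∪ D :=
    Finset.union_subset Finset.subset_union_right
      ((Finset.erase_subset _ _).trans Finset.subset_union_left)
  have hIH := M.below.good (card_lt ((P.subC.trans hsub).trans (Finset.union_subset hZW hD)) he
    fun h' => heD (compOf_subset h')) le_rfl hR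
  have hg := P.good_consecutive (p := Z.card - 2) (a₀ := 0) (l := k) hIH (by omega) (by omega)
    (fun h hh i hi => by
      rw [Nat.zero_add]
      exact exists_pathIn_clique (hZ.subset (Finset.coe_subset.2 (Finset.erase_subset e Z))) hh
        (by omega))
  refine M.bad (hg.mono le_rfl (1 + c) ?_)
  rintro n ⟨p, hp, q, hq, hpath⟩
  have hp : p ∈ Z.erase e := hp
  rw [← add_assoc]
  refine hends p (Finset.mem_of_mem_erase hp) e heZ (Finset.ne_of_mem_erase hp) _ ?_
  refine (hpath.join (mem_nbr_singleton.1 hq).symm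
    (PathIn.refl (Finset.mem_singleton_self e)) ?_).mono
    (Finset.union_subset hsub (by simp [heZ]))
  simp [heD]

/-- `K` is a largest clique among the neighbours of the first root. From each of its vertices the
lengths `0, …, K.card - 1` are available, and by maximality a vertex of `α` outside `K` is not
complete to `K`, so contracting `K` loses at most `K.card - 1`. This gives a contradiction whenever
`β` has a vertex outside `K`. -/
theorem clique_step (M : G.MinBad W α β k) {p q : V} (hp : p ∈ W) (hpα : p ∈ α) (hq : q ∈ W)
    (hqα : q ∈ α) (hpq : G.Adj p q) :
    ∃ K : Finset V, G.IsClique (K : Set V) ∧ K.card ≤ k ∧ 2 ≤ K.card ∧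
      K ⊆ W.filter (· ∈ α) ∧ W.filter (· ∈ β) ⊆ K := by
  obtain ⟨K, hK, hmax⟩ := Finset.exists_max_image
    ((W.filter (· ∈ α)).powerset.filter fun K : Finset V => G.IsClique (K : Set V)) Finset.card
    ⟨∅, by simp⟩
  simp only [Finset.mem_filter, Finset.mem_powerset] at hK hmax
  obtain ⟨hKA, hKc⟩ := hK
  have hmem : ∀ v ∈ K, v ∈ W ∧ v ∈ α := fun v hv => Finset.mem_filter.1 (hKA hv)
  have hKW : K ⊆ W := fun v hv => (hmem v hv).1
  have h2 : 2 ≤ K.card := by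
    rw [← Finset.card_pair hpq.ne]
    refine hmax {p, q} ⟨?_, ?_⟩
    · intro v hv
      rcases Finset.mem_insert.1 hv with rfl | hv
      · exact Finset.mem_filter.2 ⟨hp, hpα⟩
      · rw [Finset.mem_singleton.1 hv]; exact Finset.mem_filter.2 ⟨hq, hqα⟩
    · rw [Finset.coe_pair]
      exact (SimpleGraph.isClique_pair).2 fun _ => hpq
  have hKne : K.Nonempty := Finset.card_pos.1 (by omega)
  have hpath : ∀ h ∈ K, ∀ i < K.card, ∃ a ∈ α, G.PathIn K h a i := fun h hh i hi =>
    have ⟨a, ha, hp⟩ := exists_pathIn_clique hKc hh hi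
    ⟨a, (hmem a ha).2, hp⟩
  have hk3 := M.three_le
  have hkK : K.card ≤ k := by
    by_contra hlt
    obtain ⟨e, he, b, hb, n, hn⟩ := M.exists_exit hKW hKne
    refine M.bad (Or.inl ⟨n, fun i hi => ?_⟩)
    obtain ⟨a, ha, hp⟩ := hpath e he i (by omega)
    rw [add_comm]
    exact lens_of_exit hKW Finset.sdiff_subset Finset.disjoint_sdiff ha hp hb hn
  refine ⟨K, hKc, hkK, h2, hKA, ?_⟩
  intro v hv
  by_contra hvK
  obtain ⟨hv, hvβ⟩ := Finset.mem_filter.1 hv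
  have P := M.piece hKW hKne ⟨v, mem_compOf_of_mem (Finset.mem_sdiff.2 ⟨hv, hvK⟩) hvβ⟩
  set C := G.compOf (W \ K) β
  -- a vertex joined to the first root misses a vertex of the clique
  have hlt : ∀ u ∈ C, u ∈ α → G.degIn K u < K.card := by
    intro u hu huα
    refine lt_of_le_of_ne (degIn_le_card _ _) fun h => ?_
    have hall := degIn_eq_card.1 h
    have := hmax (insert u K) ⟨Finset.insert_subset (Finset.mem_filter.2 ⟨P.subC hu, huα⟩) hKA, by
      rw [Finset.coe_insert]
      exact hKc.insert fun w hw _ => hall w hw⟩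
    rw [Finset.card_insert_of_notMem (P.notMem hu)] at this
    omega
  have hloss : ∀ u ∈ C, G.degIn K u + (if u ∈ α then 1 else 0) ≤
      (if u ∈ G.nbr K then 1 else 0) + (K.card - 1) := by
    intro u hu
    have h1 := degIn_le_card (G := G) K u
    have h3 := hlt u hu
    simp only [mem_nbr_iff_degIn]
    split_ifs with h4 <;> [have := h3 h4; have := h3 h4; skip; skip] <;> omega
  by_cases hks : K.card + 1 ≤ k
  · refine M.bad (P.good_consecutive (p := K.card - 1) (a₀ := 0)
      (M.good_piece P hKne le_rfl (P.rooted_core (l := K.card - 1) (by omega) hloss)) (by omega)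
      (by omega) fun h hh i hi => ?_)
    rw [Nat.zero_add]
    exact hpath h hh i (by omega)
  -- Now `K.card = k`, and the loss `K.card - 1` would leave the parameter `1`, which is too small.
  -- A vertex of `α` with a neighbour in `K`, or any vertex complete to `K`, supplies the missing
  -- length directly; in the absence of both, the loss is at most `K.card - 2`.
  · by_cases ht : ∃ u ∈ C, u ∈ α ∧ 0 < G.degIn K u
    · obtain ⟨u, hu, huα, hd⟩ := ht
      obtain ⟨h, hh, huh⟩ := degIn_pos.1 hd
      refine M.bad (P.good_exit hu (a₀ := 0) fun i hi => ?_)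
      rcases Nat.eq_zero_or_pos i with rfl | hi'
      · exact ⟨u, huα, PathIn.refl (Finset.mem_insert_self _ _)⟩
      · obtain ⟨a, ha, hp⟩ := hpath h hh (i - 1) (by omega)
        refine ⟨a, ha, ?_⟩
        rw [show 0 + i = i - 1 + 1 by omega]
        exact hp.cons huh (Finset.mem_insert_self _ _) (P.notMem hu) (Finset.subset_insert _ _)
    by_cases ht' : ∃ u ∈ C, G.degIn K u = K.card
    · obtain ⟨u, hu, hd⟩ := ht'
      have hall := degIn_eq_card.1 hd
      obtain ⟨e, he, b, hb, n, hn⟩ := M.exists_exit_avoiding hKW hKne (P.notMem hu)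
      refine M.bad (Or.inl ⟨n, fun i hi => ?_⟩)
      obtain ⟨a, ha, hp⟩ : ∃ a ∈ α, G.PathIn (insert u K) e a i := by
        by_cases hi' : i < K.card
        · obtain ⟨a, ha, hp⟩ := hpath e he i hi'
          exact ⟨a, ha, hp.mono (Finset.subset_insert _ _)⟩
        · obtain rfl : i = K.card := by omega
          have hc := Finset.card_erase_of_mem he
          obtain ⟨h, hh⟩ : (K.erase e).Nonempty := Finset.card_pos.1 (by omega)
          obtain ⟨a, ha, hp⟩ := exists_pathIn_clique (G := G) (K := K.erase e)
            (hKc.subset (Finset.coe_subset.2 (Finset.erase_subset e K))) hh (n := K.card - 2)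
            (by omega)
          refine ⟨a, (hmem a (Finset.mem_of_mem_erase ha)).2, ?_⟩
          have h1 : G.PathIn (insert u (K.erase e)) u a (K.card - 2 + 1) :=
            hp.cons (hall h (Finset.mem_of_mem_erase hh)) (Finset.mem_insert_self _ _)
              (fun h' => P.notMem hu (Finset.mem_of_mem_erase h')) (Finset.subset_insert _ _)
          rw [show K.card = K.card - 2 + 1 + 1 by omega]
          exact h1.cons (hall e he).symm (Finset.mem_insert_of_mem he)
            (by simp [show e ≠ u from (hall e he).ne'])
            (Finset.insert_subset_insert _ (Finset.erase_subset _ _))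
      rw [add_comm]
      exact lens_of_exit (Finset.insert_subset (P.subC hu) hKW) Finset.sdiff_subset
        Finset.disjoint_sdiff ha hp hb hn
    · push Not at ht ht'
      have hR := P.rooted_core (l := K.card - 2) (by omega) (fun u hu => by
        have h1 := degIn_le_card (G := G) K u
        have h3 := ht u hu
        have h4 := ht' u hu
        simp only [mem_nbr_iff_degIn]
        split_ifs with h5 <;> [have := h3 h5; have := h3 h5; skip; skip] <;> omega)
      refine M.bad (P.good_consecutive (p := K.card - 1) (a₀ := 0)
        (M.good_piece P hKne le_rfl hR) (by omega)
        (by omega) fun h hh i hi => ?_)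
      rw [Nat.zero_add]
      exact hpath h hh i (by omega)

/-- The neighbours of the first root are independent. -/
theorem indep_left (M : G.MinBad W α β k) {p q : V} (hp : p ∈ W) (hpα : p ∈ α) (hq : q ∈ W)
    (hqα : q ∈ α) : ¬ G.Adj p q := by
  intro hpq
  obtain ⟨K, hK, hKk, hK2, hKα, hβK⟩ := M.clique_step hp hpα hq hqα hpq
  obtain ⟨r, hr, hrβ⟩ := M.exists_mem_right
  obtain ⟨t, ht, htβ, hrt⟩ := M.exists_right r
  -- Two vertices of `β` lie in the clique `K` and hence are adjacent, so the argument applies with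
  -- the roots exchanged. It follows that `α` and `β` both meet `W` in `K`.
  obtain ⟨K', -, -, -, hKβ, hαK⟩ := M.symm.clique_step hr hrβ ht htβ
    (hK (hβK (Finset.mem_filter.2 ⟨hr, hrβ⟩)) (hβK (Finset.mem_filter.2 ⟨ht, htβ⟩)) hrt.symm)
  have h1 : ∀ v ∈ K, v ∈ W ∧ v ∈ α ∧ v ∈ β := fun v hv => by
    have h1 := hKα hv
    have h2 := Finset.mem_filter.1 (hKβ (hαK h1))
    exact ⟨h2.1, (Finset.mem_filter.1 h1).2, h2.2⟩
  have h2 : ∀ v ∈ W, v ∈ β → v ∈ K := fun v hv h => hβK (Finset.mem_filter.2 ⟨hv, h⟩)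
  have h3 : ∀ v ∈ W, v ∈ α → v ∈ K := fun v hv h =>
    hβK (hKβ (hαK (Finset.mem_filter.2 ⟨hv, h⟩)))
  have hKW : K ⊆ W := fun v hv => (h1 v hv).1
  have hw : ∀ v ∈ K, G.wdeg W α β v ≤ G.degIn (W \ K) v + K.card + 1 := by
    intro v hv
    have e1 : G.degIn K v < K.card := by
      refine lt_of_le_of_ne (degIn_le_card _ _) fun h => ?_
      exact G.irrefl (degIn_eq_card.1 h v hv)
    have e2 : G.degIn W v = G.degIn (W \ K) v + G.degIn K v := by
      rw [← degIn_union Finset.sdiff_disjoint, Finset.sdiff_union_of_subset hKW]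
    unfold wdeg
    rw [if_pos (h1 v hv).2.1, if_pos (h1 v hv).2.2]
    omega
  -- If `K` were all of `W`, weighted degrees would be at most `k + 1`, too small for the edge `p
  -- q`.
  have hne : (W \ K).Nonempty := by
    by_contra hemp
    rw [Finset.not_nonempty_iff_eq_empty] at hemp
    have hpK := h3 p hp hpα
    have hqK := h3 q hq hqα
    have e1 := hw p hpK
    have e2 := hw q hqK
    have e3 := M.rooted.sum p hp q hq hpq
    rw [hemp] at e1 e2
    have e4 : ∀ v, G.degIn ∅ v = 0 := fun v => by simp [degIn]
    rw [e4] at e1 e2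
    omega
  refine M.split_clique hK hK2 hKk Finset.sdiff_subset hne
    (fun v hv h => (Finset.mem_sdiff.1 hv).2 (h3 v (Finset.mem_sdiff.1 hv).1 h))
    (fun v hv h => (Finset.mem_sdiff.1 hv).2 (h2 v (Finset.mem_sdiff.1 hv).1 h))
    Finset.disjoint_sdiff (fun v _ w hw _ => ?_) hKW 0 fun p hp q hq _ n hn => ?_
  · by_cases hwK : w ∈ K
    · exact Or.inr hwK
    · exact Or.inl (Finset.mem_sdiff.2 ⟨hw, hwK⟩)
  · exact ⟨p, (h1 p hp).2.1, q, (h1 q hq).2.2,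
      hn.mono (Finset.union_subset hKW Finset.sdiff_subset)⟩

theorem indep_right (M : G.MinBad W α β k) {p q : V} (hp : p ∈ W) (hpβ : p ∈ β) (hq : q ∈ W)
    (hqβ : q ∈ β) : ¬ G.Adj p q := M.symm.indep_left hp hpβ hq hqβ

end MinBad

/-! ### Mixed cores: a clique with common neighbours at a root -/

/-- A vertex with neighbours in both parts of a core consisting of a clique and a set complete
to it. -/
theorem Piece.good_exit_mixed {W Z T C : Finset V} {α β : Set V} {k : ℕ}
    (P : G.Piece W (Z ∪ T) C α β k) (hd : Disjoint Z T) (hZ : G.IsClique (Z : Set V))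
    (hZT : ∀ z ∈ Z, ∀ b ∈ T, G.Adj z b) (hT : ∀ b ∈ T, b ∈ α) (ht : 1 ≤ T.card)
    (htZ : T.card ≤ Z.card) {u : V} (hu : u ∈ C) (h1 : 0 < G.degIn Z u) (h2 : 0 < G.degIn T u)
    (hk : k ≤ Z.card + T.card - 1) : GoodSet k (G.Lens W α β) := by
  obtain ⟨z, hz, huz⟩ := degIn_pos.1 h1
  obtain ⟨b, hb, hub⟩ := degIn_pos.1 h2
  refine P.good_exit hu (a₀ := 1) fun i hi => ?_
  rcases Nat.eq_zero_or_pos i with rfl | hi'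
  · exact ⟨b, hT b hb, (PathIn.refl (Finset.mem_union_right Z hb)).cons hub
      (Finset.mem_insert_self _ _) (P.notMem hu) (Finset.subset_insert _ _)⟩
  · obtain ⟨a, ha, hp⟩ := exists_pathIn_mixed hd hZ hZT hz ht htZ (n := i) hi' (by omega)
    refine ⟨a, hT a ha, ?_⟩
    rw [add_comm]
    exact hp.cons huz (Finset.mem_insert_self _ _) (P.notMem hu) (Finset.subset_insert _ _)

/-- From `Z` there are `Z.card + T.card - 1` consecutive lengths, so contracting `Z` may lose
`Z.card + T.card - 2`; the bounds on neighbours in `Z` and `T` guarantee this. A pendant set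
avoiding `Z` is rooted at `T`, with loss `T.card - 1`. Small `k` are treated apart, since the
remaining parameter must be at least two. -/
theorem Piece.good_mixed {W Z T C : Finset V} {α β : Set V} {k N : ℕ}
    (P : G.Piece W (Z ∪ T) C α β k) (hd : Disjoint Z T) (hZ : G.IsClique (Z : Set V))
    (hZT : ∀ z ∈ Z, ∀ b ∈ T, G.Adj z b) (hT : ∀ b ∈ T, b ∈ α) (ht : 2 ≤ T.card)
    (htZ : T.card ≤ Z.card) (ht3 : T.card ≤ 3) (htk : T.card = 3 → 4 ≤ k) (hk : 3 ≤ k)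
    (hZk : 3 ≤ Z.card ∨ 4 ≤ k) (hind : ∀ u ∈ C, u ∈ α → G.degIn T u = 0)
    (hmax : ∀ u ∈ C, u ∉ α → G.degIn Z u = Z.card → G.degIn T u ≤ 1)
    (hmax' : T.card = 2 → k = Z.card + 1 → ∀ u ∈ C, u ∈ α → G.degIn Z u < Z.card)
    (hN : G.GoodBelow N) (hC : C.card < N) : GoodSet k (G.Lens W α β) := by
  have hdeg : ∀ u, G.degIn (Z ∪ T) u = G.degIn Z u + G.degIn T u := degIn_union hd
  have hleZ := degIn_le_card (G := G) Z
  have hleT := degIn_le_card (G := G) T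
  have hpath : ∀ z ∈ Z, ∀ i ≤ Z.card + T.card - 2, ∃ a ∈ α, G.PathIn (Z ∪ T) z a (1 + i) :=
    fun z hz i hi =>
      have ⟨a, ha, hp⟩ := exists_pathIn_mixed hd hZ hZT hz (by omega) htZ (n := 1 + i) (by omega)
        (by omega)
      ⟨a, hT a ha, hp⟩
  have hpath' : ∀ b ∈ T, ∀ i ≤ Z.card + T.card - 3, ∃ a ∈ α, G.PathIn (Z ∪ T) b a (2 + i) :=
    fun b hb i hi =>
      have ⟨a, ha, hp⟩ := exists_pathIn_mixed' hd hZ hZT hb ht (by omega) (n := 2 + i) (by omega)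
        (by omega)
      ⟨a, hT a ha, hp⟩
  have hpend : ∀ D γ, G.Pendant C D β γ → (∀ v ∈ D, v ∉ G.nbr Z) →
      GoodSet k (G.Lens W α β) := by
    intro D γ Q hD
    have hR := P.pendant_rooted Q (F := T) (l := T.card - 1) (by omega)
      (fun v hv h hh hvh => (Finset.mem_union.1 hh).resolve_left fun hz =>
        hD v hv ⟨h, hz, hvh.symm⟩) (fun v hv => by
        have h1 := hD v hv
        have h2 := hleT v
        have h3 := hind v (Q.sub hv)
        rw [mem_nbr_iff_degIn] at h1
        simp only [mem_nbr_iff_degIn, hdeg]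
        split_ifs with h4 <;> [have := h3 h4; have := h3 h4; skip; skip] <;> omega)
    obtain ⟨c, hc⟩ := P.pendant_lift Q (G.nbr T)
    exact P.good_consecutive (p := Z.card + T.card - 3) (a₀ := 2)
      ((hN.good hC Q.sub hR).mono le_rfl c hc) (by omega) (by omega) hpath'
  by_cases hks : k ≤ Z.card + T.card - 2
  · by_cases hv : ∃ v ∈ C, v ∈ G.nbr Z
    · obtain ⟨v, hv, z, hz, hzv⟩ := hv
      refine P.good_exit hv (a₀ := 2) fun i hi => ?_
      -- For such small `k` the core alone has enough lengths, and one edge from `Z` into `C`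
      -- suffices.
      obtain ⟨a, ha, hp⟩ := hpath z hz i (by omega)
      refine ⟨a, ha, ?_⟩
      rw [show 2 + i = 1 + i + 1 by omega]
      exact hp.cons hzv.symm (Finset.mem_insert_self _ _) (P.notMem hv) (Finset.subset_insert _ _)
    · push Not at hv
      refine hpend C β ⟨le_rfl, P.nonempty, Or.inl ⟨rfl, ?_, fun _ _ _ hw _ => hw⟩⟩ hv
      obtain ⟨v, hv⟩ := P.nonempty
      obtain ⟨b, hb, n, hn⟩ := P.exists_pathIn hv
      exact ⟨b, hn.mem_right, hb⟩
  by_cases hks' : k = Z.card + T.card - 1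
  · by_cases hu : ∃ u ∈ C, 0 < G.degIn Z u ∧ 0 < G.degIn T u
    · obtain ⟨u, hu, h1, h2⟩ := hu
      exact P.good_exit_mixed hd hZ hZT hT (by omega) htZ hu h1 h2 hks'.le
    · push Not at hu
      -- No vertex of `C` sees both `Z` and `T`, so the loss is one less than in general and the
      -- parameter `2` remains.
      rcases P.rooted_or_pendant (E := Z) (l := k - 2) (by omega) (fun v hv => by
        have h1 := hu v hv
        have h2 := hleT v
        have h3 := hleZ v
        have h4 := hind v hv
        have h6 : T.card = 2 → v ∈ α → G.degIn Z v < Z.card := fun h6 h7 =>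
          hmax' h6 (by omega) v hv h7
        simp only [mem_nbr_iff_degIn, hdeg]
        split_ifs with h5 <;>
          [(have := h4 h5; have := fun h => h6 h h5); (have := h4 h5); skip; skip] <;> omega)
        with hR | ⟨D, γ, Q, hD⟩
      · exact P.good_consecutive (p := Z.card + T.card - 2) (a₀ := 1) (hN.good hC le_rfl hR)
          (by omega) (by omega) hpath
      · exact hpend D γ Q hD
  · rcases P.rooted_or_pendant (E := Z) (l := Z.card + T.card - 2) (by omega) (fun v hv => by
      have h2 := hleT v
      have h3 := hleZ v
      have h4 := hind v hv
      have h1 := hmax v hv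
      simp only [mem_nbr_iff_degIn, hdeg]
      split_ifs with h5 <;>
        [have := h4 h5; have := h4 h5; have := h1 h5; have := h1 h5] <;> omega)
      with hR | ⟨D, γ, Q, hD⟩
    · exact P.good_consecutive (p := Z.card + T.card - 2) (a₀ := 1) (hN.good hC le_rfl hR)
        (by omega) (by omega) hpath
    · exact hpend D γ Q hD

namespace MinBad

variable {W : Finset V} {α β : Set V} {k : ℕ}

/-- Both roots have the same two neighbours. -/
theorem two_terminals (M : G.MinBad W α β k) {p q : V} (hpq : p ≠ q) (hp : p ∈ W) (hq : q ∈ W)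
    (hpα : p ∈ α) (hqβ : q ∈ β) (hα : ∀ v ∈ W, v ∈ α → v = p ∨ v = q)
    (hβ : ∀ v ∈ W, v ∈ β → v = p ∨ v = q) {w : V} (hw : w ∈ W) (hwp : w ≠ p) (hwq : w ≠ q) :
    False := by
  have hg := M.good_between (D := W \ {p, q}) Finset.sdiff_subset ⟨w, by simp [hw, hwp, hwq]⟩
    (by simp) (by simp) hpq
    (fun v hv h => by
      simp only [Finset.mem_sdiff, Finset.mem_insert, Finset.mem_singleton] at hv
      exact hv.2 (hα v hv.1 h))
    (fun v hv h => by
      simp only [Finset.mem_sdiff, Finset.mem_insert, Finset.mem_singleton] at hv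
      exact hv.2 (hβ v hv.1 h))
    (fun v hv z hz _ => by
      simp only [Finset.mem_sdiff, Finset.mem_insert, Finset.mem_singleton]
      tauto)
  refine M.bad (hg.mono le_rfl 2 ?_)
  rintro n ⟨a, ha, b, hb, hn⟩
  refine ⟨p, hpα, q, hqβ, ?_⟩
  have h1 := (hn.join (mem_nbr_singleton.1 hb).symm (PathIn.refl (Finset.mem_singleton_self q))
    (by simp)).cons (T := W) (mem_nbr_singleton.1 ha) hp (by simp [hpq])
    (Finset.union_subset Finset.sdiff_subset (by simp [hq]))
  exact h1

end MinBad

/-- The vertices of `W` in `α` that are adjacent to all of `Z`. -/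
noncomputable def apex (G : SimpleGraph V) (W : Finset V) (α : Set V) (Z : Finset V) : Finset V :=
  W.filter fun v => v ∈ α ∧ ∀ z ∈ Z, G.Adj z v

theorem mem_apex {W Z : Finset V} {α : Set V} {v : V} :
    v ∈ G.apex W α Z ↔ v ∈ W ∧ v ∈ α ∧ ∀ z ∈ Z, G.Adj z v := Finset.mem_filter

theorem disjoint_apex {W Z : Finset V} {α : Set V} : Disjoint Z (G.apex W α Z) :=
  Finset.disjoint_left.2 fun v hv hv' => G.irrefl ((mem_apex.1 hv').2.2 v hv)

namespace MinBad

variable {W : Finset V} {α β : Set V} {k : ℕ}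

theorem degIn_left (M : G.MinBad W α β k) {T : Finset V} (hT : ∀ v ∈ T, v ∈ W ∧ v ∈ α) {u : V}
    (hu : u ∈ W) (huα : u ∈ α) : G.degIn T u = 0 :=
  degIn_eq_zero.2 fun v hv => M.indep_left hu huα (hT v hv).1 (hT v hv).2

/-- If the second root is attached only to a clique `Z` and a set complete to it, it is attached
only to the latter. -/
theorem right_sub_of_sub (M : G.MinBad W α β k) {Z T : Finset V} (hZ : G.IsClique (Z : Set V))
    (hZT : ∀ z ∈ Z, ∀ b ∈ T, G.Adj z b) (h : ∀ v ∈ W, v ∈ β → v ∈ Z ∪ T) :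
    ∀ v ∈ W, v ∈ β → v ∈ T := by
  intro v hv hvβ
  refine (Finset.mem_union.1 (h v hv hvβ)).resolve_left fun hvZ => ?_
  obtain ⟨w, hw, hwβ, hwv⟩ := M.exists_right v
  refine M.indep_right hv hvβ hw hwβ ?_
  rcases Finset.mem_union.1 (h w hw hwβ) with h1 | h1
  · exact hZ hvZ h1 hwv.symm
  · exact hZT v hvZ w h1

/-- If some `b` in `T` has a neighbour outside the core, `b` replaces the second root and `Z` with
the other two vertices of `T` is again a mixed core. Otherwise the rest is attached to the clique
`Z` alone and `split_clique` applies. -/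
theorem three_terminals (M : G.MinBad W α β k) {Z T : Finset V} (hZ : G.IsClique (Z : Set V))
    (hZW : Z ⊆ W) (hZ3 : 3 ≤ Z.card) (hT : T.card = 3) (hk : 4 ≤ k)
    (hZT : ∀ z ∈ Z, ∀ b ∈ T, G.Adj z b) (hd : Disjoint Z T)
    (hTα : ∀ b ∈ T, b ∈ W ∧ b ∈ α ∧ b ∈ β) (hα : ∀ v ∈ W, v ∈ α → v ∈ T)
    (hβ : ∀ v ∈ W, v ∈ β → v ∈ T)
    (hmax : ∀ u ∈ W, u ∉ Z ∪ T → G.degIn Z u = Z.card → G.degIn T u ≤ 1) : False := by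
  have hTW : T ⊆ W := fun v hv => (hTα v hv).1
  have hS : ∀ v ∈ W \ (Z ∪ T), v ∈ W ∧ v ∉ Z ∧ v ∉ T := fun v hv => by
    simpa only [Finset.mem_sdiff, Finset.mem_union, not_or] using hv
  rcases le_or_gt k Z.card with hkZ | hkZ
  · obtain ⟨b, hb⟩ : T.Nonempty := Finset.card_pos.1 (by omega)
    refine M.bad (Or.inl ⟨2, fun i hi => ?_⟩)
    obtain ⟨a, ha, hp⟩ := exists_pathIn_mixed' hd hZ hZT hb (by omega) (by omega) (n := 2 + i)
      (by omega) (by omega)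
    exact ⟨b, (hTα b hb).2.1, a, (hTα a ha).2.2, hp.mono (Finset.union_subset hZW hTW)⟩
  by_cases hb : ∃ b ∈ T, ∃ v ∈ W \ (Z ∪ T), G.Adj b v
  · obtain ⟨b, hb, v, hv, hbv⟩ := hb
    have hbZ : b ∉ Z := Finset.disjoint_right.1 hd hb
    have hTb : T.erase b ⊆ T := Finset.erase_subset _ _
    have hc := Finset.card_erase_of_mem hb
    have P := M.reroot (S := W \ (Z ∪ T)) (H := Z ∪ T.erase b) (e := b) (α' := α)
      Finset.sdiff_subset
      (Finset.disjoint_of_subset_left (Finset.union_subset_union_right hTb) Finset.disjoint_sdiff)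
      (by simp [hb]) (by simp [hbZ]) (fun v hv h' => (hS v hv).2.2 (hβ v (hS v hv).1 h'))
      (fun v _ h' => h') (fun u _ w hw _ => by
        simp only [Finset.mem_sdiff, Finset.mem_union, Finset.mem_erase]
        tauto) ⟨v, hv, hbv⟩
    have hbS : b ∉ W \ (Z ∪ T) ∪ (Z ∪ T.erase b) := by simp [hb, hbZ]
    have hsub : W \ (Z ∪ T) ∪ (Z ∪ T.erase b) ⊆ W := Finset.union_subset Finset.sdiff_subset
      (Finset.union_subset hZW (hTb.trans hTW))
    have hout : ∀ u ∈ G.compOf (W \ (Z ∪ T)) (G.nbr {b}), u ∉ α := fun u hu h' =>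
      have := hS u (compOf_subset hu)
      this.2.2 (hα u this.1 h')
    have hg := P.good_mixed (Finset.disjoint_of_subset_right hTb hd) hZ
      (fun z hz c hc => hZT z hz c (hTb hc)) (fun c hc => (hTα c (hTb hc)).2.1) (by omega)
      (by omega) (by omega) (by omega) (by omega) (by omega) (fun u hu h' => absurd h' (hout u hu))
      (fun u hu _ h' => (degIn_mono hTb u).trans (hmax u (hS u (compOf_subset hu)).1
        (Finset.mem_sdiff.1 (compOf_subset hu)).2 h'))
      (fun _ _ u hu h' => absurd h' (hout u hu)) M.below
      (card_lt (P.subC.trans hsub) (hTW hb) fun h' => hbS (P.subC h'))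
    refine M.bad (hg.mono le_rfl 1 ?_)
    rintro n ⟨a, ha, g, hg, hp⟩
    exact ⟨a, ha, b, (hTα b hb).2.2, (hp.join (mem_nbr_singleton.1 hg).symm
      (PathIn.refl (Finset.mem_singleton_self b)) (Finset.disjoint_singleton_right.2 hbS)).mono
      (Finset.union_subset hsub (by simpa using hTW hb))⟩
  · push Not at hb
    -- If nothing lay outside the core, an edge between `Z` and `T` would have degree sum at most `2
    -- * Z.card + 4`, below `2 * k + 3` because `Z.card < k`.
    have hne : (W \ (Z ∪ T)).Nonempty := by
      by_contra hemp
      rw [Finset.not_nonempty_iff_eq_empty, Finset.sdiff_eq_empty_iff_subset] at hemp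
      obtain ⟨b, hb⟩ : T.Nonempty := Finset.card_pos.1 (by omega)
      obtain ⟨z, hz⟩ : Z.Nonempty := Finset.card_pos.1 (by omega)
      have e0 := M.rooted.sum z (hZW hz) b (hTW hb) (hZT z hz b hb)
      have hzT : z ∉ T := Finset.disjoint_left.1 hd hz
      have e1 : ∀ v, G.degIn W v ≤ G.degIn Z v + G.degIn T v := fun v => by
        rw [← degIn_union hd]; exact degIn_mono hemp v
      have e2 := M.degIn_left (fun v hv => ⟨(hTα v hv).1, (hTα v hv).2.1⟩) (hTW hb) (hTα b hb).2.1
      have e3 := degIn_le_card (G := G) Z b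
      have e4 := degIn_le_card (G := G) T z
      have e5 : G.degIn Z z < Z.card :=
        lt_of_le_of_ne (degIn_le_card _ _) fun h => G.irrefl (degIn_eq_card.1 h z hz)
      have e6 := e1 z
      have e7 := e1 b
      unfold wdeg at e0
      rw [if_neg fun h => hzT (hα z (hZW hz) h), if_neg fun h => hzT (hβ z (hZW hz) h)] at e0
      split_ifs at e0 <;> omega
    obtain ⟨b, hbT, b', hbT', hbb⟩ := Finset.one_lt_card.1 (show 1 < T.card by omega)
    refine M.split_clique hZ (by omega) hkZ.le Finset.sdiff_subset hne
      (fun v hv h => (hS v hv).2.2 (hα v (hS v hv).1 h))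
      (fun v hv h => (hS v hv).2.2 (hβ v (hS v hv).1 h))
      (Finset.disjoint_of_subset_left Finset.subset_union_left Finset.disjoint_sdiff)
      (fun v hv w hw hvw => ?_) hZW 2 fun p hp q hq _ n hn => ?_
    · by_cases hwT : w ∈ T
      · exact absurd hvw.symm (hb w hwT v hv)
      · simp only [Finset.mem_sdiff, Finset.mem_union]
        tauto
    · have hT' : ∀ c ∈ T, c ∉ Z ∪ W \ (Z ∪ T) := fun c hc => by
        simp [hc, Finset.disjoint_right.1 hd hc]
      refine ⟨b, (hTα b hbT).2.1, b', (hTα b' hbT').2.2, ?_⟩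
      have h1 := hn.cons (T := insert b (Z ∪ W \ (Z ∪ T))) (hZT p hp b hbT).symm
        (Finset.mem_insert_self _ _) (hT' b hbT) (Finset.subset_insert _ _)
      have h2 := h1.join (hZT q hq b' hbT') (PathIn.refl (Finset.mem_singleton_self b'))
        (by simp [hbb.symm, Finset.disjoint_right.1 hd hbT', hbT'])
      exact h2.mono (Finset.union_subset (Finset.insert_subset (hTW hbT)
        (Finset.union_subset hZW Finset.sdiff_subset)) (by simpa using hTW hbT'))

/-- By maximality of `Z`, a vertex complete to `Z` outside the core has at most one neighbour in
`T`, which limits the loss in `good_mixed`. Three vertices are taken for `T` when possible, for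
otherwise a further apex outside `T` could lose too much. The case `Z.card = 2`, `k = 3` is beyond
`good_mixed` and is done by hand. -/
theorem mixed_step (M : G.MinBad W α β k) {Z : Finset V} (hZ : G.IsClique (Z : Set V))
    (hZW : Z ⊆ W) (hZ2 : 2 ≤ Z.card) (hap : 2 ≤ (G.apex W α Z).card)
    (hmax : ∀ Z' : Finset V, G.IsClique (Z' : Set V) → Z' ⊆ W → 2 ≤ (G.apex W α Z').card →
      Z'.card ≤ Z.card) :
    ∃ T ⊆ G.apex W α Z, (T.card = 2 ∨ T.card = 3 ∧ 4 ≤ k ∧ 3 ≤ Z.card) ∧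
      ∀ v ∈ W, v ∈ β → v ∈ T := by
  have hk3 := M.three_le
  have hZne : Z.Nonempty := Finset.card_pos.1 (by omega)
  -- facts about subsets of the set of apices
  have hsub : ∀ T ⊆ G.apex W α Z, (∀ z ∈ Z, ∀ b ∈ T, G.Adj z b) ∧ (∀ b ∈ T, b ∈ W ∧ b ∈ α) ∧
      Disjoint Z T ∧ Z ∪ T ⊆ W := fun T hT =>
    ⟨fun z hz b hb => (mem_apex.1 (hT hb)).2.2 z hz,
      fun b hb => ⟨(mem_apex.1 (hT hb)).1, (mem_apex.1 (hT hb)).2.1⟩,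
      Finset.disjoint_of_subset_right hT disjoint_apex,
      Finset.union_subset hZW fun b hb => (mem_apex.1 (hT hb)).1⟩
  by_cases hex : Z.card = 2 ∧ k = 3 ∧ 3 ≤ (G.apex W α Z).card
  · exfalso
    obtain ⟨hZ2, rfl, hap3⟩ := hex
    set T := G.apex W α Z with hTdef
    obtain ⟨hZT, hTα, hd, hHW⟩ := hsub T le_rfl
    -- With three apices over an edge, the complete bipartite graph between `Z` and `T` gives the
    -- lengths `0, 2, 4`, enough for `k = 3` at any exit from `T`.
    have heven : ∀ b ∈ T, ∀ i < 3, ∃ a ∈ α, G.PathIn (Z ∪ T) b a (2 * i) := fun b hb i hi =>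
      have ⟨a, ha, hp⟩ := exists_pathIn_even hd hZT hb (j := i) (by omega) (by omega)
      ⟨a, (hTα a ha).2, hp⟩
    have hHne : (Z ∪ T).Nonempty := hZne.mono Finset.subset_union_left
    by_cases hC : (G.compOf (W \ (Z ∪ T)) β).Nonempty
    · have P := M.piece hHW hHne hC
      by_cases hv : ∃ v ∈ G.compOf (W \ (Z ∪ T)) β, v ∈ G.nbr T
      · obtain ⟨v, hv, t, ht, htv⟩ := hv
        obtain ⟨b, hb, n, hn⟩ := P.exists_pathIn hv
        refine M.bad (Or.inr ⟨n + 1, fun i hi => ?_⟩)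
        have := P.lens_core (E := {t}) (m := 2 * i) (by simpa using heven t ht i hi)
          ⟨v, mem_nbr_singleton.2 htv, b, hb, hn⟩
        rwa [show n + 1 + 2 * i = 2 * i + n + 1 by omega]
      · push Not at hv
        rcases P.rooted_or_pendant (E := Z) (l := 1) (by omega) (fun v hv' => by
          have h1 := hv v hv'
          have h2 := degIn_le_card (G := G) Z v
          have h3 : v ∈ α → G.degIn Z v < Z.card := fun h => by
            refine lt_of_le_of_ne h2 fun h3 => P.notMem hv' (Finset.mem_union_right _ ?_)
            exact mem_apex.2 ⟨P.subC hv', h, fun z hz => (degIn_eq_card.1 h3 z hz).symm⟩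
          rw [mem_nbr_iff_degIn] at h1
          simp only [mem_nbr_iff_degIn, degIn_union hd]
          split_ifs with h4 <;> [have := h3 h4; have := h3 h4; skip; skip] <;> omega)
          with hR | ⟨D, γ, Q, hD⟩
        · refine M.bad (P.good_consecutive (p := 1) (a₀ := 1) (M.good_piece P hHne le_rfl hR)
            (by omega) (by omega) fun z hz i hi => ?_)
          obtain ⟨t, ht, t', ht', htt⟩ := Finset.one_lt_card.1 (show 1 < T.card by omega)
          obtain ⟨a, ha, hp⟩ := exists_pathIn_mixed (T := {t})
            (Finset.disjoint_of_subset_right (Finset.singleton_subset_iff.2 ht) hd) hZ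
            (fun z hz b hb => hZT z hz b (by rwa [Finset.mem_singleton.1 hb])) hz (n := 1 + i)
            (by simp) (by simp; omega) (by omega) (by simp; omega)
          refine ⟨a, ?_, hp.mono (Finset.union_subset_union_right
            (Finset.singleton_subset_iff.2 ht))⟩
          rw [Finset.mem_singleton.1 ha]
          exact (hTα t ht).2
        · obtain ⟨v, hv', h, hh, hvh⟩ := P.pendant_meets Q
          exact (Finset.mem_union.1 hh).elim (fun h' => hD v hv' ⟨h, h', hvh⟩)
            fun h' => hv v (Q.sub hv') ⟨h, h', hvh⟩
    · have h1 := M.right_sub_of_sub hZ hZT fun v hv hvβ => by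
        by_contra h'
        exact hC ⟨v, mem_compOf_of_mem (Finset.mem_sdiff.2 ⟨hv, h'⟩) hvβ⟩
      obtain ⟨b, hb, hbβ⟩ := M.exists_mem_right
      refine M.bad (Or.inr ⟨0, fun i hi => ?_⟩)
      obtain ⟨a, ha, hp⟩ := heven b (h1 b hb hbβ) i hi
      rw [Nat.zero_add]
      exact ⟨a, ha, b, hbβ, hp.symm.mono hHW⟩
  obtain ⟨T, hTs, hTc⟩ : ∃ T ⊆ G.apex W α Z, T.card = 2 ∧ (k ≤ 3 ∨ Z.card ≤ 2 ∨
      T = G.apex W α Z) ∨ T.card = 3 ∧ 4 ≤ k ∧ 3 ≤ Z.card := by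
    by_cases h : 4 ≤ k ∧ 3 ≤ Z.card ∧ 3 ≤ (G.apex W α Z).card
    · obtain ⟨T, hT, hc⟩ := Finset.exists_subset_card_eq h.2.2
      exact ⟨T, hT, Or.inr ⟨hc, h.1, h.2.1⟩⟩
    · obtain ⟨T, hT, hc⟩ := Finset.exists_subset_card_eq hap
      refine ⟨T, hT, Or.inl ⟨hc, ?_⟩⟩
      by_cases h' : 3 ≤ (G.apex W α Z).card
      · omega
      · exact Or.inr (Or.inr (Finset.eq_of_subset_of_card_le hT (by omega)))
  obtain ⟨hZT, hTα, hd, hHW⟩ := hsub T hTs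
  refine ⟨T, hTs, by omega, M.right_sub_of_sub hZ hZT fun v hv hvβ => ?_⟩
  by_contra hvH
  have hHne : (Z ∪ T).Nonempty := hZne.mono Finset.subset_union_left
  have P := M.piece hHW hHne ⟨v, mem_compOf_of_mem (Finset.mem_sdiff.2 ⟨hv, hvH⟩) hvβ⟩
  set C := G.compOf (W \ (Z ∪ T)) β
  have hind : ∀ u ∈ C, u ∈ α → G.degIn T u = 0 := fun u hu huα =>
    M.degIn_left hTα (P.subC hu) huα
  have hCW : C.card < W.card := by
    obtain ⟨z, hz⟩ := hHne
    exact card_lt P.subC (hHW hz) fun h => P.notMem h hz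
  have hfull : ∀ u ∈ C, u ∈ α → G.degIn Z u = Z.card → T ≠ G.apex W α Z := by
    rintro u hu huα h rfl
    exact P.notMem hu (Finset.mem_union_right _ (mem_apex.2 ⟨P.subC hu, huα,
      fun z hz => (degIn_eq_card.1 h z hz).symm⟩))
  by_cases hZk : 3 ≤ Z.card ∨ 4 ≤ k
  · refine M.bad (P.good_mixed hd hZ hZT (fun b hb => (hTα b hb).2) (by omega) (by omega)
      (by omega) (by omega) hk3 hZk hind (fun u hu _ hcard => ?_) (fun hT2 hk u hu huα => ?_)
      M.below hCW)
    · by_contra h2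
      obtain ⟨b, hb, b', hb', hbb, hub, hub'⟩ :=
        two_le_degIn.1 (show 2 ≤ G.degIn T u by omega)
      have hall := degIn_eq_card.1 hcard
      have := hmax (insert u Z) (by
        rw [Finset.coe_insert]
        exact hZ.insert fun w hw _ => hall w hw) (Finset.insert_subset (P.subC hu) hZW) (by
        rw [← Finset.card_pair hbb]
        refine Finset.card_le_card fun v hv => ?_
        have hvT : v ∈ T ∧ G.Adj u v := by
          rcases Finset.mem_insert.1 hv with rfl | hv
          · exact ⟨hb, hub⟩
          · rw [Finset.mem_singleton.1 hv]; exact ⟨hb', hub'⟩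
        refine mem_apex.2 ⟨(hTα v hvT.1).1, (hTα v hvT.1).2, fun z hz => ?_⟩
        rcases Finset.mem_insert.1 hz with rfl | hz
        · exact hvT.2
        · exact hZT z hz v hvT.1)
      rw [Finset.card_insert_of_notMem fun h => P.notMem hu (Finset.mem_union_left _ h)] at this
      omega
    · refine lt_of_le_of_ne (degIn_le_card _ _) fun h => hfull u hu huα h ?_
      rcases hTc with ⟨_, h1 | h1 | h1⟩ | h1
      · omega
      · omega
      · exact h1
      · omega
  · have hk : k = 3 := by omega
    have hZ2' : Z.card = 2 := by omega
    have hT2 : T.card = 2 := by omega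
    have hTa : T = G.apex W α Z := Finset.eq_of_subset_of_card_le hTs (by omega)
    by_cases hu : ∃ u ∈ C, 0 < G.degIn Z u ∧ 0 < G.degIn T u
    · obtain ⟨u, hu, h1, h2⟩ := hu
      exact M.bad (P.good_exit_mixed hd hZ hZT (fun b hb => (hTα b hb).2) (by omega) (by omega) hu
        h1 h2 (by omega))
    · push Not at hu
      have hR := P.rooted_core (l := 1) (by omega) (fun v hv => by
        have h1 := hu v hv
        have h2 := degIn_le_card (G := G) T v
        have h3 := degIn_le_card (G := G) Z v
        have h4 := hind v hv
        have h6 : v ∈ α → G.degIn Z v ≠ Z.card := fun h7 h8 => hfull v hv h7 h8 hTa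
        simp only [mem_nbr_iff_degIn, degIn_union hd]
        split_ifs with h5 <;>
          [(have := h4 h5; have := h6 h5); (have := h4 h5; have := h6 h5); skip; skip] <;> omega)
      refine M.bad (P.good_consecutive (p := 1) (a₀ := 2) (M.good_piece P hHne le_rfl hR)
        (by omega) (by omega) fun h hh i hi => ?_)
      rcases Finset.mem_union.1 hh with hh | hh
      · obtain ⟨a, ha, hp⟩ := exists_pathIn_mixed hd hZ hZT hh (by omega) (by omega) (n := 2 + i)
          (by omega) (by omega)
        exact ⟨a, (hTα a ha).2, hp⟩
      · obtain ⟨a, ha, hp⟩ := exists_pathIn_mixed' hd hZ hZT hh (by omega) (by omega)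
          (n := 2 + i) (by omega) (by omega)
        exact ⟨a, (hTα a ha).2, hp⟩

/-- No edge has two common neighbours that are joined to the first root. -/
theorem no_diamond (M : G.MinBad W α β k) {z z' : V} (hz : z ∈ W) (hz' : z' ∈ W)
    (hzz : G.Adj z z') : (G.apex W α {z, z'}).card ≤ 1 := by
  by_contra hap
  obtain ⟨Z, hZ, hmax⟩ := Finset.exists_max_image
    (W.powerset.filter fun K : Finset V => G.IsClique (K : Set V) ∧ 2 ≤ (G.apex W α K).card)
    Finset.card ⟨{z, z'}, by
      simp only [Finset.mem_filter, Finset.mem_powerset]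
      refine ⟨?_, ?_, by omega⟩
      · intro v hv
        rcases Finset.mem_insert.1 hv with rfl | hv
        · exact hz
        · rwa [Finset.mem_singleton.1 hv]
      · rw [Finset.coe_pair]
        exact (SimpleGraph.isClique_pair).2 fun _ => hzz⟩
  have hZ2 : 2 ≤ Z.card := by
    rw [← Finset.card_pair hzz.ne]
    refine hmax _ ?_
    simp only [Finset.mem_filter, Finset.mem_powerset]
    refine ⟨?_, ?_, by omega⟩
    · intro v hv
      rcases Finset.mem_insert.1 hv with rfl | hv
      · exact hz
      · rwa [Finset.mem_singleton.1 hv]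
    · rw [Finset.coe_pair]
      exact (SimpleGraph.isClique_pair).2 fun _ => hzz
  simp only [Finset.mem_filter, Finset.mem_powerset] at hZ hmax
  obtain ⟨hZW, hZc, hZa⟩ := hZ
  obtain ⟨T, hTs, hTc, hTβ⟩ := M.mixed_step hZc hZW hZ2 hZa
    fun Z' h1 h2 h3 => hmax Z' ⟨h2, h1, h3⟩
  have hβα : ∀ v ∈ W, v ∈ β → v ∈ α := fun v hv h => (mem_apex.1 (hTs (hTβ v hv h))).2.1
  -- Since `β` lies in `α` within `W`, the clique `Z` is also a largest one for the exchanged roots.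
  obtain ⟨T', hTs', -, hTα⟩ := M.symm.mixed_step hZc hZW hZ2 (by
    obtain ⟨r, hr, hrβ⟩ := M.exists_mem_right
    obtain ⟨t, ht, htβ, hrt⟩ := M.exists_right r
    rw [← Finset.card_pair hrt]
    refine Finset.card_le_card fun v hv => ?_
    have hv' : v ∈ W ∧ v ∈ β := by
      rcases Finset.mem_insert.1 hv with rfl | hv
      · exact ⟨ht, htβ⟩
      · rw [Finset.mem_singleton.1 hv]; exact ⟨hr, hrβ⟩
    exact mem_apex.2 ⟨hv'.1, hv'.2, (mem_apex.1 (hTs (hTβ v hv'.1 hv'.2))).2.2⟩)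
    fun Z' h1 h2 h3 => hmax Z' ⟨h2, h1, h3.trans (Finset.card_le_card fun v hv => by
      obtain ⟨hv1, hv2, hv3⟩ := mem_apex.1 hv
      exact mem_apex.2 ⟨hv1, hβα v hv1 hv2, hv3⟩)⟩
  have hT' : ∀ v ∈ W, v ∈ α → v ∈ T := fun v hv h =>
    hTβ v hv (mem_apex.1 (hTs' (hTα v hv h))).2.1
  have hTab : ∀ b ∈ T, b ∈ W ∧ b ∈ α ∧ b ∈ β := fun b hb =>
    have h := mem_apex.1 (hTs hb)
    ⟨h.1, h.2.1, (mem_apex.1 (hTs' (hTα b h.1 h.2.1))).2.1⟩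
  have hd : Disjoint Z T := Finset.disjoint_of_subset_right hTs disjoint_apex
  have hZT : ∀ z ∈ Z, ∀ b ∈ T, G.Adj z b := fun z hz b hb => (mem_apex.1 (hTs hb)).2.2 z hz
  rcases hTc with hT2 | ⟨hT3, hk, hZ3⟩
  · obtain ⟨p, q, hpq, rfl⟩ := Finset.card_eq_two.1 hT2
    obtain ⟨w, hw⟩ : Z.Nonempty := Finset.card_pos.1 (by omega)
    have hwT := Finset.disjoint_left.1 hd hw
    have hp := hTab p (by simp)
    have hq := hTab q (by simp)
    simp only [Finset.mem_insert, Finset.mem_singleton, not_or] at hwT hT' hTβ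
    exact M.two_terminals hpq hp.1 hq.1 hp.2.1 hq.2.2 hT' hTβ (hZW hw) hwT.1 hwT.2
  · refine M.three_terminals hZc hZW hZ3 hT3 hk hZT hd hTab hT' hTβ fun u hu huH hcard => ?_
    by_contra h2
    obtain ⟨b, hb, b', hb', hbb, hub, hub'⟩ :=
      two_le_degIn.1 (show 2 ≤ G.degIn T u by omega)
    have hall := degIn_eq_card.1 hcard
    have := hmax (insert u Z) ⟨Finset.insert_subset hu hZW, by
      rw [Finset.coe_insert]
      exact hZc.insert fun w hw _ => hall w hw, by
      rw [← Finset.card_pair hbb]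
      refine Finset.card_le_card fun v hv => ?_
      have hvT : v ∈ T ∧ G.Adj u v := by
        rcases Finset.mem_insert.1 hv with rfl | hv
        · exact ⟨hb, hub⟩
        · rw [Finset.mem_singleton.1 hv]; exact ⟨hb', hub'⟩
      refine mem_apex.2 ⟨(hTab v hvT.1).1, (hTab v hvT.1).2.1, fun z hz => ?_⟩
      rcases Finset.mem_insert.1 hz with rfl | hz
      · exact hvT.2
      · exact hZT z hz v hvT.1⟩
    rw [Finset.card_insert_of_notMem fun h => huH (Finset.mem_union_left _ h)] at this
    omega

end MinBad

/-! ### Bipartite cores -/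

/-- From `B` the lengths `0, 2, …, 2 * Z.card` balance a loss of `Z.card`. A pendant set avoiding
`B` is rooted at `Z`, where `Z.card` odd lengths balance a loss of `Z.card - 1`. The latter bound
fails only if `Z` is a single vertex and the pendant set meets `α`, the exception in the conclusion.
-/
theorem Piece.good_bipartite {W Z B C : Finset V} {α β : Set V} {k N : ℕ}
    (P : G.Piece W (Z ∪ B) C α β k) (hd : Disjoint Z B) (hZB : ∀ z ∈ Z, ∀ b ∈ B, G.Adj z b)
    (hB : ∀ b ∈ B, b ∈ α) (hZ1 : 1 ≤ Z.card) (hc : Z.card + 1 ≤ B.card) (hk : Z.card + 1 ≤ k)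
    (h₁ : ∀ u ∈ C, u ∈ α → G.degIn B u = 0 ∧ G.degIn Z u < Z.card)
    (h₂ : ∀ u ∈ C, u ∉ α → 0 < G.degIn Z u → G.degIn B u ≤ 1)
    (h₃ : ∀ u ∈ C, u ∉ α → G.degIn Z u = 0 → G.degIn B u ≤ Z.card + 1)
    (hN : G.GoodBelow N) (hC : C.card < N) :
    GoodSet k (G.Lens W α β) ∨ Z.card = 1 ∧ ∃ D γ, G.Pendant C D β γ ∧
      (∀ v ∈ D, v ∉ G.nbr B) ∧ ∃ v ∈ D, v ∈ α := by
  have hleZ := degIn_le_card (G := G) Z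
  rcases P.rooted_or_pendant (E := B) (l := Z.card) (by omega) (fun u hu => by
    have e1 := h₁ u hu
    have e2 := h₂ u hu
    have e3 := h₃ u hu
    have e4 := hleZ u
    simp only [mem_nbr_iff_degIn, degIn_union hd]
    split_ifs with h4 <;>
      [have := e1 h4; have := e1 h4; (have := e2 h4; have := e3 h4);
        (have := e2 h4; have := e3 h4)] <;> omega) with hR | ⟨D, γ, Q, hD⟩
  · refine Or.inl (P.good_even (p := Z.card + 1) (a₀ := 0) (hN.good hC le_rfl hR) (by omega)
      (by omega) (by omega) fun b hb i hi => ?_)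
    obtain ⟨a, ha, hp⟩ := exists_pathIn_even hd hZB hb (j := i) (by omega) (by omega)
    rw [Nat.zero_add]
    exact ⟨a, hB a ha, hp⟩
  · by_cases ht : Z.card = 1 ∧ ∃ v ∈ D, v ∈ α
    · exact Or.inr ⟨ht.1, D, γ, Q, hD, ht.2⟩
    have hR := P.pendant_rooted Q (F := Z) (l := Z.card - 1) (by omega)
      (fun v hv h hh hvh => (Finset.mem_union.1 hh).resolve_right fun hz =>
        hD v hv ⟨h, hz, hvh.symm⟩) (fun v hv => by
        have e0 := hD v hv
        have e1 := h₁ v (Q.sub hv)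
        have e4 := hleZ v
        have e5 : v ∈ α → Z.card ≠ 1 := fun h h' => ht ⟨h', v, hv, h⟩
        rw [mem_nbr_iff_degIn] at e0
        simp only [mem_nbr_iff_degIn, degIn_union hd]
        split_ifs with h4 <;>
          [(have := e1 h4; have := e5 h4); (have := e1 h4; have := e5 h4); skip; skip] <;> omega)
    obtain ⟨c, hc⟩ := P.pendant_lift Q (G.nbr Z)
    refine Or.inl (P.good_even (p := Z.card) (a₀ := 1)
      ((hN.good hC Q.sub hR).mono le_rfl c hc) (by omega) (by omega) (by omega)
      fun z hz i hi => ?_)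
    obtain ⟨a, ha, hp⟩ := exists_pathIn_odd hd hZB hz (j := i) (by omega) (by omega)
    exact ⟨a, hB a ha, hp⟩

theorem lens_between {W D S T : Finset V} {α β : Set V} {a p q b : V} {m n l : ℕ} (hD : D ⊆ W)
    (hS : S ⊆ W) (hT : T ⊆ W) (hSD : Disjoint S D) (hDT : Disjoint D T) (hST : Disjoint S T)
    (ha : a ∈ α) (hap : G.PathIn S a p m) (hb : b ∈ β) (hqb : G.PathIn T q b l)
    (hn : n ∈ G.Lens D (G.nbr {p}) (G.nbr {q})) : n + (m + l + 2) ∈ G.Lens W α β := by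
  obtain ⟨v, hv, w, hw, hp⟩ := hn
  have h1 := hap.join (mem_nbr_singleton.1 hv) hp hSD
  have h2 := h1.join (mem_nbr_singleton.1 hw).symm hqb (Finset.disjoint_union_left.2 ⟨hST, hDT⟩)
  refine ⟨a, ha, b, hb, ?_⟩
  rw [show n + (m + l + 2) = m + n + 1 + l + 1 by omega]
  exact h2.mono (Finset.union_subset (Finset.union_subset hS hD) hT)

namespace MinBad

variable {W : Finset V} {α β : Set V} {k : ℕ}

/-- Two neighbours of `u` in `B` would be common neighbours of the edge `z u`. -/
theorem degIn_apex (M : G.MinBad W α β k) {z u : V} {B : Finset V} (hz : z ∈ W) (hu : u ∈ W)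
    (hzu : G.Adj z u) (hB : ∀ b ∈ B, b ∈ W ∧ b ∈ α ∧ G.Adj z b) : G.degIn B u ≤ 1 := by
  refine le_trans (Finset.card_le_card fun b hb => ?_) (M.no_diamond hz hu hzu)
  obtain ⟨hb, hub⟩ := Finset.mem_filter.1 hb
  refine mem_apex.2 ⟨(hB b hb).1, (hB b hb).2.1, fun w hw => ?_⟩
  rcases Finset.mem_insert.1 hw with rfl | hw
  · exact (hB b hb).2.2
  · rwa [Finset.mem_singleton.1 hw]

/-- A set missing the second root and attached to two vertices `p` and `o` is rooted at the first
root and `p`, or it has a part attached to `o` and another vertex that misses both roots. -/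
theorem rooted_or_part (M : G.MinBad W α β k) {D : Finset V} {p o : V} (hD : D ⊆ W)
    (hne : D.Nonempty) (hpW : p ∈ W) (hp : p ∉ D) (ho : o ∉ D) (hpo : p ≠ o)
    (hβ : ∀ v ∈ D, v ∉ β) (hcl : ∀ v ∈ D, ∀ w ∈ W, G.Adj v w → w ∈ D ∨ w = p ∨ w = o) :
    G.Rooted D α (G.nbr {p}) (k - 1) ∨ ∃ D' ⊆ D, D'.Nonempty ∧ (∀ v ∈ D', v ∉ α) ∧
      ∃ c ∈ W, c ≠ o ∧ c ∉ D' ∧ (c ∈ D ∨ c = p) ∧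
        ∀ v ∈ D', ∀ w ∈ W, G.Adj v w → w ∈ D' ∨ w = c ∨ w = o := by
  rw [or_iff_not_imp_right]
  intro hcon
  have hcut : ∀ D' ⊆ D, D'.Nonempty → ∀ c,
      ∃ v ∈ D', ∃ w ∈ W, G.Adj v w ∧ w ∉ D' ∧ w ≠ c := fun D' hD' hne' c =>
    M.cut_right (hD'.trans hD) hne' (M.ne_of_sub fun v hv => hβ v (hD' hv))
      (fun v hv => hβ v (hD' hv)) c
  have hk := M.two_le
  -- The one unit lost is the edge to `o`; the edge to `p` counts as an edge to the new root.
  have hd := rooted_deg (G := G) (W := W) (D := D) (α' := α) (β' := G.nbr {p})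
    (show 1 ≤ k by omega) (fun v hv => M.rooted.deg v (hD hv))
    (fun u hu v hv => M.rooted.sum u (hD hu) v (hD hv)) (fun v hv => by
      have h1 : G.degIn W v ≤ G.degIn (D ∪ {p} ∪ {o}) v := by
        refine Finset.card_le_card fun w hw => ?_
        obtain ⟨hw, hvw⟩ := Finset.mem_filter.1 hw
        refine Finset.mem_filter.2 ⟨?_, hvw⟩
        have := hcl v hv w hw hvw
        simp only [Finset.mem_union, Finset.mem_singleton]
        tauto
      rw [degIn_union (by simp [ho, hpo.symm]), degIn_union (by simp [hp]), degIn_singleton,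
        degIn_singleton] at h1
      unfold wdeg
      rw [if_neg (hβ v hv), mem_nbr_singleton, G.adj_comm p v]
      split_ifs at h1 ⊢ <;> omega)
  refine ⟨hne, fun D' hD' hne' hcl' => ⟨?_, ?_⟩, fun D' hD' hne' h1 h2 c => ?_, hd.1, hd.2⟩
  · by_contra hα
    push Not at hα
    refine hcon ⟨D', hD', hne', hα, p, hpW, hpo, fun h => hp (hD' h), Or.inr rfl,
      fun v hv w hw hvw => ?_⟩
    exact (hcl v (hD' hv) w hw hvw).imp_left fun h => hcl' v hv w h hvw
  · obtain ⟨v, hv, w, hw, hvw, hwD, hwo⟩ := hcut D' hD' hne' o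
    rcases hcl v (hD' hv) w hw hvw with h | rfl | h
    · exact absurd (hcl' v hv w h hvw) hwD
    · exact ⟨v, hv, mem_nbr_singleton.2 hvw.symm⟩
    · exact absurd h hwo
  · by_contra hc
    push Not at hc
    have hin : ∀ v ∈ D', ∀ w ∈ W, G.Adj v w → w ∈ D ∨ w = o := fun v hv w hw hvw => by
      rcases hcl v (hD' hv) w hw hvw with h | rfl | h
      · exact Or.inl h
      · exact absurd (mem_nbr_singleton.2 hvw.symm) (h2 v hv)
      · exact Or.inr h
    obtain ⟨v, hv, w, hw, hvw, hwD, hwo⟩ := hcut D' hD' hne' o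
    have hwD' := (hin v hv w hw hvw).resolve_right hwo
    obtain rfl := hc v hv w hwD' hvw hwD
    refine hcon ⟨D', hD', hne', h1, w, hw, hwo, hwD, Or.inl hwD', fun v hv z hz hvz => ?_⟩
    rcases hin v hv z hz hvz with h | h
    · exact or_iff_not_imp_left.2 fun h' => Or.inl (hc v hv z h hvz h')
    · exact Or.inr (Or.inr h)

/-- A vertex `a` with its neighbours in `α` as core, and a part `D` attached only to `a` and one
further vertex `c`, when some `4`-cycle through the second root avoids `D`. -/
theorem four_cycle_mem (M : G.MinBad W α β k) {a c : V} {C D : Finset V}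
    (P : G.Piece W ({a} ∪ G.apex W α {a}) C α β k) (hB : (G.apex W α {a}).Nonempty) (hDC : D ⊆ C)
    (hne : D.Nonempty) (hc : c ∈ C) (hcD : c ∉ D) (hβ : ∀ v ∈ D, v ∉ β)
    (hcl : ∀ v ∈ D, ∀ w ∈ W, G.Adj v w → w ∈ D ∨ w = a ∨ w = c) {u : V} (hu : u ∈ W)
    (hu2 : 2 ≤ G.degIn (W.filter (· ∈ β)) u) : u ∈ D := by
  by_contra huD
  have hk := M.three_le
  have hDW := hDC.trans P.subC
  obtain ⟨b, hb⟩ := hB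
  obtain ⟨hbW, hbα, hab⟩ := mem_apex.1 hb
  have hab : G.Adj a b := hab a (Finset.mem_singleton_self a)
  have haH : a ∈ ({a} : Finset V) ∪ G.apex W α {a} := by simp
  have hbH : b ∈ ({a} : Finset V) ∪ G.apex W α {a} := Finset.mem_union_right _ hb
  have haW := P.subH haH
  have haC : a ∉ C := fun h => P.notMem h haH
  have hbC : b ∉ C := fun h => P.notMem h hbH
  have haD : a ∉ D := fun h => haC (hDC h)
  have hcW := P.subC hc
  have hac : a ≠ c := fun h => haC (h ▸ hc)
  obtain ⟨r, hr, t, ht, hrt, hur, hut⟩ := two_le_degIn.1 hu2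
  obtain ⟨hrW, hrβ⟩ := Finset.mem_filter.1 hr
  obtain ⟨htW, htβ⟩ := Finset.mem_filter.1 ht
  have hrt_mem : ∀ v ∈ ({r, t} : Finset V), v ∈ W ∧ v ∈ β ∧ G.Adj u v := by
    intro v hv
    rcases Finset.mem_insert.1 hv with rfl | hv
    · exact ⟨hrW, hrβ, hur⟩
    · rw [Finset.mem_singleton.1 hv]; exact ⟨htW, htβ, hut⟩
  have hrS : r ∈ W \ insert u D := by
    simp only [Finset.mem_sdiff, Finset.mem_insert, not_or]
    exact ⟨hrW, hur.ne', fun h => hβ r h hrβ⟩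
  -- a path from the cycle to one of the two attachments
  obtain ⟨p, hp, n, hn⟩ := exists_pathIn (G := G) hrS (β := {p | p = a ∨ p = c})
    fun R hR hrR hclR => by
      by_contra hcon
      push Not at hcon
      -- If neither `a` nor `c` were reached, `u` would be a cut vertex separating `r` from `D`.
      have hall := M.no_cut hk (hR.trans Finset.sdiff_subset) ⟨r, hrR⟩ u fun v hv w hw hvw => by
        rw [or_iff_not_imp_right]
        intro hwu
        have hv' := hR hv
        simp only [Finset.mem_sdiff, Finset.mem_insert, not_or] at hv'
        refine hclR v hv w ?_ hvw
        simp only [Finset.mem_sdiff, Finset.mem_insert, not_or]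
        refine ⟨hw, hwu, fun hwD => ?_⟩
        rcases hcl w hwD v hv'.1 hvw.symm with h | h
        · exact hv'.2.2 h
        · exact hcon v hv h
      obtain ⟨d, hd⟩ := hne
      rcases hall d (hDW hd) with h | rfl
      · exact (Finset.mem_sdiff.1 (hR h)).2 (Finset.mem_insert_of_mem hd)
      · exact huD hd
  obtain ⟨e, he, m, hm⟩ := hn.last_of_mem (E := {r, t}) (by simp)
  -- attaching the cycle
  have key : GoodSet (k - 1) (G.Lens D α (G.nbr {p})) → False := by
    intro hg
    -- The lengths `0` and `2` along the 4-cycle make up for the unit lost.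
    refine M.bad (hg.add_even (p := 2) (a₀ := 0) (by omega) (by omega) (by omega) (m + 1)
      fun i hi n hn => ?_)
    obtain ⟨v, hv, w, hw, hpath⟩ := hn
    obtain ⟨s, hs, hq⟩ := exists_pathIn_even (G := G) (Z := {u}) (B := {r, t})
      (by simp [hur.ne, hut.ne]) (by simp [hur, hut]) he (j := i)
      (by simp; omega) (by rw [Finset.card_pair hrt]; omega)
    have h1 := hpath.join (mem_nbr_singleton.1 hw).symm hm.symm (by
      rw [Finset.disjoint_right]
      intro x hx hxD
      rcases Finset.mem_insert.1 hx with rfl | hx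
      · exact hβ x hxD (hrt_mem x he).2.1
      · simp only [Finset.mem_sdiff, Finset.mem_insert, not_or] at hx
        exact hx.1.2.2 hxD)
    have h2 := h1.append hq (by
      intro x hx hx'
      have hx2 : x = u ∨ x ∈ ({r, t} : Finset V) := by
        rwa [Finset.mem_union, Finset.mem_singleton] at hx'
      rcases Finset.mem_union.1 hx with hxD | hxS
      · rcases hx2 with hx2 | hx2
        · exact absurd (hx2 ▸ hxD) huD
        · exact absurd (hrt_mem x hx2).2.1 (hβ x hxD)
      · rcases Finset.mem_insert.1 hxS with hxe | hxS
        · exact hxe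
        · rw [Finset.mem_sdiff, Finset.mem_sdiff, Finset.mem_insert, not_or] at hxS
          rcases hx2 with hx2 | hx2
          · exact absurd hx2 hxS.1.2.1
          · exact absurd hx2 hxS.2)
    refine ⟨v, hv, s, (hrt_mem s hs).2.1, ?_⟩
    rw [show 0 + 2 * i + n + (m + 1) = n + m + 1 + 2 * i by omega]
    refine h2.mono (Finset.union_subset (Finset.union_subset hDW ?_) (Finset.union_subset ?_ ?_))
    · exact Finset.insert_subset (hrt_mem e he).1
        (Finset.sdiff_subset.trans Finset.sdiff_subset)
    · simpa using hu
    · exact fun x hx => (hrt_mem x hx).1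
  rcases hp with rfl | rfl
  · rcases M.rooted_or_part hDW hne haW haD hcD hac hβ hcl with
      hR | ⟨D', hD', hne', hα', c', hc'W, hc'c, hc'D', hc', hcl'⟩
    · exact key (M.good_of_rooted hDW (M.ne_of_sub hβ) hR)
    -- `D'` is attached to two vertices only and carries the full parameter. From `c'` the first
    -- root is reached through `D \ D'` and the core, from `c` the second root outside `D`.
    have hg := M.good_between (hD'.trans hDW) hne' hc'D' (fun h => hcD (hD' h)) hc'c hα'
      (fun v hv => hβ v (hD' hv)) hcl'
    obtain ⟨y, hy, l, hl⟩ := P.exists_pathIn_sdiff hDC hβ hc hcD fun v hv w hw hvw => by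
      rcases hcl v hv w (P.subC hw) hvw with h | rfl | h
      · exact Or.inl h
      · exact absurd hw haC
      · exact Or.inr h
    have hSW : D \ D' ∪ {p, b} ⊆ W := by
      refine Finset.union_subset (Finset.sdiff_subset.trans hDW) fun v hv => ?_
      rcases Finset.mem_insert.1 hv with rfl | hv
      · exact haW
      · rwa [Finset.mem_singleton.1 hv]
    obtain ⟨x, hx, j, hj⟩ := exists_pathIn (G := G) (S := D \ D' ∪ {p, b}) (a := c') (β := α) (by
      simp only [Finset.mem_union, Finset.mem_sdiff, Finset.mem_insert]
      tauto) fun R hR hcR hclR => by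
        by_contra hcon
        push Not at hcon
        have hpR : p ∉ R := fun h => hcon b (hclR p h b (by simp) hab) hbα
        have hRD : ∀ v ∈ R ∪ D', v ∉ α := fun v hv => (Finset.mem_union.1 hv).elim (hcon v) (hα' v)
        obtain ⟨v, hv, w, hw, hvw, hwn, hwc⟩ := M.cut_left
          (Finset.union_subset (hR.trans hSW) (hD'.trans hDW)) ⟨c', Finset.mem_union_left _ hcR⟩
          (M.symm.ne_of_sub hRD) hRD c
        rw [Finset.mem_union, not_or] at hwn
        rcases Finset.mem_union.1 hv with hv | hv
        · have hvD : v ∈ D := by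
            have h1 := hR hv
            simp only [Finset.mem_union, Finset.mem_sdiff, Finset.mem_insert,
              Finset.mem_singleton] at h1
            rcases h1 with h1 | rfl | rfl
            · exact h1.1
            · exact absurd hv hpR
            · exact absurd hbα (hcon _ hv)
          refine hwn.1 (hclR v hv w ?_ hvw)
          simp only [Finset.mem_union, Finset.mem_sdiff, Finset.mem_insert]
          rcases hcl v hvD w hw hvw with h | h | h
          · exact Or.inl ⟨h, hwn.2⟩
          · exact Or.inr (Or.inl h)
          · exact absurd h hwc
        · rcases hcl' v hv w hw hvw with h | rfl | h
          · exact hwn.2 h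
          · exact hwn.1 hcR
          · exact hwc h
    refine M.bad (hg.mono le_rfl _ fun n hn => lens_between (hD'.trans hDW) hSW
      (Finset.sdiff_subset.trans P.subC) ?_ ?_ ?_ hx hj.symm hy hl hn)
    · rw [Finset.disjoint_right]
      intro v hv hv'
      simp only [Finset.mem_union, Finset.mem_sdiff, Finset.mem_insert,
        Finset.mem_singleton] at hv'
      rcases hv' with h | rfl | rfl
      · exact h.2 hv
      · exact haD (hD' hv)
      · exact hbC (hDC (hD' hv))
    · exact Finset.disjoint_of_subset_left hD' Finset.disjoint_sdiff
    · rw [Finset.disjoint_right]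
      intro v hv hv'
      simp only [Finset.mem_union, Finset.mem_sdiff, Finset.mem_insert,
        Finset.mem_singleton] at hv hv'
      rcases hv' with h | rfl | rfl
      · exact hv.2 h.1
      · exact haC hv.1
      · exact hbC hv.1
  · rcases M.rooted_or_part hDW hne hcW hcD haD hac.symm hβ
      (fun v hv w hw hvw => (hcl v hv w hw hvw).imp_right Or.symm) with
      hR | ⟨D', hD', hne', hα', c', hc'W, hc'a, hc'D', hc', hcl'⟩
    · exact key (M.good_of_rooted hDW (M.ne_of_sub hβ) hR)
    -- Here `D'` is attached to `a` and `c'`: the first root is reached from `a` through `b`, the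
    -- second from `c'` inside `C \ D'`.
    have hg := M.good_between (hD'.trans hDW) hne' (fun h => haD (hD' h)) hc'D' hc'a.symm hα'
      (fun v hv => hβ v (hD' hv)) fun v hv w hw hvw => (hcl' v hv w hw hvw).imp_right Or.symm
    obtain ⟨y, hy, l, hl⟩ := P.exists_pathIn_sdiff (hD'.trans hDC) (fun v hv => hβ v (hD' hv))
      (c := c') (by
        rcases hc' with h | rfl
        · exact hDC h
        · exact hc) hc'D' fun v hv w hw hvw => by
      rcases hcl' v hv w (P.subC hw) hvw with h | h | rfl
      · exact Or.inl h
      · exact Or.inr h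
      · exact absurd hw haC
    have hbp : G.PathIn {a, b} b a 1 :=
      (PathIn.refl (G := G) (Finset.mem_singleton_self a)).cons hab.symm (by simp)
        (by simp [hab.ne']) (by simp)
    refine M.bad (hg.mono le_rfl _ fun n hn => lens_between (hD'.trans hDW) (S := {a, b}) ?_
      (Finset.sdiff_subset.trans P.subC) ?_ Finset.disjoint_sdiff ?_ hbα hbp hy hl hn)
    · intro v hv
      rcases Finset.mem_insert.1 hv with rfl | hv
      · exact haW
      · rwa [Finset.mem_singleton.1 hv]
    · rw [Finset.disjoint_insert_left, Finset.disjoint_singleton_left]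
      exact ⟨fun h => haD (hD' h), fun h => hbC (hDC (hD' h))⟩
    · rw [Finset.disjoint_insert_left, Finset.disjoint_singleton_left]
      exact ⟨fun h => haC (Finset.mem_sdiff.1 h).1, fun h => hbC (Finset.mem_sdiff.1 h).1⟩

/-- As there is no cut vertex, `D` is attached to exactly `a` and some `c`. A vertex `u` with two
neighbours in `β` lies in `D` by `four_cycle_mem`, so these neighbours are `a` and `c`. Then `u`,
`a`, `c` form a bipartite core at the second root. If it too runs into the exception, its pendant
set minus `D` is separated by at most one vertex, against `no_cut`. -/
theorem no_trouble (M : G.MinBad W α β k) {a : V} {C D : Finset V} {γ : Set V}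
    (P : G.Piece W ({a} ∪ G.apex W α {a}) C α β k) (hB : (G.apex W α {a}).Nonempty)
    (Q : G.Pendant C D β γ) (hDB : ∀ v ∈ D, v ∉ G.nbr (G.apex W α {a})) : False := by
  have hk := M.three_le
  have hDW := Q.sub.trans P.subC
  have ⟨b, hb⟩ := hB
  obtain ⟨hbW, hbα, hab⟩ := mem_apex.1 hb
  have hab : G.Adj a b := hab a (Finset.mem_singleton_self a)
  have hbH : b ∈ ({a} : Finset V) ∪ G.apex W α {a} := Finset.mem_union_right _ hb
  have haH : a ∈ ({a} : Finset V) ∪ G.apex W α {a} := by simp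
  have haC : a ∉ C := fun h => P.notMem h haH
  have hbC : b ∉ C := fun h => P.notMem h hbH
  have hout : ∀ v ∈ D, ∀ w ∈ W, G.Adj v w → w ∈ C ∨ w = a := fun v hv w hw hvw => by
    rcases P.closed v (Q.sub hv) w hw hvw with h | h
    · exact Or.inl h
    · rcases Finset.mem_union.1 h with h | h
      · exact Or.inr (Finset.mem_singleton.1 h)
      · exact absurd ⟨w, h, hvw.symm⟩ (hDB v hv)
  rcases Q.type with ⟨-, -, h⟩ | ⟨c, hc, hcD, -, hβ, h⟩
  · rcases M.no_cut hk hDW Q.nonempty a (fun v hv w hw hvw =>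
      (hout v hv w hw hvw).imp_left fun h' => h v hv w h' hvw) b hbW with h' | h'
    · exact hbC (Q.sub h')
    · exact hab.ne' h'
  have hcl : ∀ v ∈ D, ∀ w ∈ W, G.Adj v w → w ∈ D ∨ w = a ∨ w = c := fun v hv w hw hvw => by
    rcases hout v hv w hw hvw with h' | h'
    · exact (h v hv w h' hvw).imp_right Or.inr
    · exact Or.inr (Or.inl h')
  obtain ⟨u, hu, hu2⟩ := M.symm.exists_two_nbrs
  have huD := M.four_cycle_mem P hB Q.sub Q.nonempty hc hcD hβ hcl hu hu2
  have hac : a ≠ c := fun h => haC (h ▸ hc)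
  have huβ : ∀ v ∈ W, v ∈ β → G.Adj u v → v = a ∨ v = c := fun v hv hvβ huv =>
    (hcl u huD v hv huv).resolve_left fun h' => hβ v h' hvβ
  have haW := P.subH haH
  have hcW := P.subC hc
  have hac_mem : (a ∈ β ∧ G.Adj u a) ∧ c ∈ β ∧ G.Adj u c := by
    obtain ⟨r, hr, t, ht, hrt, hur, hut⟩ := two_le_degIn.1 hu2
    obtain ⟨hrW, hrβ⟩ := Finset.mem_filter.1 hr
    obtain ⟨htW, htβ⟩ := Finset.mem_filter.1 ht
    rcases huβ r hrW hrβ hur with rfl | rfl <;> rcases huβ t htW htβ hut with rfl | rfl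
    · exact absurd rfl hrt
    · exact ⟨⟨hrβ, hur⟩, htβ, hut⟩
    · exact ⟨⟨htβ, hut⟩, hrβ, hur⟩
    · exact absurd rfl hrt
  obtain ⟨⟨haβ, hua⟩, hcβ, huc⟩ := hac_mem
  have hmem : ∀ v ∈ ({a, c} : Finset V), v ∈ W ∧ v ∈ β ∧ G.Adj u v := by
    intro v hv
    rcases Finset.mem_insert.1 hv with rfl | hv
    · exact ⟨haW, haβ, hua⟩
    · rw [Finset.mem_singleton.1 hv]; exact ⟨hcW, hcβ, huc⟩
  have hHW : ({u} : Finset V) ∪ {a, c} ⊆ W :=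
    Finset.union_subset (by simpa using hu) fun v hv => (hmem v hv).1
  have hbu : b ≠ u := fun h => hbC (Q.sub (h ▸ huD))
  have hbc : b ≠ c := fun h => hbC (h ▸ hc)
  have P' := M.symm.piece hHW ⟨u, by simp⟩ ⟨b, mem_compOf_of_mem
    (by simp [hbW, hbu, hab.ne', hbc]) hbα⟩
  rcases P'.good_bipartite (by simp [hua.ne, huc.ne]) (by simp [hua, huc])
    (fun v hv => (hmem v hv).2.1) (by simp) (by rw [Finset.card_pair hac]; simp)
    (by simp; omega)
    (fun v hv hvβ => ⟨M.symm.degIn_left (fun w hw => ⟨(hmem w hw).1, (hmem w hw).2.1⟩)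
      (P'.subC hv) hvβ, by
        rw [degIn_singleton, if_neg]
        · simp
        · intro hvu
          refine P'.notMem hv (Finset.mem_union_right _ ?_)
          simpa using huβ v (P'.subC hv) hvβ hvu.symm⟩)
    (fun v hv _ h0 => by
      obtain ⟨z, hz, hvz⟩ := degIn_pos.1 h0
      rw [Finset.mem_singleton.1 hz] at hvz
      exact M.symm.degIn_apex hu (P'.subC hv) hvz.symm hmem)
    (fun v _ _ _ => (degIn_le_card _ _).trans (by rw [Finset.card_pair hac]; simp))
    M.below (card_lt P'.subC hu fun h' => P'.notMem h' (by simp)) with hg | ⟨-, D', γ', Q', h1, h2⟩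
  · exact M.symm.bad hg
  have ha' : a ∉ D' := fun h' => P'.notMem (Q'.sub h') (by simp)
  have hc' : c ∉ D' := fun h' => P'.notMem (Q'.sub h') (by simp)
  obtain ⟨d, hd⟩ : ∃ d, ∀ v ∈ D' \ D, ∀ w ∈ W, G.Adj v w → w ∈ D' \ D ∨
      (w = d ∧ d ∈ G.compOf (W \ ({u} ∪ {a, c})) α) := by
    have hin : ∀ v ∈ D' \ D, ∀ w ∈ W, G.Adj v w →
        w ∉ D ∧ w ∈ G.compOf (W \ ({u} ∪ {a, c})) α := by
      intro v hv w hw hvw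
      obtain ⟨hv, hvD⟩ := Finset.mem_sdiff.1 hv
      have hwD : w ∉ D := by
        intro hwD
        have hvH := P'.notMem (Q'.sub hv)
        simp only [Finset.mem_union, Finset.mem_singleton, Finset.mem_insert, not_or] at hvH
        rcases hcl w hwD v (P'.subC (Q'.sub hv)) hvw.symm with h' | h' | h'
        · exact hvD h'
        · exact hvH.2.1 h'
        · exact hvH.2.2 h'
      refine ⟨hwD, (P'.closed v (Q'.sub hv) w hw hvw).resolve_right fun hwH => ?_⟩
      rcases Finset.mem_union.1 hwH with h' | h'
      · exact hwD (Finset.mem_singleton.1 h' ▸ huD)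
      · exact h1 v hv ⟨w, h', hvw.symm⟩
    rcases Q'.type with ⟨-, -, h'⟩ | ⟨d, hd, -, -, -, h'⟩
    · exact ⟨a, fun v hv w hw hvw => Or.inl (Finset.mem_sdiff.2
        ⟨h' v (Finset.mem_sdiff.1 hv).1 w (hin v hv w hw hvw).2 hvw, (hin v hv w hw hvw).1⟩)⟩
    · refine ⟨d, fun v hv w hw hvw => ?_⟩
      rcases h' v (Finset.mem_sdiff.1 hv).1 w (hin v hv w hw hvw).2 hvw with h3 | h3
      · exact Or.inl (Finset.mem_sdiff.2 ⟨h3, (hin v hv w hw hvw).1⟩)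
      · exact Or.inr ⟨h3, hd⟩
  obtain ⟨v, hv, hvβ⟩ := h2
  have hne : (D' \ D).Nonempty := ⟨v, Finset.mem_sdiff.2 ⟨hv, fun h' => hβ v h' hvβ⟩⟩
  have hsub : D' \ D ⊆ W := Finset.sdiff_subset.trans (Q'.sub.trans P'.subC)
  have hall := M.no_cut hk hsub hne d fun v hv w hw hvw =>
    (hd v hv w hw hvw).imp_right And.left
  have h3 : a = d := (hall a haW).resolve_left fun h' => ha' (Finset.mem_sdiff.1 h').1
  have h4 : c = d := (hall c hcW).resolve_left fun h' => hc' (Finset.mem_sdiff.1 h').1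
  exact hac (h3.trans h4.symm)

theorem no_trouble_of_card_one (M : G.MinBad W α β k) {Z C : Finset V} (hZ : Z.card = 1)
    (P : G.Piece W (Z ∪ G.apex W α Z) C α β k) (hB : (G.apex W α Z).Nonempty) {D : Finset V}
    {γ : Set V} (Q : G.Pendant C D β γ) (hD : ∀ v ∈ D, v ∉ G.nbr (G.apex W α Z)) : False := by
  obtain ⟨a, rfl⟩ := Finset.card_eq_one.1 hZ
  exact M.no_trouble P hB Q hD

/-- A largest set `Z` that has more than `Z.card` common neighbours joined to the first root. -/
theorem bipartite_step (M : G.MinBad W α β k) :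
    ∃ Z ⊆ W, 1 ≤ Z.card ∧ Z.card + 1 ≤ (G.apex W α Z).card ∧ Z.card + 1 ≤ k ∧
      (∀ u ∈ W, u ∉ Z → G.degIn (G.apex W α Z) u ≤ Z.card + 1) ∧
      ∀ v ∈ W, v ∈ β → v ∈ Z ∪ G.apex W α Z := by
  obtain ⟨u₀, hu₀, h2⟩ := M.exists_two_nbrs
  have hu₀2 : 2 ≤ (G.apex W α {u₀}).card := by
    refine h2.trans (Finset.card_le_card fun v hv => ?_)
    simp only [Finset.mem_filter] at hv
    exact mem_apex.2 ⟨hv.1.1, hv.1.2, by simpa using hv.2⟩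
  obtain ⟨Z, hZ, hmax⟩ := Finset.exists_max_image
    (W.powerset.filter fun Z : Finset V => Z.card + 1 ≤ (G.apex W α Z).card)
    Finset.card ⟨{u₀}, by simpa using ⟨hu₀, hu₀2⟩⟩
  have hZ1 : 1 ≤ Z.card := hmax {u₀} (by simpa using ⟨hu₀, hu₀2⟩)
  simp only [Finset.mem_filter, Finset.mem_powerset] at hZ hmax
  obtain ⟨hZW, hZc⟩ := hZ
  have hZne : Z.Nonempty := Finset.card_pos.1 (by omega)
  set B := G.apex W α Z with hBdef
  have hZB : ∀ z ∈ Z, ∀ b ∈ B, G.Adj z b := fun z hz b hb => (mem_apex.1 hb).2.2 z hz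
  have hB : ∀ b ∈ B, b ∈ W ∧ b ∈ α := fun b hb => ⟨(mem_apex.1 hb).1, (mem_apex.1 hb).2.1⟩
  have hd : Disjoint Z B := disjoint_apex
  have hHW : Z ∪ B ⊆ W := Finset.union_subset hZW fun b hb => (hB b hb).1
  have hHne : (Z ∪ B).Nonempty := hZne.mono Finset.subset_union_left
  have hmax' : ∀ u ∈ W, u ∉ Z → G.degIn B u ≤ Z.card + 1 := by
    intro u hu huZ
    by_contra hlt
    have hle : G.degIn B u ≤ (G.apex W α (insert u Z)).card := by
      refine Finset.card_le_card fun v hv => ?_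
      obtain ⟨hv, huv⟩ := Finset.mem_filter.1 hv
      refine mem_apex.2 ⟨(hB v hv).1, (hB v hv).2, fun z hz => ?_⟩
      rcases Finset.mem_insert.1 hz with rfl | hz
      · exact huv
      · exact hZB z hz v hv
    have hc := Finset.card_insert_of_notMem huZ
    have := hmax (insert u Z) ⟨Finset.insert_subset hu hZW, by omega⟩
    omega
  -- If `k ≤ Z.card`, the core alone has `k` lengths of one parity at any exit.
  have hk : Z.card + 1 ≤ k := by
    by_contra hlt
    obtain ⟨e, he, b, hb, n, hn⟩ := M.exists_exit hHW hHne
    have key : ∃ c, ∀ i < k, ∃ a ∈ α, G.PathIn (Z ∪ B) e a (c + 2 * i) := by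
      rcases Finset.mem_union.1 he with he | he
      · refine ⟨1, fun i hi => ?_⟩
        obtain ⟨a, ha, hp⟩ := exists_pathIn_odd hd hZB he (j := i) (by omega) (by omega)
        exact ⟨a, (hB a ha).2, hp⟩
      · refine ⟨0, fun i hi => ?_⟩
        obtain ⟨a, ha, hp⟩ := exists_pathIn_even hd hZB he (j := i) (by omega) (by omega)
        rw [Nat.zero_add]
        exact ⟨a, (hB a ha).2, hp⟩
    obtain ⟨c, hc⟩ := key
    refine M.bad (Or.inr ⟨c + n, fun i hi => ?_⟩)
    obtain ⟨a, ha, hp⟩ := hc i hi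
    rw [show c + n + 2 * i = c + 2 * i + n by omega]
    exact lens_of_exit hHW Finset.sdiff_subset Finset.disjoint_sdiff ha hp hb hn
  refine ⟨Z, hZW, hZ1, hZc, hk, hmax', fun v hv hvβ => ?_⟩
  by_contra hvH
  have P := M.piece hHW hHne ⟨v, mem_compOf_of_mem (Finset.mem_sdiff.2 ⟨hv, hvH⟩) hvβ⟩
  obtain ⟨z₀, hz₀⟩ := hHne
  rcases P.good_bipartite hd hZB (fun b hb => (hB b hb).2) hZ1 hZc hk
    (fun u hu huα => ⟨M.degIn_left hB (P.subC hu) huα, by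
      refine lt_of_le_of_ne (degIn_le_card _ _) fun h => P.notMem hu (Finset.mem_union_right _ ?_)
      exact mem_apex.2 ⟨P.subC hu, huα, fun z hz => (degIn_eq_card.1 h z hz).symm⟩⟩)
    (fun u hu _ h0 => by
      obtain ⟨z, hz, huz⟩ := degIn_pos.1 h0
      exact M.degIn_apex (hZW hz) (P.subC hu) huz.symm
        fun b hb => ⟨(hB b hb).1, (hB b hb).2, hZB z hz b hb⟩)
    (fun u hu _ _ => hmax' u (P.subC hu) fun h => P.notMem hu (Finset.mem_union_left _ h))
    M.below (card_lt P.subC (hHW hz₀) fun h => P.notMem h hz₀) with hg | ⟨h1, D, γ, Q, hD, -⟩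
  · exact M.bad hg
  · exact M.no_trouble_of_card_one h1 P (Finset.card_pos.1 (show 0 < B.card by omega)) Q hD

/-- A bipartite core at the second root whose larger side consists of all neighbours of the root. -/
theorem right_core (M : G.MinBad W α β k) {Z : Finset V} (hZ1 : 1 ≤ Z.card) (hZk : Z.card + 1 ≤ k)
    (hZW : Z ⊆ W) (hZβ : ∀ z ∈ Z, ∀ b ∈ W, b ∈ β → G.Adj z b)
    (hc : Z.card + 1 ≤ (W.filter (· ∈ β)).card)
    (h₃ : ∀ u ∈ W, u ∉ Z → G.degIn (W.filter (· ∈ β)) u ≤ Z.card + 1) {v : V} (hv : v ∈ W)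
    (hvα : v ∈ α) (hvβ : v ∉ β) (hvZ : v ∉ Z) : False := by
  have hB : ∀ b ∈ W.filter (· ∈ β), b ∈ W ∧ b ∈ β := fun b hb => Finset.mem_filter.1 hb
  have hd : Disjoint Z (W.filter (· ∈ β)) := Finset.disjoint_left.2 fun z hz hz' =>
    G.irrefl (hZβ z hz z (hB z hz').1 (hB z hz').2)
  have hHW : Z ∪ W.filter (· ∈ β) ⊆ W := Finset.union_subset hZW (Finset.filter_subset _ _)
  obtain ⟨z₀, hz₀⟩ : Z.Nonempty := Finset.card_pos.1 (by omega)
  have hz₀H : z₀ ∈ Z ∪ W.filter (· ∈ β) := Finset.mem_union_left _ hz₀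
  have P := M.symm.piece hHW ⟨z₀, hz₀H⟩ ⟨v, mem_compOf_of_mem (by simp [hv, hvβ, hvZ]) hvα⟩
  -- All of `β` lies in the core, which rules out the exceptional outcome of `good_bipartite`.
  have hout : ∀ u ∈ G.compOf (W \ (Z ∪ W.filter (· ∈ β))) α, u ∉ β := fun u hu huβ =>
    P.notMem hu (Finset.mem_union_right _ (Finset.mem_filter.2 ⟨P.subC hu, huβ⟩))
  rcases P.good_bipartite hd (fun z hz b hb => hZβ z hz b (hB b hb).1 (hB b hb).2)
    (fun b hb => (hB b hb).2) hZ1 hc hZk (fun u hu huβ => absurd huβ (hout u hu))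
    (fun u hu _ h0 => by
      obtain ⟨z, hz, huz⟩ := degIn_pos.1 h0
      exact M.symm.degIn_apex (hZW hz) (P.subC hu) huz.symm
        fun b hb => ⟨(hB b hb).1, (hB b hb).2, hZβ z hz b (hB b hb).1 (hB b hb).2⟩)
    (fun u hu _ _ => h₃ u (P.subC hu) fun h => P.notMem hu (Finset.mem_union_left _ h))
    M.below (card_lt P.subC (hHW hz₀H) fun h => P.notMem h hz₀H) with
    hg | ⟨-, D, γ, Q, -, w, hw, hwβ⟩
  · exact M.symm.bad hg
  · exact hout w (Q.sub hw) hwβ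

/-- Both roots have the same neighbours `B`, and the set `Z` is complete to `B`. -/
theorem equal_terminals (M : G.MinBad W α β k) {Z B : Finset V} (hZW : Z ⊆ W) (hZ1 : 1 ≤ Z.card)
    (hc : Z.card + 1 ≤ B.card) (hZB : ∀ z ∈ Z, ∀ b ∈ B, G.Adj z b)
    (hB : ∀ b ∈ B, b ∈ W ∧ b ∈ α ∧ b ∈ β) (hα : ∀ v ∈ W, v ∈ α → v ∈ B)
    (hβ : ∀ v ∈ W, v ∈ β → v ∈ B) (hmax : ∀ u ∈ W, u ∉ Z → G.degIn B u ≤ Z.card + 1) :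
    False := by
  have hd : Disjoint Z B := Finset.disjoint_left.2 fun z hz hz' => G.irrefl (hZB z hz z hz')
  have hBW : B ⊆ W := fun b hb => (hB b hb).1
  have hBαW : ∀ b ∈ B, b ∈ W ∧ b ∈ α := fun b hb => ⟨(hB b hb).1, (hB b hb).2.1⟩
  obtain ⟨b, hb⟩ : B.Nonempty := Finset.card_pos.1 (by omega)
  obtain ⟨hbW, hbα, hbβ⟩ := hB b hb
  by_cases hk : k ≤ Z.card + 1
  · refine M.bad (Or.inr ⟨0, fun i hi => ?_⟩)
    obtain ⟨a, ha, hp⟩ := exists_pathIn_even hd hZB hb (j := i) (by omega) (by omega)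
    rw [Nat.zero_add]
    exact ⟨b, hbα, a, (hB a ha).2.2, hp.mono (Finset.union_subset hZW hBW)⟩
  by_cases hB2 : B.card = 2
  · obtain ⟨p, q, hpq, rfl⟩ := Finset.card_eq_two.1 hB2
    obtain ⟨w, hw⟩ : Z.Nonempty := Finset.card_pos.1 (by omega)
    have hwB := Finset.disjoint_left.1 hd hw
    have hp := hB p (by simp)
    have hq := hB q (by simp)
    simp only [Finset.mem_insert, Finset.mem_singleton, not_or] at hwB hα hβ
    exact M.two_terminals hpq hp.1 hq.1 hp.2.1 hq.2.2 hα hβ (hZW hw) hwB.1 hwB.2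
  -- One vertex `b` of `B` is to become the second root. `Z` is shrunk if necessary so that `B.erase
  -- b` is still larger.
  obtain ⟨Z', hZ', hZc'⟩ := Finset.exists_subset_card_eq
    (show min Z.card (B.card - 2) ≤ Z.card from min_le_left _ _)
  have hmin1 : min Z.card (B.card - 2) = Z.card ∨ min Z.card (B.card - 2) = B.card - 2 := by omega
  have hBb : B.erase b ⊆ B := Finset.erase_subset _ _
  have hcB := Finset.card_erase_of_mem hb
  have hbZ : b ∉ Z' := fun h => Finset.disjoint_left.1 hd (hZ' h) hb
  have hd' : Disjoint Z' (B.erase b) :=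
    Finset.disjoint_of_subset_left hZ' (Finset.disjoint_of_subset_right hBb hd)
  have hS : ∀ v ∈ W \ (Z' ∪ B), v ∈ W ∧ v ∉ Z' ∧ v ∉ B := fun v hv => by
    simpa only [Finset.mem_sdiff, Finset.mem_union, not_or] using hv
  -- Inside the core and to the roots, `b` has weighted degree at most `Z.card + 2 ≤ k`, so it has a
  -- further neighbour.
  obtain ⟨v, hv, hbv⟩ : ∃ v ∈ W \ (Z' ∪ B), G.Adj b v := by
    rw [← degIn_pos]
    have e1 := M.rooted.deg b hbW
    have e2 : G.degIn W b = G.degIn (W \ (Z' ∪ B)) b + (G.degIn Z' b + G.degIn B b) := by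
      rw [← degIn_union (Finset.disjoint_of_subset_left hZ' hd),
        ← degIn_union Finset.sdiff_disjoint,
        Finset.sdiff_union_of_subset (Finset.union_subset (hZ'.trans hZW) hBW)]
    have e3 := M.degIn_left hBαW hbW hbα
    have e4 := degIn_le_card (G := G) Z' b
    unfold wdeg at e1
    rw [if_pos hbα, if_pos hbβ] at e1
    omega
  have P := M.reroot (S := W \ (Z' ∪ B)) (H := Z' ∪ B.erase b) (e := b) (α' := α)
    Finset.sdiff_subset
    (Finset.disjoint_of_subset_left (Finset.union_subset_union_right hBb) Finset.disjoint_sdiff)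
    (by simp [hb]) (by simp [hbZ]) (fun v hv h' => (hS v hv).2.2 (hβ v (hS v hv).1 h'))
    (fun v _ h' => h') (fun u _ w hw _ => by
      simp only [Finset.mem_sdiff, Finset.mem_union, Finset.mem_erase]
      tauto) ⟨v, hv, hbv⟩
  have hbS : b ∉ W \ (Z' ∪ B) ∪ (Z' ∪ B.erase b) := by simp [hb, hbZ]
  have hsub : W \ (Z' ∪ B) ∪ (Z' ∪ B.erase b) ⊆ W := Finset.union_subset Finset.sdiff_subset
    (Finset.union_subset (hZ'.trans hZW) (hBb.trans hBW))
  have hout : ∀ u ∈ G.compOf (W \ (Z' ∪ B)) (G.nbr {b}), u ∉ α := fun u hu h' =>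
    have := hS u (compOf_subset hu)
    this.2.2 (hα u this.1 h')
  rcases P.good_bipartite hd' (fun z hz c hc => hZB z (hZ' hz) c (hBb hc))
    (fun c hc => (hB c (hBb hc)).2.1) (by omega) (by omega) (by omega)
    (fun u hu h' => absurd h' (hout u hu)) (fun u hu _ h0 => by
      obtain ⟨z, hz, huz⟩ := degIn_pos.1 h0
      exact M.degIn_apex (hZW (hZ' hz)) (hS u (compOf_subset hu)).1 huz.symm
        fun b hb => ⟨(hB b (hBb hb)).1, (hB b (hBb hb)).2.1, hZB z (hZ' hz) b (hBb hb)⟩)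
    (fun u hu _ _ => by
      have e1 := degIn_le_card (G := G) (B.erase b) u
      rcases hmin1 with h | h
      · obtain rfl : Z' = Z := Finset.eq_of_subset_of_card_le hZ' (by omega)
        have := hS u (compOf_subset hu)
        exact (degIn_mono hBb u).trans (hmax u this.1 this.2.1)
      · omega)
    M.below (card_lt (P.subC.trans hsub) hbW fun h' => hbS (P.subC h')) with
    hg | ⟨-, D, γ, Q, -, w, hw, hwα⟩
  · refine M.bad (hg.mono le_rfl 1 ?_)
    rintro n ⟨a, ha, g, hg, hp⟩
    exact ⟨a, ha, b, hbβ, (hp.join (mem_nbr_singleton.1 hg).symm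
      (PathIn.refl (Finset.mem_singleton_self b)) (Finset.disjoint_singleton_right.2 hbS)).mono
      (Finset.union_subset hsub (by simpa using hbW))⟩
  · exact hout w (Q.sub hw) hwα

/-! ### End of the induction -/

protected theorem false (M : G.MinBad W α β k) : False := by
  obtain ⟨Z, hZW, hZ1, hZc, hk, hmax, hβ⟩ := M.bipartite_step
  set B := G.apex W α Z with hBdef
  have hZB : ∀ z ∈ Z, ∀ b ∈ B, G.Adj z b := fun z hz b hb => (mem_apex.1 hb).2.2 z hz
  have hB : ∀ b ∈ B, b ∈ W ∧ b ∈ α := fun b hb => ⟨(mem_apex.1 hb).1, (mem_apex.1 hb).2.1⟩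
  have hd : Disjoint Z B := disjoint_apex
  have hc2 : 2 ≤ (W.filter (· ∈ β)).card := by
    obtain ⟨r, hr, hrβ⟩ := M.exists_mem_right
    obtain ⟨t, ht, htβ, htr⟩ := M.exists_right r
    exact Finset.one_lt_card.2 ⟨r, Finset.mem_filter.2 ⟨hr, hrβ⟩, t, Finset.mem_filter.2 ⟨ht, htβ⟩,
      htr.symm⟩
  by_cases hr : ∃ r ∈ W, r ∈ β ∧ r ∈ Z
  -- As `β` is independent and `Z` is complete to `B`, all of `β` now lies in `Z`. The sides swap
  -- roles: part of `B` together with `β` is a core at the second root, and some vertex of `B`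
  -- remains outside it.
  · obtain ⟨r, hr, hrβ, hrZ⟩ := hr
    have hβZ : ∀ v ∈ W, v ∈ β → v ∈ Z := fun v hv hvβ =>
      (Finset.mem_union.1 (hβ v hv hvβ)).resolve_right fun h =>
        M.indep_right hr hrβ hv hvβ (hZB r hrZ v h)
    have hcZ : (W.filter (· ∈ β)).card ≤ Z.card := Finset.card_le_card fun v hv =>
      hβZ v (Finset.mem_filter.1 hv).1 (Finset.mem_filter.1 hv).2
    obtain ⟨Z', hZ', hZc'⟩ := Finset.exists_subset_card_eq
      (show (W.filter (· ∈ β)).card - 1 ≤ B.card by omega)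
    obtain ⟨b, hb, hbZ⟩ := Finset.exists_mem_notMem_of_card_lt_card
      (show Z'.card < B.card by omega)
    exact M.right_core (Z := Z') (by omega) (by omega) (fun z hz => (hB z (hZ' hz)).1)
      (fun z hz c hc hcβ => (hZB c (hβZ c hc hcβ) z (hZ' hz)).symm) (by omega)
      (fun u _ _ => (degIn_le_card _ _).trans (by omega)) (hB b hb).1 (hB b hb).2
      (fun h => Finset.disjoint_left.1 hd (hβZ b (hB b hb).1 h) hb) hbZ
  · have hβB : ∀ v ∈ W, v ∈ β → v ∈ B := fun v hv hvβ =>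
      (Finset.mem_union.1 (hβ v hv hvβ)).resolve_left fun h => hr ⟨v, hv, hvβ, h⟩
    have hsub : W.filter (· ∈ β) ⊆ B := fun v hv =>
      hβB v (Finset.mem_filter.1 hv).1 (Finset.mem_filter.1 hv).2
    by_cases ha : ∃ a ∈ W, a ∈ α ∧ a ∉ β
    · obtain ⟨a, ha, haα, haβ⟩ := ha
      -- `β` may be smaller than `B`, so `Z` is cut down until `β` again has more vertices.
      obtain ⟨Z', hZ', hZc'⟩ := Finset.exists_subset_card_eq
        (show min Z.card ((W.filter (· ∈ β)).card - 1) ≤ Z.card from min_le_left _ _)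
      refine M.right_core (Z := Z') (by omega) (by omega) (hZ'.trans hZW)
        (fun z hz c hc hcβ => hZB z (hZ' hz) c (hβB c hc hcβ)) (by omega)
        (fun u hu huZ => ?_) ha haα haβ fun h => ?_
      · have e1 := degIn_le_card (G := G) (W.filter (· ∈ β)) u
        by_cases h : Z'.card = Z.card
        · obtain rfl : Z' = Z := Finset.eq_of_subset_of_card_le hZ' (by omega)
          exact (degIn_mono hsub u).trans (hmax u hu huZ)
        · omega
      · obtain ⟨b, hb⟩ : B.Nonempty := Finset.card_pos.1 (by omega)
        exact M.indep_left ha haα (hB b hb).1 (hB b hb).2 (hZB a (hZ' h) b hb)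
    · push Not at ha
      exact M.equal_terminals hZW hZ1 hZc hZB
        (fun b hb => ⟨(hB b hb).1, (hB b hb).2, ha b (hB b hb).1 (hB b hb).2⟩)
        (fun v hv h => hβB v hv (ha v hv h)) hβB hmax

end MinBad

theorem goodBelow (G : SimpleGraph V) (N : ℕ) : G.GoodBelow N := by
  induction N with
  | zero => exact fun W α β k h => absurd h (Nat.not_lt_zero _)
  | succ N ih =>
    intro W α β k hW hR
    by_contra hbad
    exact MinBad.false ⟨hR, fun W' α' β' k' h => ih W' α' β' k' (by omega), hbad⟩

theorem Rooted.good {W : Finset V} {α β : Set V} {k : ℕ} (h : G.Rooted W α β k) :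
    GoodSet k (G.Lens W α β) :=
  G.goodBelow (W.card + 1) W α β k (Nat.lt_succ_self _) h

/-! ### Back to the original graph -/

theorem PathIn.mono_graph {G' : SimpleGraph V} {S : Finset V} {a b : V} {n : ℕ}
    (h : G.PathIn S a b n) (hG : ∀ v ∈ S, ∀ w ∈ S, G.Adj v w → G'.Adj v w) :
    G'.PathIn S a b n := by
  induction n generalizing S a with
  | zero => exact h
  | succ n ih =>
    obtain ⟨ha, c, hac, hc⟩ := h
    exact ⟨ha, c, hG a ha c (Finset.mem_of_mem_erase hc.mem_left) hac, ih hc fun v hv w hw =>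
      hG v (Finset.mem_of_mem_erase hv) w (Finset.mem_of_mem_erase hw)⟩

theorem PathIn.exists_isPath {S : Finset V} {a b : V} {n : ℕ} (h : G.PathIn S a b n) :
    ∃ p : G.Walk a b, p.IsPath ∧ p.length = n ∧ ∀ v ∈ p.support, v ∈ S := by
  induction n generalizing S a with
  | zero =>
    obtain ⟨rfl, ha⟩ := h
    exact ⟨Walk.nil, by simp, rfl, by simpa using ha⟩
  | succ n ih =>
    obtain ⟨ha, c, hac, hc⟩ := h
    obtain ⟨p, hp, hl, hs⟩ := ih hc
    refine ⟨Walk.cons hac p, ?_, by simp [hl], fun v hv => ?_⟩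
    · rw [Walk.cons_isPath_iff]
      exact ⟨hp, fun h' => Finset.notMem_erase a S (hs a h')⟩
    · rw [Walk.support_cons, List.mem_cons] at hv
      rcases hv with rfl | hv
      · exact ha
      · exact Finset.mem_of_mem_erase (hs v hv)

theorem Connected.exists_adj {H : SimpleGraph V} (h : H.Connected) {D : Set V} {d o : V}
    (hd : d ∈ D) (ho : o ∉ D) : ∃ v ∈ D, ∃ w ∉ D, H.Adj v w := by
  obtain ⟨p⟩ := h.preconnected d o
  obtain ⟨e, -, h1, h2⟩ := p.exists_boundary_dart D hd ho
  exact ⟨e.fst, h1, e.snd, h2, e.adj⟩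

theorem IsTwoConnected.exists_adj {H : SimpleGraph V} (h : H.IsTwoConnected) {D : Set V} {d o : V}
    (hd : d ∈ D) (ho : o ∉ D) (c : V) (hoc : o ≠ c) : ∃ v ∈ D, ∃ w ∉ D, H.Adj v w ∧ w ≠ c := by
  by_cases hc : c ∈ D
  · obtain ⟨v, hv, w, hw, hvw⟩ := h.2.1.exists_adj hd ho
    exact ⟨v, hv, w, hw, hvw, fun h' => hw (h' ▸ hc)⟩
  · have hdc : d ≠ c := fun h' => hc (h' ▸ hd)
    obtain ⟨⟨v, hvc⟩, hv, ⟨w, hwc⟩, hw, hvw⟩ := (h.2.2 c).exists_adj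
      (D := {v : {w | w ≠ c} | (v : V) ∈ D}) (d := ⟨d, hdc⟩) (o := ⟨o, hoc⟩) hd ho
    exact ⟨v, hv, w, hw, hvw, hwc⟩

theorem addEdge_adj_of_ne {x y v w : V} (hx : v ≠ x) (hy : v ≠ y) (h : (G.addEdge x y).Adj v w) :
    G.Adj v w := by
  rw [addEdge, sup_adj, edge_adj] at h
  tauto

theorem removeEdge_adj {x y v w : V} : (G.removeEdge x y).Adj v w ↔
    G.Adj v w ∧ s(v, w) ≠ s(x, y) := by
  rw [removeEdge, deleteEdges_adj]
  simp

theorem degree_eq_wdeg [Fintype V] [DecidableRel G.Adj] {x y v : V} (hxy : x ≠ y) :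
    G.degree v = G.wdeg (Finset.univ \ {x, y}) {w | G.Adj x w} {w | G.Adj y w} v := by
  have h1 : G.degree v = G.degIn Finset.univ v := by
    rw [← card_neighborFinset_eq_degree, neighborFinset_eq_filter, degIn]
    congr!
  have h2 : (Finset.univ : Finset V) = (Finset.univ \ {x, y} ∪ {x}) ∪ {y} := by
    ext w
    simp only [Finset.mem_union, Finset.mem_sdiff, Finset.mem_univ, Finset.mem_insert,
      Finset.mem_singleton]
    tauto
  rw [h1]
  nth_rewrite 1 [h2]
  rw [degIn_union (by simp [hxy.symm]), degIn_union (by simp), degIn_singleton, degIn_singleton,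
    wdeg, Set.mem_ofPred_eq, Set.mem_ofPred_eq, G.adj_comm x v, G.adj_comm y v]

theorem rooted_of_isTwoConnected [Fintype V] [DecidableRel G.Adj] {x y : V} (hxy : x ≠ y) {k : ℕ}
    (hconn : (G.addEdge x y).IsTwoConnected)
    (hdeg : ∀ v : V, v ≠ x → v ≠ y → k + 1 ≤ G.degree v)
    (hsum : ∀ u v : V, G.Adj u v → u ≠ x → u ≠ y → v ≠ x → v ≠ y →
      2 * k + 3 ≤ G.degree u + G.degree v) :
    G.Rooted (Finset.univ \ {x, y}) {w | G.Adj x w} {w | G.Adj y w} k := by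
  have hW : ∀ v, v ∈ (Finset.univ \ {x, y} : Finset V) ↔ v ≠ x ∧ v ≠ y := by simp
  have hout : ∀ D : Finset V, D ⊆ Finset.univ \ {x, y} → x ∉ (D : Set V) ∧ y ∉ (D : Set V) :=
    fun D hD => ⟨fun h => ((hW x).1 (hD h)).1 rfl, fun h => ((hW y).1 (hD h)).2 rfl⟩
  -- an edge that leaves `D` and avoids `c`
  have hcross : ∀ D : Finset V, D ⊆ Finset.univ \ {x, y} → D.Nonempty → ∀ c,
      ∃ v ∈ D, ∃ w ∉ D, G.Adj v w ∧ w ≠ c := by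
    rintro D hD ⟨d, hd⟩ c
    -- One of `x`, `y` differs from `c` and lies outside `D`; the added edge `x y` has no end in
    -- `D`, so the crossing edge belongs to `G`.
    obtain ⟨o, ho, hoc⟩ : ∃ o ∉ (D : Set V), o ≠ c := by
      by_cases hxc : x = c
      · exact ⟨y, (hout D hD).2, fun h => hxy (hxc.trans h.symm)⟩
      · exact ⟨x, (hout D hD).1, hxc⟩
    obtain ⟨v, hv, w, hw, hvw, hwc⟩ := hconn.exists_adj (D := (D : Set V)) hd ho c hoc
    have hv' := (hW v).1 (hD hv)
    exact ⟨v, hv, w, hw, addEdge_adj_of_ne hv'.1 hv'.2 hvw, hwc⟩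
  refine ⟨?_, fun D hD hne hcl => ⟨?_, ?_⟩, fun D hD hne hα hβ c => ?_, fun v hv => ?_,
    fun u hu v hv huv => ?_⟩
  · rw [← Finset.card_pos, Finset.card_sdiff_of_subset (Finset.subset_univ _),
      Finset.card_pair hxy, Finset.card_univ, ← Nat.card_eq_fintype_card]
    have := hconn.1
    omega
  -- An edge that leaves a closed set and avoids `y` can only end at `x`.
  · obtain ⟨v, hv, w, hw, hvw, hwy⟩ := hcross D hD hne y
    refine ⟨v, hv, ?_⟩
    by_cases hwx : w = x
    · exact hwx ▸ hvw.symm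
    · exact absurd (hcl v hv w ((hW w).2 ⟨hwx, hwy⟩) hvw) hw
  · obtain ⟨v, hv, w, hw, hvw, hwx⟩ := hcross D hD hne x
    refine ⟨v, hv, ?_⟩
    by_cases hwy : w = y
    · exact hwy ▸ hvw.symm
    · exact absurd (hcl v hv w ((hW w).2 ⟨hwx, hwy⟩) hvw) hw
  · obtain ⟨v, hv, w, hw, hvw, hwc⟩ := hcross D hD hne c
    refine ⟨v, hv, w, (hW w).2 ⟨?_, ?_⟩, hvw, hw, hwc⟩
    · rintro rfl
      exact hα v hv hvw.symm
    · rintro rfl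
      exact hβ v hv hvw.symm
  · rw [← degree_eq_wdeg hxy]
    exact hdeg v ((hW v).1 hv).1 ((hW v).1 hv).2
  · rw [← degree_eq_wdeg hxy, ← degree_eq_wdeg hxy]
    exact hsum u v huv ((hW u).1 hu).1 ((hW u).1 hu).2 ((hW v).1 hv).1 ((hW v).1 hv).2

theorem exists_path_of_mem_lens [Fintype V] {x y : V} (hxy : x ≠ y) {n : ℕ}
    (h : n ∈ G.Lens (Finset.univ \ {x, y}) {w | G.Adj x w} {w | G.Adj y w}) :
    ∃ P : (G.removeEdge x y).Path x y, (P : (G.removeEdge x y).Walk x y).length = n + 2 := by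
  obtain ⟨a, hxa, b, hyb, hp⟩ := h
  have hW : ∀ v, v ∈ (Finset.univ \ {x, y} : Finset V) → v ≠ x ∧ v ≠ y := by simp
  have key : ∀ v w, G.Adj v w → w ≠ x → w ≠ y → (G.removeEdge x y).Adj v w := by
    intro v w hvw h1 h2
    refine removeEdge_adj.2 ⟨hvw, fun h => ?_⟩
    have : w ∈ s(x, y) := h ▸ Sym2.mem_mk_right v w
    rcases Sym2.mem_iff.1 this with h | h
    · exact h1 h
    · exact h2 h
  have hp' := hp.mono_graph (G' := G.removeEdge x y) fun v _ w hw hvw =>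
    key v w hvw (hW w hw).1 (hW w hw).2
  have ha := hW a hp.mem_left
  have hb := hW b hp.mem_right
  have h1 := (hp'.join (key y b hyb hb.1 hb.2).symm (PathIn.refl (Finset.mem_singleton_self y))
    (by simp)).cons (T := Finset.univ) (key x a hxa ha.1 ha.2) (Finset.mem_univ _)
    (by simp [hxy]) (Finset.subset_univ _)
  obtain ⟨p, hpath, hl, -⟩ := h1.exists_isPath
  exact ⟨⟨p, hpath⟩, hl⟩

end SimpleGraph

end RootedPaths

theorem theorem4p2 {V : Type*} [Fintype V] (G : SimpleGraph V) [DecidableRel G.Adj]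
    (x y : V) (hxy : x ≠ y) (k : ℕ)
    (hconn : (G.addEdge x y).IsTwoConnected)
    (hdeg : ∀ v : V, v ≠ x → v ≠ y → k + 1 ≤ G.degree v)
    (hsum : ∀ u v : V, G.Adj u v → u ≠ x → u ≠ y → v ≠ x → v ≠ y →
      2 * k + 3 ≤ G.degree u + G.degree v) :
    (G.removeEdge x y).HasPathsInProgression x y (k + 1) 1 ∨
      (G.removeEdge x y).HasPathsInProgression x y k 2 := by
  classical
  rcases (SimpleGraph.rooted_of_isTwoConnected hxy hconn hdeg hsum).good with ⟨a, ha⟩ | ⟨a, ha⟩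
  · refine Or.inl ⟨a + 2, ?_⟩
    choose P hP using fun i : Fin (k + 1) =>
      SimpleGraph.exists_path_of_mem_lens hxy (ha i (Nat.le_of_lt_succ i.2))
    exact ⟨P, fun i => by rw [hP]; omega⟩
  · refine Or.inr ⟨a + 2, ?_⟩
    choose P hP using fun i : Fin k => SimpleGraph.exists_path_of_mem_lens hxy (ha i i.2)
    exact ⟨P, fun i => by rw [hP]; omega⟩
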